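/- **Setting.** Let $\Omega\subset\mathbb R^2$ carry a regular (conforming) triangulation $\mathcal T$ into nondegenerate triangles whose union has interior $\Omega$ (for instance a bounded polygonal Lipschitz domain), shape regular with parameter $\kappa$: every $T\in\mathcal T$ contains a ball of some radius $r_T>0$ with $h_T:=\operatorname{diam}T\le\kappa r_T$. Let $\nu>0$, $f\in L^2(\Omega)^2$, and let $u\in H^1(\Omega)^2$, $p\in L^2_0(\Omega)$ be the weak solution of $-\nu\Delta u+\nabla p=f$, $\operatorname{div}u=0$ in $\Omega$, $u=u_D$ on $\partial\Omega$ (where $u_D\in H^1(\Omega)^2$), i.e. $u-u_D\in V:=H^1_0(\Omega)^2$, $\operatorname{div}u=0$ and $\nu(\nabla u,\nabla v)-(p,\operatorname{div}v)=(f,v)$ for all $v\in V$. Let $V_h\subseteq V$ be a space of piecewise polynomials of degree at most $m$ with respect to $\mathcal T$, $Q_h\subseteq L^2_0(\Omega)$ a space of piecewise polynomials of bounded degree, and $V_{0,h}:=\{v_h\in V_h:(q_h,\operatorname{div}v_h)=0\ \forall q_h\in Q_h\}$. Let $u_h\in u_{D,h}+V_h$ with $u_{D,h}\in H^1(\Omega)^2$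 piecewise polynomial of degree at most $m$ (in particular $u_h$ may be the discrete velocity of the classical or of the pressure-robust method), and let $\Pi:V_h\to H(\operatorname{div},\Omega)$ be linear. For a linear functional $\ell$ on $V_h$ put $\|\ell\|_\star:=\sup_{v_h\in V_{0,h}\setminus\{0\}}\ell(v_h)/\|\nabla v_h\|_{L^2}$ (and $0$ if $V_{0,h}=\{0\}$). Let $\Delta_{\mathcal T}$ be the piecewise Laplacian, $\mathcal E^\circ$ the set of inner edges (edges shared by two triangles), $n_E$ a unit normal of $E$ with arbitrary but fixed orientation, $[\cdot]$ the jump across $E$, $h_E$ the length of $E$, $h_{\mathcal T}|_T:=h_T$ and $h_{\mathcal E}|_E:=h_E$. For a finite family $\mathcal S$ of sets $K$ with diameters $h_K$, let $\operatorname{osc}_k(g,\mathcal S)^2:=\sum_{K\in\mathcal S}h_K^2\|(1-\pi_{P_k(K)})g\|_{L^2(K)}^2$, where $\pi_{P_k(K)}$ is the $L^2(K)$-best approximation by polynomials of degree at most $k$ (componentwise). **Local orthogonality of $\Pi$** (order $r\ge1$, constant $c$, family $\mathcal K$): $\mathcal K$ is a finite family of unions $K$ of triangles of $\mathcal T$,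 such that each triangle belongs to at most $M$ members and $h_K\le M h_T$ whenever $T$ is a triangle of $K\in\mathcal K$ (e.g. $\mathcal K=\mathcal T$, or the vertex patches of a shape-regular triangulation of a Lipschitz domain, with $M$ depending on $\kappa$ only); and for each $v_h\in V_{0,h}$ there are $\sigma_K\in L^2(\Omega)^2$ vanishing outside $K$ with $(1-\Pi)v_h=\sum_{K\in\mathcal K}\sigma_K$, $\|\sigma_K\|_{L^2(K)}\le c\,h_K\|\nabla v_h\|_{L^2(K)}$ and $\int_K\sigma_K\cdot g\,dx=0$ for all $g\in P_{r-1}(K)^2$. **Theorem (efficiency for $\sigma=\nabla u_h$).** For all $\kappa$, $m$ and $k\ge 0$ there is a constant $C>0$, depending only on $\kappa,m,k$, and for all $M,c$ a constant $C'>0$, depending only on $\kappa,m,k,M,c$, such that in the above setting the following holds. (a) If $u_{D,h}=u_D$ on $\partial\Omega$, i.e. $u_D-u_{D,h}\in H^1_0(\Omega)^2$, then $\|\operatorname{div}u_h\|_{L^2}\le\|\nabla(u-u_h)\|_{L^2}$. (b) For all $q\in H^1(\Omega)$, $$\nu^{-1}\|h_{\mathcal T}(f-\nabla q+\nu\Delta_{\mathcal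 T}u_h)\|_{L^2}\le C\Big(\|\nabla(u-u_h)\|_{L^2}+\nu^{-1}\big(\|p-q\|_{L^2}+\operatorname{osc}_k(f-\nabla q,\mathcal T)\big)\Big).$$ (c) If $p\in H^1(\Omega)$, then $$\nu^{-1}\|h_{\mathcal E}^{1/2}[\nu\nabla u_h\,n_E]\|_{L^2(\bigcup\mathcal E^\circ)}\le C\Big(\|\nabla(u-u_h)\|_{L^2}+\nu^{-1}\operatorname{osc}_k(f-\nabla p,\mathcal T)\Big).$$ (d) If $p\in H^1(\Omega)$ and $\Pi$ has the local orthogonality property of order $r$ with constant $c$ on a family $\mathcal K$ as above, then $\|\Delta_{\mathcal T}u_h\circ(1-\Pi)\|_{V_{0,h}^\star}:=\|\,v_h\mapsto\int_\Omega\Delta_{\mathcal T}u_h\cdot(1-\Pi)v_h\,dx\,\|_\star$ satisfies $$\|\Delta_{\mathcal T}u_h\circ(1-\Pi)\|_{V_{0,h}^\star}\le C'\Big(\|\nabla(u-u_h)\|_{L^2}+\nu^{-1}\big(\operatorname{osc}_k(f-\nabla p,\mathcal T)+\operatorname{osc}_{r-1}(f-\nabla p,\mathcal K)\big)\Big).$$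 (e) For $q\in L^2(\Omega)$ let $\|\nabla q\|_{(\Pi V_{0,h})^\star}:=\|\,v_h\mapsto\int_\Omega q\operatorname{div}(\Pi v_h)\,dx\,\|_\star$. If $\operatorname{div}(\Pi v_h)=0$ for all $v_h\in V_{0,h}$, then $\|\nabla q\|_{(\Pi V_{0,h})^\star}=0$. If $\Pi=1$, then $\|\nabla q\|_{(\Pi V_{0,h})^\star}\le\min_{q_h\in Q_h}\|q-q_h\|_{L^2}$, and the minimum is attained. For $q\in H^1(\Omega)$ both statements also hold with the functional $v_h\mapsto\int_\Omega\nabla q\cdot\Pi v_h\,dx$ in place of $v_h\mapsto\int_\Omega q\operatorname{div}(\Pi v_h)\,dx$, the first one provided that in addition $\Pi v_h\cdot n=0$ on $\partial\Omega$ for all $v_h\in V_{0,h}$. -/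

import Mathlib

open MeasureTheory Filter Topology
open scoped ENNReal ContDiff

noncomputable section

namespace StokesFE

/-! ### Lebesgue and Sobolev spaces on an open set of the plane -/

/-- The Euclidean plane. -/
abbrev Plane : Type := EuclideanSpace ℝ (Fin 2)

/-- The real Hilbert space `L²(Ω)`. -/
abbrev L2 (Ω : Set Plane) : Type := Lp ℝ 2 (volume.restrict Ω)

/-- `L²(Ω)²`, componentwise. Its norm is `vecNorm` below (never the supremum norm of `Fin 2 → _`). -/
abbrev L2v (Ω : Set Plane) : Type := Fin 2 → L2 Ω

/-- Test functions, `C_c^∞(Ω)`. -/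
structure IsTest (Ω : Set Plane) (φ : Plane → ℝ) : Prop where
  smooth : ContDiff ℝ ∞ φ
  compact : HasCompactSupport φ
  supp : tsupport φ ⊆ Ω

/-- The classical partial derivative `∂φ/∂x_j`. -/
def partialDeriv (j : Fin 2) (φ : Plane → ℝ) (x : Plane) : ℝ :=
  fderiv ℝ φ x (EuclideanSpace.single j 1)

theorem IsTest.memLp {Ω : Set Plane} {φ : Plane → ℝ} (h : IsTest Ω φ) (μ : Measure Plane)
    [IsFiniteMeasureOnCompacts μ] : MemLp φ 2 μ :=
  h.smooth.continuous.memLp_of_hasCompactSupport h.compact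

theorem IsTest.memLp_partialDeriv {Ω : Set Plane} {φ : Plane → ℝ} (h : IsTest Ω φ) (j : Fin 2)
    (μ : Measure Plane) [IsFiniteMeasureOnCompacts μ] : MemLp (partialDeriv j φ) 2 μ := by
  have hc : Continuous (partialDeriv j φ) :=
    (h.smooth.continuous_fderiv (by simp)).clm_apply continuous_const
  exact hc.memLp_of_hasCompactSupport (h.compact.fderiv_apply (𝕜 := ℝ) _)

theorem integral_add_mul {Ω : Set Plane} (a b : L2 Ω) {ψ : Plane → ℝ}
    (hψ : MemLp ψ 2 (volume.restrict Ω)) :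
    ∫ x in Ω, (a + b : L2 Ω) x * ψ x = (∫ x in Ω, a x * ψ x) + ∫ x in Ω, b x * ψ x := by
  have ha : Integrable (fun x => a x * ψ x) (volume.restrict Ω) := (Lp.memLp a).integrable_mul hψ
  have hb : Integrable (fun x => b x * ψ x) (volume.restrict Ω) := (Lp.memLp b).integrable_mul hψ
  rw [← integral_add ha hb]
  refine integral_congr_ae ?_
  filter_upwards [Lp.coeFn_add a b] with x hx
  rw [hx, Pi.add_apply, add_mul]

theorem integral_smul_mul {Ω : Set Plane} (c : ℝ) (a : L2 Ω) (ψ : Plane → ℝ) :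
    ∫ x in Ω, (c • a : L2 Ω) x * ψ x = c * ∫ x in Ω, a x * ψ x := by
  rw [← integral_const_mul]
  refine integral_congr_ae ?_
  filter_upwards [Lp.coeFn_smul c a] with x hx
  rw [hx, Pi.smul_apply, smul_eq_mul, mul_assoc]

theorem integral_zero_mul {Ω : Set Plane} (ψ : Plane → ℝ) :
    ∫ x in Ω, (0 : L2 Ω) x * ψ x = 0 := by
  simpa using integral_smul_mul (0 : ℝ) (0 : L2 Ω) ψ

/-- `H¹(Ω)`, as the graph of the weak gradient: the pairs `(w, g)` with `w ∈ L²(Ω)`, `g ∈ L²(Ω)²`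
and `∫_Ω w ∂_jφ = -∫_Ω g_j φ` for all test functions `φ` and `j = 1, 2`. (The second component is
determined by the first one.) -/
def H1 (Ω : Set Plane) : Submodule ℝ (L2 Ω × L2v Ω) where
  carrier := {w | ∀ φ, IsTest Ω φ → ∀ j,
    ∫ x in Ω, w.1 x * partialDeriv j φ x = -∫ x in Ω, w.2 j x * φ x}
  add_mem' := by
    intro a b ha hb φ hφ j
    have h1 := integral_add_mul a.1 b.1 (hφ.memLp_partialDeriv j (volume.restrict Ω))
    have h2 := integral_add_mul (a.2 j) (b.2 j) (hφ.memLp (volume.restrict Ω))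
    simp only [Prod.fst_add, Prod.snd_add, Pi.add_apply]
    rw [h1, h2, ha φ hφ j, hb φ hφ j, neg_add]
  zero_mem' := by
    intro φ hφ j
    simp only [Prod.fst_zero, Prod.snd_zero, Pi.zero_apply]
    rw [integral_zero_mul, integral_zero_mul, neg_zero]
  smul_mem' := by
    intro c a ha φ hφ j
    simp only [Prod.smul_fst, Prod.smul_snd, Pi.smul_apply]
    rw [integral_smul_mul, integral_smul_mul, ha φ hφ j, mul_neg]

/-- The `L²` function underlying an element of `H¹(Ω)`. -/
def fn {Ω : Set Plane} (w : H1 Ω) : L2 Ω := w.1.1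

/-- The weak gradient. -/
def grad {Ω : Set Plane} (w : H1 Ω) : L2v Ω := w.1.2

/-- `w ∈ H¹₀(Ω)`: `w` is a limit in `H¹(Ω)` of test functions. -/
def MemH10 {Ω : Set Plane} (w : H1 Ω) : Prop :=
  ∃ φ : ℕ → Plane → ℝ, (∀ n, IsTest Ω (φ n)) ∧
    Tendsto (fun n => eLpNorm (fun x => fn w x - φ n x) 2 (volume.restrict Ω)) atTop (𝓝 0) ∧
    ∀ j, Tendsto (fun n => eLpNorm (fun x => grad w j x - partialDeriv j (φ n) x) 2
      (volume.restrict Ω)) atTop (𝓝 0)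

/-- `H¹(Ω)²`. -/
abbrev H1v (Ω : Set Plane) : Type := Fin 2 → H1 Ω

/-- `w ∈ V = H¹₀(Ω)²`. -/
def MemH10v {Ω : Set Plane} (w : H1v Ω) : Prop := ∀ i, MemH10 (w i)

/-- The `L²(Ω)²` field underlying an element of `H¹(Ω)²`. -/
def vfn {Ω : Set Plane} (w : H1v Ω) : L2v Ω := fun i => fn (w i)

/-- `div w = ∂₁w₁ + ∂₂w₂`. -/
def divergence {Ω : Set Plane} (w : H1v Ω) : L2 Ω := ∑ i, grad (w i) i

/-- `‖g‖_{L²(Ω)}` for a vector field `g`. -/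
def vecNorm {Ω : Set Plane} (g : L2v Ω) : ℝ := √(∑ i, ‖g i‖ ^ 2)

/-- `(g, w) = ∫_Ω g · w` for vector fields. -/
def vecInner {Ω : Set Plane} (g w : L2v Ω) : ℝ := ∑ i, inner ℝ (g i) (w i)

/-- `‖∇w‖_{L²(Ω)}` (Frobenius norm of the velocity gradient). -/
def gradNorm {Ω : Set Plane} (w : H1v Ω) : ℝ := √(∑ i, ∑ j, ‖grad (w i) j‖ ^ 2)

/-- `‖∇w‖_{L²(K)}`, for a set `K`. -/
def gradNormOn {Ω : Set Plane} (K : Set Plane) (w : H1v Ω) : ℝ :=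
  √(∑ i, ∑ j, ∫ x in K, grad (w i) j x ^ 2)

/-- `H(div, Ω)`, as the graph of the weak divergence: the pairs `(w, d)` with `w ∈ L²(Ω)²`,
`d ∈ L²(Ω)` and `∫_Ω w · ∇φ = -∫_Ω d φ` for all test functions `φ`. -/
def Hdiv (Ω : Set Plane) : Submodule ℝ (L2v Ω × L2 Ω) where
  carrier := {w | ∀ φ, IsTest Ω φ →
    ∑ j, ∫ x in Ω, w.1 j x * partialDeriv j φ x = -∫ x in Ω, w.2 x * φ x}
  add_mem' := by
    intro a b ha hb φ hφ
    have h1 := fun j => integral_add_mul (a.1 j) (b.1 j) (hφ.memLp_partialDeriv j (volume.restrict Ω))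
    have h2 := integral_add_mul a.2 b.2 (hφ.memLp (volume.restrict Ω))
    simp only [Prod.fst_add, Prod.snd_add, Pi.add_apply, h1, h2, Finset.sum_add_distrib]
    rw [ha φ hφ, hb φ hφ, neg_add]
  zero_mem' := by
    intro φ hφ
    simp only [Prod.fst_zero, Prod.snd_zero, Pi.zero_apply, integral_zero_mul,
      Finset.sum_const_zero, neg_zero]
  smul_mem' := by
    intro c a ha φ hφ
    simp only [Prod.smul_fst, Prod.smul_snd, Pi.smul_apply, integral_smul_mul, ← Finset.mul_sum]
    rw [ha φ hφ, mul_neg]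

/-- The field underlying an element of `H(div, Ω)`. -/
def hfn {Ω : Set Plane} (w : Hdiv Ω) : L2v Ω := w.1.1

/-- The weak divergence of an element of `H(div, Ω)`. -/
def hdiv {Ω : Set Plane} (w : Hdiv Ω) : L2 Ω := w.1.2

/-- `w · n = 0` along `∂Ω`, in the weak sense: Green's formula holds without boundary term against
every function of `H¹(Ω)`. -/
def ZeroNormalTrace {Ω : Set Plane} (w : Hdiv Ω) : Prop :=
  ∀ φ : H1 Ω, vecInner (hfn w) (grad φ) + inner ℝ (hdiv w) (fn φ) = 0

/-! ### The Stokes problem -/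

/-- `(u, p) ∈ H¹(Ω)² × L²₀(Ω)` is the weak solution of `-ν Δu + ∇p = f`, `div u = 0` in `Ω`,
`u = u_D` along `∂Ω`. -/
structure IsStokesSolution {Ω : Set Plane} (ν : ℝ) (f : L2v Ω) (uD u : H1v Ω) (p : L2 Ω) :
    Prop where
  boundary : MemH10v (u - uD)
  mean_zero : ∫ x in Ω, p x = 0
  momentum : ∀ v : H1v Ω, MemH10v v →
    ν * ∑ i, vecInner (grad (u i)) (grad (v i)) - inner ℝ p (divergence v) = vecInner f (vfn v)
  div_free : divergence u = 0

/-! ### Triangulations -/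

/-- The closed triangle (or edge) with a given set of vertices. -/
def hull (T : Finset Plane) : Set Plane := convexHull ℝ (T : Set Plane)

/-- A regular (conforming) triangulation of `Ω` into nondegenerate closed triangles, each one given
by its vertices; two of them meet in the hull of their common vertices, and `Ω` is the interior of
their union. -/
structure Triangulation (Ω : Set Plane) where
  cells : Finset (Finset Plane)
  card_eq : ∀ T ∈ cells, T.card = 3
  nondegenerate : ∀ T ∈ cells, AffineIndependent ℝ ((↑) : T → Plane)
  conforming : ∀ T ∈ cells, ∀ S ∈ cells,
    hull T ∩ hull S = convexHull ℝ ((T : Set Plane) ∩ (S : Set Plane))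
  domain_eq : interior (⋃ T ∈ cells, hull T) = Ω

/-- Shape regularity: every cell `T` contains a ball of radius `r` with `h_T ≤ κ r`. -/
def ShapeRegular {Ω : Set Plane} (𝒯 : Triangulation Ω) (κ : ℝ) : Prop :=
  ∀ T ∈ 𝒯.cells, ∃ (c : Plane) (r : ℝ), 0 < r ∧ Metric.closedBall c r ⊆ hull T ∧
    Metric.diam (hull T) ≤ κ * r

open scoped Classical in
/-- The inner edges: the pairs of vertices that belong to two different cells. -/
def innerEdges {Ω : Set Plane} (𝒯 : Triangulation Ω) : Finset (Finset Plane) :=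
  (𝒯.cells.biUnion fun T => T.powersetCard 2).filter
    fun e => ∃ T ∈ 𝒯.cells, ∃ S ∈ 𝒯.cells, T ≠ S ∧ e ⊆ T ∧ e ⊆ S

/-- An arbitrary but fixed choice, for each inner edge `e`, of a unit normal vector and of a labelling
`T₊`, `T₋` of the two cells that share `e`. -/
structure EdgeOrientation {Ω : Set Plane} (𝒯 : Triangulation Ω) where
  normal : Finset Plane → Plane
  plus : Finset Plane → Finset Plane
  minus : Finset Plane → Finset Plane
  norm_normal : ∀ e ∈ innerEdges 𝒯, ‖normal e‖ = 1
  normal_perp : ∀ e ∈ innerEdges 𝒯, ∀ a ∈ e, ∀ b ∈ e, inner ℝ (normal e) (a - b) = 0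
  plus_mem : ∀ e ∈ innerEdges 𝒯, plus e ∈ 𝒯.cells ∧ e ⊆ plus e
  minus_mem : ∀ e ∈ innerEdges 𝒯, minus e ∈ 𝒯.cells ∧ e ⊆ minus e
  plus_ne_minus : ∀ e ∈ innerEdges 𝒯, plus e ≠ minus e

/-! ### Piecewise polynomials -/

/-- Polynomials in two variables. -/
abbrev Poly2 : Type := MvPolynomial (Fin 2) ℝ

/-- The value of a polynomial at a point of the plane. -/
def pval (P : Poly2) (x : Plane) : ℝ := MvPolynomial.eval (fun j => x j) P

/-- `w ∈ P_m(𝒯)`, with `w = P T` on each cell `T`. -/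
def IsPiecewise {Ω : Set Plane} (𝒯 : Triangulation Ω) (m : ℕ) (P : Finset Plane → Poly2)
    (w : L2 Ω) : Prop :=
  ∀ T ∈ 𝒯.cells, (P T).totalDegree ≤ m ∧
    (w : Plane → ℝ) =ᵐ[volume.restrict (hull T)] pval (P T)

/-- `w ∈ P_m(𝒯)`. -/
def MemPoly {Ω : Set Plane} (𝒯 : Triangulation Ω) (m : ℕ) (w : L2 Ω) : Prop :=
  ∃ P, IsPiecewise 𝒯 m P w

/-- `w ∈ P_m(𝒯)²`, with `w_i = W i T` on each cell `T`. -/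
def IsPiecewiseV {Ω : Set Plane} (𝒯 : Triangulation Ω) (m : ℕ)
    (W : Fin 2 → Finset Plane → Poly2) (w : H1v Ω) : Prop :=
  ∀ i, IsPiecewise 𝒯 m (W i) (fn (w i))

/-- The Laplacian of a polynomial. -/
def polyLaplacian (P : Poly2) : Poly2 := ∑ j, MvPolynomial.pderiv j (MvPolynomial.pderiv j P)

/-- The piecewise Laplacian `Δ_𝒯` of the piecewise polynomial given by the polynomials `P T`
(set to zero on the edges, a null set). -/
def brokenLaplacian {Ω : Set Plane} (𝒯 : Triangulation Ω) (P : Finset Plane → Poly2)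
    (x : Plane) : ℝ :=
  ∑ T ∈ 𝒯.cells, (interior (hull T)).indicator (pval (polyLaplacian (P T))) x

/-- `‖(1 - π_{P_k(K)}) g‖²_{L²(K)}`, where `π_{P_k(K)}` is the `L²(K)`-best approximation by
polynomials of degree at most `k`. -/
def bestApproxErrorSq {Ω : Set Plane} (k : ℕ) (K : Set Plane) (g : L2 Ω) : ℝ :=
  ⨅ P : {P : Poly2 // P.totalDegree ≤ k}, ∫ x in K, (g x - pval P.1 x) ^ 2

/-! ### Finite element spaces -/

/-- A pair of finite element spaces `V_h ⊆ P_m(𝒯)² ∩ H¹₀(Ω)²` and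
`Q_h ⊆ L²₀(Ω)`, `Q_h` consisting of piecewise polynomials of bounded degree. -/
structure FEPair {Ω : Set Plane} (𝒯 : Triangulation Ω) (m : ℕ) where
  V : Submodule ℝ (H1v Ω)
  Q : Submodule ℝ (L2 Ω)
  V_boundary : ∀ v ∈ V, MemH10v v
  V_poly : ∀ v ∈ V, ∀ i, MemPoly 𝒯 m (fn (v i))
  Q_mean_zero : ∀ q ∈ Q, ∫ x in Ω, q x = 0
  Q_poly : ∃ l, ∀ q ∈ Q, MemPoly 𝒯 l q

/-- `V_{0,h}`: the `v_h ∈ V_h` whose divergence has zero `L²`-projection onto `Q_h`. -/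
def FEPair.V0 {Ω : Set Plane} {𝒯 : Triangulation Ω} {m : ℕ} (X : FEPair 𝒯 m) : Set X.V :=
  {v | ∀ q ∈ X.Q, inner ℝ q (divergence v.1) = 0}

/-- The discrete dual norm `sup { ℓ(v_h) / ‖∇v_h‖ : v_h ∈ V_{0,h} \ {0} }` of a (linear)
functional `ℓ`, as an extended nonnegative number; it is `0` if `V_{0,h} = {0}`. -/
def FEPair.dualNorm {Ω : Set Plane} {𝒯 : Triangulation Ω} {m : ℕ} (X : FEPair 𝒯 m)
    (ℓ : X.V → ℝ) : ℝ≥0∞ :=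
  ⨆ v ∈ {v : X.V | v ∈ X.V0 ∧ v ≠ 0}, ENNReal.ofReal (ℓ v / gradNorm v.1)

/-- The reconstruction operator `Π = R : V_h → H(div, Ω)` maps discretely divergence-free functions onto exactly
divergence-free ones. -/
def MapsToDivFree {Ω : Set Plane} {𝒯 : Triangulation Ω} {m : ℕ} (X : FEPair 𝒯 m)
    (R : X.V →ₗ[ℝ] Hdiv Ω) : Prop :=
  ∀ v ∈ X.V0, hdiv (R v) = 0

/-- The case `Π = 1`. -/
def IsIdentity {Ω : Set Plane} {𝒯 : Triangulation Ω} {m : ℕ} (X : FEPair 𝒯 m)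
    (R : X.V →ₗ[ℝ] Hdiv Ω) : Prop :=
  ∀ v, hfn (R v) = vfn v.1

/-- The subdomain covered by a set of cells. -/
def patch (K : Finset (Finset Plane)) : Set Plane := ⋃ T ∈ K, hull T

/-- A family `𝒦` of patches of cells with overlap and size ratios bounded by `M`: each cell belongs
to at most `M` patches, and `h_K ≤ M h_T` for each cell `T` of a patch `K`. -/
structure IsPatchFamily {Ω : Set Plane} (𝒯 : Triangulation Ω) (M : ℕ)
    (𝒦 : Finset (Finset (Finset Plane))) : Prop where
  subset : ∀ K ∈ 𝒦, K ⊆ 𝒯.cells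
  overlap : ∀ T ∈ 𝒯.cells, {K | K ∈ 𝒦 ∧ T ∈ K}.ncard ≤ M
  size : ∀ K ∈ 𝒦, ∀ T ∈ K, Metric.diam (patch K) ≤ M * Metric.diam (hull T)

/-- The local splitting and orthogonality property of `Π = R` on the patches `𝒦`, of order `r`, with
constant `c`: for `v_h ∈ V_{0,h}`, `(1 - Π) v_h = ∑_K σ_K` where `σ_K` vanishes outside of `K`,
`‖σ_K‖_{L²(K)} ≤ c h_K ‖∇v_h‖_{L²(K)}` and `∫_K σ_K · g = 0` for all `g ∈ P_{r-1}(K)²`. -/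
def LocallyOrthogonal {Ω : Set Plane} {𝒯 : Triangulation Ω} {m : ℕ} (X : FEPair 𝒯 m)
    (R : X.V →ₗ[ℝ] Hdiv Ω) (𝒦 : Finset (Finset (Finset Plane))) (r : ℕ) (c : ℝ) : Prop :=
  ∀ v ∈ X.V0, ∃ σ : Finset (Finset Plane) → L2v Ω,
    vfn v.1 - hfn (R v) = ∑ K ∈ 𝒦, σ K ∧
    ∀ K ∈ 𝒦,
      (∀ i, ∀ᵐ x ∂(volume.restrict Ω), x ∉ patch K → σ K i x = 0) ∧
      vecNorm (σ K) ≤ c * Metric.diam (patch K) * gradNormOn (patch K) v.1 ∧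
      ∀ g : Fin 2 → Poly2, (∀ i, (g i).totalDegree ≤ r - 1) →
        ∑ i, ∫ x in patch K, σ K i x * pval (g i) x = 0

/-! ### Terms of the error estimator for `σ = ∇u_h`

Here `U i T` is the polynomial that represents the `i`-th component of `u_h` on the cell `T`. -/

/-- `osc_k(g, 𝒯)`. -/
def osc {Ω : Set Plane} (𝒯 : Triangulation Ω) (k : ℕ) (g : L2v Ω) : ℝ :=
  √(∑ T ∈ 𝒯.cells, Metric.diam (hull T) ^ 2 * ∑ i, bestApproxErrorSq k (hull T) (g i))

/-- `osc_k(g, 𝒦)`. -/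
def oscPatch {Ω : Set Plane} (𝒦 : Finset (Finset (Finset Plane))) (k : ℕ) (g : L2v Ω) : ℝ :=
  √(∑ K ∈ 𝒦, Metric.diam (patch K) ^ 2 * ∑ i, bestApproxErrorSq k (patch K) (g i))

/-- `η_vol = ‖h_𝒯 (g + ν Δ_𝒯 u_h)‖_{L²}`, to be used with `g = f - ∇q`. -/
def etaVol {Ω : Set Plane} (𝒯 : Triangulation Ω) (ν : ℝ) (g : L2v Ω)
    (U : Fin 2 → Finset Plane → Poly2) : ℝ :=
  √(∑ T ∈ 𝒯.cells, Metric.diam (hull T) ^ 2 *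
    ∑ i, ∫ x in hull T, (g i x + ν * brokenLaplacian 𝒯 (U i) x) ^ 2)

/-- The `i`-th component of the jump `[∇u_h n_e]` across the inner edge `e`. -/
def normalJump {Ω : Set Plane} {𝒯 : Triangulation Ω} (o : EdgeOrientation 𝒯)
    (U : Fin 2 → Finset Plane → Poly2) (e : Finset Plane) (i : Fin 2) (x : Plane) : ℝ :=
  ∑ j, (pval (MvPolynomial.pderiv j (U i (o.plus e))) x -
    pval (MvPolynomial.pderiv j (U i (o.minus e))) x) * o.normal e j

/-- `η_jump = ‖h_ℰ^{1/2} [ν ∇u_h n_E]‖_{L²(⋃ ℰ°)}`; the edge integrals are taken with respect to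
arc length, the one-dimensional Hausdorff measure. -/
def etaJump {Ω : Set Plane} {𝒯 : Triangulation Ω} (o : EdgeOrientation 𝒯) (ν : ℝ)
    (U : Fin 2 → Finset Plane → Poly2) : ℝ :=
  √(∑ e ∈ innerEdges 𝒯, Metric.diam (hull e) *
    ∑ i, ∫ x in hull e, (ν * normalJump o U e i x) ^ 2 ∂(Measure.hausdorffMeasure 1))

/-- `‖Δ_𝒯 u_h ∘ (1 - Π)‖_{V_{0,h}^⋆}`. -/
def consistency1 {Ω : Set Plane} {𝒯 : Triangulation Ω} {m : ℕ} (X : FEPair 𝒯 m)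
    (R : X.V →ₗ[ℝ] Hdiv Ω) (U : Fin 2 → Finset Plane → Poly2) : ℝ≥0∞ :=
  X.dualNorm fun v =>
    ∑ i, ∫ x in Ω, brokenLaplacian 𝒯 (U i) x * (vfn v.1 i x - hfn (R v) i x)

/-- `‖∇q‖_{(Π V_{0,h})^⋆}` for `q ∈ L²(Ω)`, where `∇q` acts as the functional `w ↦ ∫_Ω q div w`. -/
def consistency2 {Ω : Set Plane} {𝒯 : Triangulation Ω} {m : ℕ} (X : FEPair 𝒯 m)
    (R : X.V →ₗ[ℝ] Hdiv Ω) (q : L2 Ω) : ℝ≥0∞ :=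
  X.dualNorm fun v => inner ℝ q (hdiv (R v))

/-- `‖∇q‖_{(Π V_{0,h})^⋆}` for `q ∈ H¹(Ω)`, where `∇q` acts as the functional `w ↦ ∫_Ω ∇q · w`. -/
def consistency2Grad {Ω : Set Plane} {𝒯 : Triangulation Ω} {m : ℕ} (X : FEPair 𝒯 m)
    (R : X.V →ₗ[ℝ] Hdiv Ω) (q : H1 Ω) : ℝ≥0∞ :=
  X.dualNorm fun v => vecInner (grad q) (hfn (R v))

end StokesFE

end

open StokesFE

/-!
The proof is the residual and bubble-function technique for the Stokes equations. Every test
function of the momentum equation is smooth with compact support in `Ω`, so that neither traces nor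
embedding theorems are needed.

Testing with a smooth `φ` and integrating `∇q` by parts gives the residual identity
`IsStokesSolution.residual`, in which only `f - ∇q`, `∇u` and `p - q` occur.

*Volume term.* Let `φ` be supported in the interior of a cell `T`. There `u_h` is a polynomial, so
that the identity becomes `∫ (f - ∇q + ν Δu_h) φ = ν ∫ ∇(u - u_h) · ∇φ - ∫ (p - q) ∂φ`, one
component at a time. Given a polynomial `P` of degree at most `k` in place of `f - ∇q`, let `φ` be
the polynomial `P + ν Δu_h` times a smooth bump on the disc `B(c, r)` in `T` that shape regularity
provides. All norms on polynomials of bounded degree are equivalent, and `T` lies in a disc of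
radius `κ r` about `c`. Hence `exists_bubble_bound` controls `P + ν Δu_h` on all of `T` by its norm
on a small disc where the bump is one, and `∇φ` by an inverse inequality. The result is
`exists_volume_bound`; the infimum over `P` produces the oscillation.

*Jump term.* Here `q = p`. The barycentric coordinates of a cell that contains a disc of radius `r`
have Lipschitz constant at most `1 / (2r)`. Therefore, in a disc about the midpoint of an inner
edge `e`, of radius comparable to `h_e`, the two cells at `e` are the two half-discs
(`exists_sides`). The normal jump of `∇u_h` is a polynomial on the line through `e`; it is extended
constantly in the normal direction and multiplied by a bump on that disc. Green's formula on the
half-discs (`IsFrame.green_edge`) turns the residual identity into one for the jump, and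
`exists_jump_local` bounds the jump by the volume residual and the velocity error on the two cells.
Each cell has three edges, and the sum over the inner edges is `exists_jump_bound`.

*Consistency terms.* If `(1 - Π) v = ∑_K σ_K`, then
`ν Δu_h · σ_K = (f - ∇p + ν Δu_h) · σ_K - (f - ∇p) · σ_K`. The first part is controlled by the
volume term, the second one by the oscillation, because `σ_K` is orthogonal to polynomials
(`LocallyOrthogonal.laplacian_le`). The bounds for `∇q` use the definition of `V_{0,h}` and
`‖div v‖ ≤ ‖∇v‖` on `H¹₀(Ω)²` (`norm_divergence_le`), which gives the divergence estimate as well.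
-/

namespace StokesFE

/-! ### Test functions and weak derivatives -/

section TestFunctions

variable {Ω : Set Plane} {φ ψ : Plane → ℝ}

theorem contDiff_partialDeriv (h : ContDiff ℝ ∞ φ) (j : Fin 2) :
    ContDiff ℝ ∞ (partialDeriv j φ) :=
  (h.fderiv_right (m := ∞) (by simp)).clm_apply contDiff_const

theorem partialDeriv_eq_zero_of_notMem_tsupport {x : Plane} (j : Fin 2) (hx : x ∉ tsupport φ) :
    partialDeriv j φ x = 0 := by
  have : fderiv ℝ φ x = 0 := by
    by_contra h
    exact hx (support_fderiv_subset ℝ h)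
  simp [partialDeriv, this]

theorem tsupport_partialDeriv_subset (j : Fin 2) :
    tsupport (partialDeriv j φ) ⊆ tsupport φ :=
  closure_minimal (fun _ hx => by
    by_contra h
    exact hx (partialDeriv_eq_zero_of_notMem_tsupport j h)) (isClosed_tsupport φ)

theorem hasCompactSupport_partialDeriv (h : HasCompactSupport φ) (j : Fin 2) :
    HasCompactSupport (partialDeriv j φ) :=
  h.of_isClosed_subset (isClosed_tsupport _) (tsupport_partialDeriv_subset j)

theorem IsTest.partialDeriv (h : IsTest Ω φ) (j : Fin 2) : IsTest Ω (partialDeriv j φ) :=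
  ⟨contDiff_partialDeriv h.smooth j, hasCompactSupport_partialDeriv h.compact j,
    (tsupport_partialDeriv_subset j).trans h.supp⟩

theorem IsTest.mono {Ω' : Set Plane} (h : IsTest Ω φ) (hΩ : Ω ⊆ Ω') : IsTest Ω' φ :=
  ⟨h.smooth, h.compact, h.supp.trans hΩ⟩

theorem IsTest.eq_zero_of_notMem (h : IsTest Ω φ) {x : Plane} (hx : x ∉ Ω) : φ x = 0 :=
  image_eq_zero_of_notMem_tsupport fun h' => hx (h.supp h')

theorem IsTest.integrable_mul_continuous (h : IsTest Ω φ) {g : Plane → ℝ} (hg : Continuous g)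
    (μ : Measure Plane) [IsFiniteMeasureOnCompacts μ] : Integrable (fun x => g x * φ x) μ :=
  (hg.mul h.smooth.continuous).integrable_of_hasCompactSupport h.compact.mul_left

/-- Partial derivatives of smooth functions commute. -/
theorem partialDeriv_comm (h : ContDiff ℝ ∞ φ) (i j : Fin 2) :
    partialDeriv i (partialDeriv j φ) = partialDeriv j (partialDeriv i φ) := by
  funext x
  have hd : DifferentiableAt ℝ (fderiv ℝ φ) x :=
    ((h.fderiv_right (m := ∞) (by simp)).differentiable (by simp)).differentiableAt
  have key : ∀ a b : Fin 2, partialDeriv a (partialDeriv b φ) x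
      = fderiv ℝ (fderiv ℝ φ) x (EuclideanSpace.single a 1) (EuclideanSpace.single b 1) := by
    intro a b
    unfold StokesFE.partialDeriv
    rw [fderiv_clm_apply hd (differentiableAt_const _)]
    simp
  rw [key, key]
  exact (h.contDiffAt.isSymmSndFDerivAt (by simp; exact WithTop.coe_le_coe.2 le_top)).eq _ _

/-- Integration by parts on the whole plane, one factor having compact support. -/
theorem integral_mul_partialDeriv (hφ : ContDiff ℝ ∞ φ) (hψ : ContDiff ℝ ∞ ψ)
    (hc : HasCompactSupport ψ) (j : Fin 2) :
    ∫ x, φ x * partialDeriv j ψ x = -∫ x, partialDeriv j φ x * ψ x := by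
  have h1 := (contDiff_partialDeriv hφ j).continuous
  have h2 := (contDiff_partialDeriv hψ j).continuous
  have h3 := hasCompactSupport_partialDeriv hc j
  exact integral_mul_fderiv_eq_neg_fderiv_mul_of_integrable
    ((h1.mul hψ.continuous).integrable_of_hasCompactSupport hc.mul_left)
    ((hφ.continuous.mul h2).integrable_of_hasCompactSupport h3.mul_left)
    ((hφ.continuous.mul hψ.continuous).integrable_of_hasCompactSupport hc.mul_left)
    (fun x _ => (hφ.differentiable (by simp)).differentiableAt)
    (fun x _ => (hψ.differentiable (by simp)).differentiableAt)

theorem IsTest.setIntegral_mul_eq (h : IsTest Ω φ) (g : Plane → ℝ) :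
    ∫ x in Ω, g x * φ x = ∫ x, g x * φ x :=
  setIntegral_eq_integral_of_forall_compl_eq_zero fun x hx => by
    rw [h.eq_zero_of_notMem hx, mul_zero]

theorem inner_eq_integral (a b : L2 Ω) : inner ℝ a b = ∫ x in Ω, a x * b x := by
  rw [L2.inner_def]
  exact integral_congr_ae (Eventually.of_forall fun x => by simp [mul_comm])

theorem inner_toLp {ψ : Plane → ℝ} (a : L2 Ω) (hψ : MemLp ψ 2 (volume.restrict Ω)) :
    inner ℝ a (hψ.toLp ψ) = ∫ x in Ω, a x * ψ x := by
  rw [inner_eq_integral]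
  refine integral_congr_ae ?_
  filter_upwards [hψ.coeFn_toLp] with x hx
  rw [hx]

theorem norm_sq_eq_integral (a : L2 Ω) : ‖a‖ ^ 2 = ∫ x in Ω, a x ^ 2 := by
  rw [← real_inner_self_eq_norm_sq, inner_eq_integral]
  simp only [sq]

/-- A test function as an element of `L²(Ω)`. -/
noncomputable def IsTest.toL2 (h : IsTest Ω φ) : L2 Ω := (h.memLp (volume.restrict Ω)).toLp φ

theorem IsTest.coeFn_toL2 (h : IsTest Ω φ) : h.toL2 =ᵐ[volume.restrict Ω] φ :=
  MemLp.coeFn_toLp _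

theorem IsTest.inner_toL2 (h : IsTest Ω φ) (a : L2 Ω) : inner ℝ a h.toL2 = ∫ x in Ω, a x * φ x :=
  inner_toLp a _

/-- A test function as an element of `H¹(Ω)`. -/
noncomputable def IsTest.toH1 (h : IsTest Ω φ) : H1 Ω :=
  ⟨(h.toL2, fun j => (h.partialDeriv j).toL2), by
    intro ψ hψ j
    have e1 : ∫ x in Ω, h.toL2 x * StokesFE.partialDeriv j ψ x
        = ∫ x in Ω, φ x * StokesFE.partialDeriv j ψ x :=
      integral_congr_ae (by filter_upwards [h.coeFn_toL2] with x hx; rw [hx])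
    have e2 : ∫ x in Ω, (h.partialDeriv j).toL2 x * ψ x
        = ∫ x in Ω, StokesFE.partialDeriv j φ x * ψ x :=
      integral_congr_ae (by filter_upwards [(h.partialDeriv j).coeFn_toL2] with x hx; rw [hx])
    change ∫ x in Ω, h.toL2 x * StokesFE.partialDeriv j ψ x
      = -∫ x in Ω, (h.partialDeriv j).toL2 x * ψ x
    rw [e1, e2, (hψ.partialDeriv j).setIntegral_mul_eq, hψ.setIntegral_mul_eq,
      integral_mul_partialDeriv h.smooth hψ.smooth hψ.compact]⟩

@[simp] theorem IsTest.fn_toH1 (h : IsTest Ω φ) : fn h.toH1 = h.toL2 := rfl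

@[simp] theorem IsTest.grad_toH1 (h : IsTest Ω φ) (j : Fin 2) :
    grad h.toH1 j = (h.partialDeriv j).toL2 := rfl

theorem IsTest.memH10_toH1 (h : IsTest Ω φ) : MemH10 h.toH1 := by
  refine ⟨fun _ => φ, fun _ => h, ?_, fun j => ?_⟩
  · have : eLpNorm (fun x => fn h.toH1 x - φ x) 2 (volume.restrict Ω) = 0 := by
      rw [eLpNorm_congr_ae (g := 0)]
      · simp
      · filter_upwards [h.coeFn_toL2] with x hx
        simp [hx]
    simp only [this]; exact tendsto_const_nhds
  · have : eLpNorm (fun x => grad h.toH1 j x - StokesFE.partialDeriv j φ x) 2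
        (volume.restrict Ω) = 0 := by
      rw [eLpNorm_congr_ae (g := 0)]
      · simp
      · filter_upwards [(h.partialDeriv j).coeFn_toL2] with x hx
        simp [hx]
    simp only [this]; exact tendsto_const_nhds

/-- Elements of `H¹₀(Ω)` are limits of test functions, in `L²(Ω)` together with their gradients. -/
theorem MemH10.exists_tendsto {w : H1 Ω} (hw : MemH10 w) :
    ∃ (φ : ℕ → Plane → ℝ) (h : ∀ n, IsTest Ω (φ n)),
      Tendsto (fun n => (h n).toL2) atTop (𝓝 (fn w)) ∧
      ∀ j, Tendsto (fun n => ((h n).partialDeriv j).toL2) atTop (𝓝 (grad w j)) := by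
  obtain ⟨φ, h, h1, h2⟩ := hw
  refine ⟨φ, h, ?_, fun j => ?_⟩
  · rw [Lp.tendsto_Lp_iff_tendsto_eLpNorm']
    refine h1.congr fun n => ?_
    rw [← eLpNorm_neg]
    refine eLpNorm_congr_ae ?_
    filter_upwards [(h n).coeFn_toL2] with x hx
    simp [hx]
  · rw [Lp.tendsto_Lp_iff_tendsto_eLpNorm']
    refine (h2 j).congr fun n => ?_
    rw [← eLpNorm_neg]
    refine eLpNorm_congr_ae ?_
    filter_upwards [((h n).partialDeriv j).coeFn_toL2] with x hx
    simp [hx]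

theorem inner_fn_partialDeriv (w : H1 Ω) (h : IsTest Ω φ) (j : Fin 2) :
    inner ℝ (fn w) (h.partialDeriv j).toL2 = -inner ℝ (grad w j) h.toL2 := by
  rw [IsTest.inner_toL2, IsTest.inner_toL2]
  exact w.2 φ h j

/-- Integration by parts without boundary term, one factor in `H¹₀(Ω)`. -/
theorem inner_fn_grad (q : H1 Ω) {w : H1 Ω} (hw : MemH10 w) (j : Fin 2) :
    inner ℝ (fn q) (grad w j) = -inner ℝ (grad q j) (fn w) := by
  obtain ⟨φ, h, h1, h2⟩ := hw.exists_tendsto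
  refine tendsto_nhds_unique ((tendsto_const_nhds (x := fn q)).inner (h2 j)) ?_
  exact (((tendsto_const_nhds (x := grad q j)).inner h1).neg).congr
    fun n => (inner_fn_partialDeriv q (h n) j).symm

/-- `(∂_i v, ∂_j w) = (∂_j v, ∂_i w)` as soon as one of the two functions is in `H¹₀(Ω)`: both
sides are `-(v, ∂_i∂_j w)` for a test function `w`. -/
theorem inner_grad_grad_comm (v : H1 Ω) {w : H1 Ω} (hw : MemH10 w) (i j : Fin 2) :
    inner ℝ (grad v i) (grad w j) = inner ℝ (grad v j) (grad w i) := by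
  obtain ⟨φ, h, h1, h2⟩ := hw.exists_tendsto
  refine tendsto_nhds_unique ((tendsto_const_nhds (x := grad v i)).inner (h2 j)) ?_
  refine ((tendsto_const_nhds (x := grad v j)).inner (h2 i)).congr fun n => ?_
  have e1 := inner_fn_partialDeriv v ((h n).partialDeriv j) i
  have e2 := inner_fn_partialDeriv v ((h n).partialDeriv i) j
  have e3 : (((h n).partialDeriv j).partialDeriv i).toL2
      = (((h n).partialDeriv i).partialDeriv j).toL2 := by
    unfold IsTest.toL2
    congr 1
    exact partialDeriv_comm (h n).smooth i j
  rw [e3] at e1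
  linarith

theorem MemH10.add {v w : H1 Ω} (hv : MemH10 v) (hw : MemH10 w) : MemH10 (v + w) := by
  obtain ⟨φ, h, h1, h2⟩ := hv
  obtain ⟨ψ, h', h1', h2'⟩ := hw
  have key : ∀ (a b : L2 Ω) (f g : ℕ → Plane → ℝ),
      (∀ n, MemLp (f n) 2 (volume.restrict Ω)) → (∀ n, MemLp (g n) 2 (volume.restrict Ω)) →
      Tendsto (fun n => eLpNorm (fun x => a x - f n x) 2 (volume.restrict Ω)) atTop (𝓝 0) →
      Tendsto (fun n => eLpNorm (fun x => b x - g n x) 2 (volume.restrict Ω)) atTop (𝓝 0) →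
      Tendsto (fun n => eLpNorm (fun x => (a + b : L2 Ω) x - (f n x + g n x)) 2
        (volume.restrict Ω)) atTop (𝓝 0) := by
    intro a b f g hf hg ha hb
    refine tendsto_of_tendsto_of_tendsto_of_le_of_le tendsto_const_nhds
      (by simpa using ha.add hb) (fun _ => zero_le) fun n => ?_
    refine le_trans (le_of_eq ?_) (eLpNorm_add_le ((Lp.memLp a).sub (hf n)).1
      ((Lp.memLp b).sub (hg n)).1 (by norm_num))
    refine eLpNorm_congr_ae ?_
    filter_upwards [Lp.coeFn_add a b] with x hx
    simp only [hx, Pi.add_apply]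
    ring
  refine ⟨fun n x => φ n x + ψ n x, fun n => ⟨(h n).smooth.add (h' n).smooth,
    (h n).compact.add (h' n).compact,
    (tsupport_add _ _).trans (Set.union_subset (h n).supp (h' n).supp)⟩, ?_, fun j => ?_⟩
  · exact key _ _ φ ψ (fun n => (h n).memLp _) (fun n => (h' n).memLp _) h1 h1'
  · have e : ∀ n, StokesFE.partialDeriv j (fun x => φ n x + ψ n x)
        = fun x => StokesFE.partialDeriv j (φ n) x + StokesFE.partialDeriv j (ψ n) x := by
      intro n
      funext x
      unfold StokesFE.partialDeriv
      rw [fderiv_fun_add ((h n).smooth.differentiable (by simp)).differentiableAt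
        ((h' n).smooth.differentiable (by simp)).differentiableAt]
      rfl
    simp only [e]
    exact key _ _ _ _ (fun n => (h n).memLp_partialDeriv j _)
      (fun n => (h' n).memLp_partialDeriv j _) (h2 j) (h2' j)

theorem gradNorm_sq (w : H1v Ω) : gradNorm w ^ 2 = ∑ i, ∑ j, ‖grad (w i) j‖ ^ 2 :=
  Real.sq_sqrt (by positivity)

theorem gradNorm_nonneg (w : H1v Ω) : 0 ≤ gradNorm w := Real.sqrt_nonneg _

/-- On `H¹₀(Ω)²` the divergence is bounded by the gradient with constant one, because
`‖∇w‖² = ‖div w‖² + ‖curl w‖²` there. -/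
theorem norm_divergence_le {w : H1v Ω} (hw : MemH10v w) : ‖divergence w‖ ≤ gradNorm w := by
  refine Real.le_sqrt_of_sq_le ?_
  have h := inner_grad_grad_comm (w 0) (hw 1) 0 1
  have e1 : ‖divergence w‖ ^ 2 = ‖grad (w 0) 0‖ ^ 2 + 2 * inner ℝ (grad (w 0) 0) (grad (w 1) 1)
      + ‖grad (w 1) 1‖ ^ 2 := by
    rw [divergence, Fin.sum_univ_two, norm_add_sq_real]
  have e2 : 0 ≤ ‖grad (w 0) 1‖ ^ 2 - 2 * inner ℝ (grad (w 0) 1) (grad (w 1) 0)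
      + ‖grad (w 1) 0‖ ^ 2 := by
    rw [← norm_sub_sq_real]; positivity
  simp only [Fin.sum_univ_two]
  linarith

theorem vecInner_grad_vfn (q : H1 Ω) {v : H1v Ω} (hv : MemH10v v) :
    vecInner (grad q) (vfn v) = -inner ℝ (fn q) (divergence v) := by
  simp only [vecInner, vfn, divergence, inner_sum, ← Finset.sum_neg_distrib]
  exact Finset.sum_congr rfl fun i _ => by rw [inner_fn_grad q (hv i) i, neg_neg]

/-- A function that is locally square integrable on an open set and orthogonal to all its test
functions vanishes there. -/
theorem ae_eq_zero_of_forall_test {U : Set Plane} (hU : IsOpen U) {g : Plane → ℝ}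
    (hg : MemLp g 2 (volume.restrict U))
    (h : ∀ φ, IsTest U φ → ∫ x in U, g x * φ x = 0) : ∀ᵐ x ∂(volume.restrict U), g x = 0 := by
  have hloc : LocallyIntegrableOn g U volume := by
    rw [locallyIntegrableOn_iff hU.isLocallyClosed]
    intro K hK hKc
    have : IsFiniteMeasure (volume.restrict K) := ⟨by simpa using hKc.measure_lt_top⟩
    exact (hg.mono_measure (Measure.restrict_mono hK le_rfl)).integrable (by norm_num)
  have := hU.ae_eq_zero_of_integral_contDiff_smul_eq_zero hloc fun φ h1 h2 h3 => by
    have ht : IsTest U φ := ⟨h1, h2, h3⟩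
    have := h φ ht
    rw [ht.setIntegral_mul_eq] at this
    simpa [mul_comm] using this
  exact (ae_restrict_iff' hU.measurableSet).2 this

/-- The weak divergence of `v ∈ H¹(Ω)²`, seen as an element of `H(div, Ω)`, is `div v`. -/
theorem hdiv_eq_divergence (hΩ : IsOpen Ω) {w : Hdiv Ω} {v : H1v Ω} (h : hfn w = vfn v) :
    hdiv w = divergence v := by
  have key : ∀ φ (hφ : IsTest Ω φ), ∫ x in Ω, (hdiv w - divergence v : L2 Ω) x * φ x = 0 := by
    intro φ hφ
    have h1 : ∑ j, inner ℝ (hfn w j) (hφ.partialDeriv j).toL2 = -inner ℝ (hdiv w) hφ.toL2 := by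
      simp only [IsTest.inner_toL2]
      exact w.2 φ hφ
    rw [h] at h1
    have h2 : ∀ j, inner ℝ (vfn v j) (hφ.partialDeriv j).toL2
        = -inner ℝ (grad (v j) j) hφ.toL2 := fun j => inner_fn_partialDeriv (v j) hφ j
    simp only [h2] at h1
    rw [← hφ.inner_toL2, inner_sub_left, divergence, sum_inner]
    simp only [Finset.sum_neg_distrib] at h1
    linarith
  have := ae_eq_zero_of_forall_test hΩ (Lp.memLp _) key
  rw [← sub_eq_zero]
  exact (Lp.eq_zero_iff_ae_eq_zero).2 this

end TestFunctions

/-! ### Triangles and triangulations -/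

section Triangles

theorem isCompact_hull (T : Finset Plane) : IsCompact (hull T) :=
  T.finite_toSet.isCompact_convexHull ℝ

theorem measurableSet_hull (T : Finset Plane) : MeasurableSet (hull T) :=
  (isCompact_hull T).isClosed.measurableSet

theorem convex_hull (T : Finset Plane) : Convex ℝ (hull T) := convex_convexHull ℝ _

theorem subset_hull {T : Finset Plane} {a : Plane} (ha : a ∈ T) : a ∈ hull T :=
  subset_convexHull ℝ _ ha

theorem dist_le_diam_hull {T : Finset Plane} {x y : Plane} (hx : x ∈ hull T) (hy : y ∈ hull T) :
    dist x y ≤ Metric.diam (hull T) :=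
  Metric.dist_le_diam_of_mem (isCompact_hull T).isBounded hx hy

theorem interior_hull_ae_eq (T : Finset Plane) : interior (hull T) =ᵐ[volume] hull T :=
  interior_ae_eq_of_null_frontier ((convex_hull T).addHaar_frontier volume)

theorem restrict_hull (T : Finset Plane) :
    volume.restrict (hull T) = volume.restrict (interior (hull T)) :=
  (Measure.restrict_congr_set (interior_hull_ae_eq T)).symm

/-- Barycentric coordinates on a nondegenerate triangle. -/
theorem exists_barycentric {T : Finset Plane} (h3 : T.card = 3)
    (hT : AffineIndependent ℝ ((↑) : T → Plane)) :
    ∃ l : Plane → Plane →ᵃ[ℝ] ℝ, (∀ a ∈ T, l a a = 1) ∧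
      (∀ a ∈ T, ∀ b ∈ T, a ≠ b → l a b = 0) ∧ (∀ x, ∑ a ∈ T, l a x = 1) ∧
      (∀ x, ∑ a ∈ T, l a x • a = x) ∧ hull T = {x | ∀ a ∈ T, 0 ≤ l a x} := by
  classical
  have htop : affineSpan ℝ (Set.range ((↑) : T → Plane)) = ⊤ := by
    rw [hT.affineSpan_eq_top_iff_card_eq_finrank_add_one]
    simp [h3]
  let b : AffineBasis T ℝ Plane := ⟨_, hT, htop⟩
  have hb : ∀ i : T, b i = i := fun _ => rfl
  refine ⟨fun a => if h : a ∈ T then b.coord ⟨a, h⟩ else 0, fun a ha => ?_, fun a ha c hc hac => ?_,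
    fun x => ?_, fun x => ?_, ?_⟩
  · simp only [dif_pos ha]; exact b.coord_apply_eq ⟨a, ha⟩
  · simp only [dif_pos ha]
    exact b.coord_apply_ne (i := ⟨a, ha⟩) (j := ⟨c, hc⟩) (by simpa using hac)
  · rw [← b.sum_coord_apply_eq_one x, ← Finset.sum_coe_sort T]
    exact Finset.sum_congr rfl fun i _ => by simp only [dif_pos i.2]
  · refine Eq.trans ?_ (b.linear_combination_coord_eq_self x)
    rw [← Finset.sum_coe_sort T]
    exact Finset.sum_congr rfl fun i _ => by simp only [dif_pos i.2, hb]
  · have e : hull T = convexHull ℝ (Set.range b) := by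
      have : Set.range b = T := by
        change Set.range ((↑) : T → Plane) = T
        simp
      rw [this]; rfl
    rw [e, b.convexHull_eq_nonneg_coord]
    ext x
    simp only [Set.mem_ofPred_eq]
    constructor
    · intro h a ha
      simp only [dif_pos ha]; exact h _
    · intro h i
      have := h i i.2
      simpa only [dif_pos i.2] using this

/-- An affine function with values in `[0, 1]` on a disc of radius `r` has Lipschitz constant at
most `1 / (2r)`. -/
theorem affine_lipschitz {l : Plane →ᵃ[ℝ] ℝ} {c : Plane} {r : ℝ} (hr : 0 < r)
    (h : ∀ x ∈ Metric.closedBall c r, l x ∈ Set.Icc (0 : ℝ) 1) (x y : Plane) :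
    2 * r * |l x - l y| ≤ dist x y := by
  rcases eq_or_ne x y with rfl | hxy
  · simp
  have hd : 0 < ‖x - y‖ := norm_pos_iff.2 (sub_ne_zero.2 hxy)
  have hm : ∀ s : ℝ, |s| = 1 → c + (s * r / ‖x - y‖) • (x - y) ∈ Metric.closedBall c r := by
    intro s hs
    rw [mem_closedBall_iff_norm, add_sub_cancel_left, norm_smul, Real.norm_eq_abs, abs_div,
      abs_mul, hs, abs_norm, one_mul, div_mul_cancel₀ _ hd.ne', abs_of_pos hr]
  have hv : ∀ s : ℝ, l (c + (s * r / ‖x - y‖) • (x - y))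
      = l c + s * r / ‖x - y‖ * (l x - l y) := by
    intro s
    have e1 : l (x - y + y) = l.linear (x - y) + l y := l.map_vadd y (x - y)
    have e2 : l ((s * r / ‖x - y‖) • (x - y) + c)
        = l.linear ((s * r / ‖x - y‖) • (x - y)) + l c := l.map_vadd c _
    rw [sub_add_cancel] at e1
    rw [add_comm c, e2, map_smul, smul_eq_mul, e1]
    ring
  have h1 := h _ (hm 1 (by simp))
  have h2 := h _ (hm (-1) (by simp))
  rw [hv] at h1 h2
  obtain ⟨h1a, h1b⟩ := h1
  obtain ⟨h2a, h2b⟩ := h2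
  have e5 : -1 * r / ‖x - y‖ * (l x - l y) = -(r / ‖x - y‖ * (l x - l y)) := by ring
  have e6 : 1 * r / ‖x - y‖ * (l x - l y) = r / ‖x - y‖ * (l x - l y) := by ring
  rw [e5] at h2a h2b
  rw [e6] at h1a h1b
  have e : |r / ‖x - y‖ * (l x - l y)| * 2 ≤ 1 := by
    have : |2 * (r / ‖x - y‖ * (l x - l y))| ≤ 1 := abs_le.2 ⟨by linarith, by linarith⟩
    rw [abs_mul, abs_two] at this
    linarith
  rw [abs_mul, abs_div, abs_norm, abs_of_pos hr] at e
  rw [dist_eq_norm]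
  have e4 : r / ‖x - y‖ * |l x - l y| * 2 = 2 * r * |l x - l y| / ‖x - y‖ := by ring
  rw [e4, div_le_one hd] at e
  exact e

variable {Ω : Set Plane} (𝒯 : Triangulation Ω)

/-- Two different cells meet in a null set: their intersection is spanned by at most two
vertices. -/
theorem volume_hull_inter {T S : Finset Plane} (hT : T ∈ 𝒯.cells) (hS : S ∈ 𝒯.cells)
    (hne : T ≠ S) : volume (hull T ∩ hull S) = 0 := by
  obtain ⟨d, hd, hdS⟩ : ∃ d ∈ T, d ∉ S := by
    by_contra! hsub
    exact hne (Finset.eq_of_subset_of_card_le hsub (by rw [𝒯.card_eq T hT, 𝒯.card_eq S hS]))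
  rw [𝒯.conforming T hT S hS]
  have hnot := (𝒯.nondegenerate T hT).notMem_affineSpan_sdiff ⟨d, hd⟩ Set.univ
  set A := affineSpan ℝ (((↑) : T → Plane) '' (Set.univ \ {⟨d, hd⟩})) with hA
  have htop : A ≠ ⊤ := by
    intro h
    rw [h] at hnot
    exact hnot (AffineSubspace.mem_top _ _ _)
  refine measure_mono_null ?_ (Measure.addHaar_affineSubspace volume A htop)
  refine (convexHull_mono ?_).trans (convexHull_subset_affineSpan _)
  rintro x ⟨hxT, hxS⟩
  refine ⟨⟨x, hxT⟩, ⟨Set.mem_univ _, ?_⟩, rfl⟩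
  intro h
  have : x = d := congrArg Subtype.val h
  exact hdS (this ▸ hxS)

theorem disjoint_interior_hull {T S : Finset Plane} (hT : T ∈ 𝒯.cells) (hS : S ∈ 𝒯.cells)
    (hne : T ≠ S) : Disjoint (interior (hull T)) (interior (hull S)) := by
  rw [Set.disjoint_iff_inter_eq_empty, ← interior_inter]
  by_contra h
  exact (isOpen_interior.measure_pos volume (Set.nonempty_iff_ne_empty.2 h)).ne'
    (measure_mono_null interior_subset (volume_hull_inter 𝒯 hT hS hne))

theorem isOpen_of_triangulation (𝒯 : Triangulation Ω) : IsOpen Ω := by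
  rw [← 𝒯.domain_eq]; exact isOpen_interior

theorem interior_patch_subset {K : Finset (Finset Plane)} (hK : K ⊆ 𝒯.cells) :
    interior (patch K) ⊆ Ω := by
  rw [← 𝒯.domain_eq]
  exact interior_mono (Set.biUnion_subset_biUnion_left hK)

theorem interior_hull_subset {T : Finset Plane} (hT : T ∈ 𝒯.cells) : interior (hull T) ⊆ Ω := by
  rw [← 𝒯.domain_eq]
  exact interior_mono (Set.subset_biUnion_of_mem (u := fun T => hull T) (Finset.mem_coe.2 hT))

theorem patch_ae_eq (K : Finset (Finset Plane)) :
    (⋃ T ∈ K, interior (hull T) : Set Plane) =ᵐ[volume] patch K :=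
  EventuallyEq.biUnion K.finite_toSet fun T _ => interior_hull_ae_eq T

theorem isCompact_patch (K : Finset (Finset Plane)) : IsCompact (patch K) :=
  K.finite_toSet.isCompact_biUnion fun T _ => isCompact_hull T

theorem measurableSet_patch (K : Finset (Finset Plane)) : MeasurableSet (patch K) :=
  (isCompact_patch K).isClosed.measurableSet

theorem restrict_patch (K : Finset (Finset Plane)) :
    volume.restrict (patch K) = volume.restrict (⋃ T ∈ K, interior (hull T)) :=
  (Measure.restrict_congr_set (patch_ae_eq K)).symm

theorem restrict_patch_le {K : Finset (Finset Plane)} (hK : K ⊆ 𝒯.cells) :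
    volume.restrict (patch K) ≤ volume.restrict Ω := by
  have h : (⋃ T ∈ K, interior (hull T)) ⊆ Ω :=
    Set.iUnion₂_subset fun T hT => interior_hull_subset 𝒯 (hK hT)
  rw [restrict_patch K]
  exact Measure.restrict_mono_set volume h

theorem restrict_hull_le {T : Finset Plane} (hT : T ∈ 𝒯.cells) :
    volume.restrict (hull T) ≤ volume.restrict Ω := by
  rw [restrict_hull]
  exact Measure.restrict_mono (interior_hull_subset 𝒯 hT) le_rfl

theorem restrict_patch_cells : volume.restrict (patch 𝒯.cells) = volume.restrict Ω := by
  refine le_antisymm (restrict_patch_le 𝒯 subset_rfl) (Measure.restrict_mono ?_ le_rfl)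
  conv_lhs => rw [← 𝒯.domain_eq]
  exact interior_subset

theorem setIntegral_patch {K : Finset (Finset Plane)} (hK : K ⊆ 𝒯.cells) {F : Plane → ℝ}
    (hF : Integrable F (volume.restrict Ω)) :
    ∫ x in patch K, F x = ∑ T ∈ K, ∫ x in hull T, F x := by
  rw [restrict_patch, integral_biUnion_finset K (fun T _ => isOpen_interior.measurableSet)
    (fun T hT S hS hne => disjoint_interior_hull 𝒯 (hK hT) (hK hS) hne)
    (fun T hT => hF.mono_measure (Measure.restrict_mono (interior_hull_subset 𝒯 (hK hT)) le_rfl))]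
  simp only [restrict_hull]

theorem setIntegral_eq_sum_cells {F : Plane → ℝ} (hF : Integrable F (volume.restrict Ω)) :
    ∫ x in Ω, F x = ∑ T ∈ 𝒯.cells, ∫ x in hull T, F x := by
  rw [← setIntegral_patch 𝒯 subset_rfl hF, restrict_patch_cells]

theorem integrable_sq (a : L2 Ω) : Integrable (fun x => a x ^ 2) (volume.restrict Ω) :=
  (Lp.memLp a).integrable_sq

theorem sum_cells_integral_sq (a : L2 Ω) :
    ∑ T ∈ 𝒯.cells, ∫ x in hull T, a x ^ 2 = ‖a‖ ^ 2 := by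
  rw [norm_sq_eq_integral, setIntegral_eq_sum_cells 𝒯 (integrable_sq a)]

theorem brokenLaplacian_eq {T : Finset Plane} (hT : T ∈ 𝒯.cells) (P : Finset Plane → Poly2)
    {x : Plane} (hx : x ∈ interior (hull T)) :
    brokenLaplacian 𝒯 P x = pval (polyLaplacian (P T)) x := by
  rw [brokenLaplacian, Finset.sum_eq_single_of_mem T hT, Set.indicator_of_mem hx]
  intro S hS hne
  exact Set.indicator_of_notMem
    (fun h => (Set.disjoint_left.1 (disjoint_interior_hull 𝒯 hS hT hne)) h hx) _

theorem ae_brokenLaplacian_eq {T : Finset Plane} (hT : T ∈ 𝒯.cells) (P : Finset Plane → Poly2) :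
    ∀ᵐ x ∂(volume.restrict (hull T)), brokenLaplacian 𝒯 P x = pval (polyLaplacian (P T)) x := by
  rw [restrict_hull]
  filter_upwards [ae_restrict_mem isOpen_interior.measurableSet] with x hx
  exact brokenLaplacian_eq 𝒯 hT P hx

theorem contDiff_pval (P : Poly2) : ContDiff ℝ ∞ (pval P) := by
  unfold pval
  induction P using MvPolynomial.induction_on with
  | C a => simpa using contDiff_const
  | add p q hp hq => simpa using hp.add hq
  | mul_X p i hp =>
    simp only [map_mul, MvPolynomial.eval_X]
    exact hp.mul (contDiff_euclidean.1 contDiff_id i)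

theorem continuous_pval (P : Poly2) : Continuous (pval P) := (contDiff_pval P).continuous

theorem memLp_of_continuous {g : Plane → ℝ} (hg : Continuous g) {K : Set Plane}
    (hK : IsCompact K) : MemLp g 2 (volume.restrict K) := by
  have : IsFiniteMeasure (volume.restrict K) := ⟨by simpa using hK.measure_lt_top⟩
  obtain ⟨B, hB⟩ := hK.exists_bound_of_continuousOn hg.continuousOn
  exact MemLp.of_bound hg.aestronglyMeasurable B
    ((ae_restrict_iff' hK.isClosed.measurableSet).2 (Eventually.of_forall hB))

theorem memLp_indicator_pval (μ : Measure Plane) (hμ : μ ≤ volume) (T : Finset Plane) (P : Poly2) :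
    MemLp ((interior (hull T)).indicator (pval P)) 2 μ :=
  MemLp.mono_measure hμ ((memLp_indicator_iff_restrict isOpen_interior.measurableSet).2
    (restrict_hull T ▸ memLp_of_continuous (continuous_pval P) (isCompact_hull T)))

theorem memLp_brokenLaplacian (P : Finset Plane → Poly2) :
    MemLp (brokenLaplacian 𝒯 P) 2 (volume.restrict Ω) :=
  memLp_finsetSum _ fun T _ => memLp_indicator_pval _ Measure.restrict_le_self T _

/-- The polynomials of degree at most `l` on a cell, extended by zero to `Ω`. -/
noncomputable def cellPoly (Ω : Set Plane) (l : ℕ) (T : Finset Plane) :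
    MvPolynomial.restrictTotalDegree (Fin 2) ℝ l →ₗ[ℝ] L2 Ω where
  toFun P := (memLp_indicator_pval (volume.restrict Ω) Measure.restrict_le_self T P.1).toLp _
  map_add' P R := by
    rw [← MemLp.toLp_add, MemLp.toLp_eq_toLp_iff]
    refine Eventually.of_forall fun x => ?_
    by_cases hx : x ∈ interior (hull T) <;> simp [hx, pval]
  map_smul' c P := by
    rw [RingHom.id_apply, ← MemLp.toLp_const_smul, MemLp.toLp_eq_toLp_iff]
    refine Eventually.of_forall fun x => ?_
    by_cases hx : x ∈ interior (hull T) <;> simp [hx, pval]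

/-- Piecewise polynomials of bounded degree form a finite-dimensional space. -/
theorem finiteDimensional_of_memPoly (Q : Submodule ℝ (L2 Ω))
    (h : ∃ l, ∀ q ∈ Q, MemPoly 𝒯 l q) : FiniteDimensional ℝ Q := by
  obtain ⟨l, hl⟩ := h
  let W : Submodule ℝ (L2 Ω) := 𝒯.cells.sup fun T => LinearMap.range (cellPoly Ω l T)
  have hW : FiniteDimensional ℝ W := Submodule.finiteDimensional_finset_sup _ _
  have hQ : Q ≤ W := by
    intro q hq
    obtain ⟨P, hP⟩ := hl q hq
    have hdeg : ∀ T ∈ 𝒯.cells, P T ∈ MvPolynomial.restrictTotalDegree (Fin 2) ℝ l := fun T hT =>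
      (MvPolynomial.mem_restrictTotalDegree _ _ _).2 (hP T hT).1
    let R : Finset Plane → MvPolynomial.restrictTotalDegree (Fin 2) ℝ l := fun T => by
      classical exact if hT : T ∈ 𝒯.cells then ⟨P T, hdeg T hT⟩ else 0
    have hR : ∀ T ∈ 𝒯.cells, (R T).1 = P T := fun T hT => by simp [R, hT]
    have hq' : q = ∑ T ∈ 𝒯.cells, cellPoly Ω l T (R T) := by
      refine Lp.ext ?_
      have e1 : (∑ T ∈ 𝒯.cells, cellPoly Ω l T (R T) : L2 Ω) =ᵐ[volume.restrict Ω]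
          fun x => ∑ T ∈ 𝒯.cells, (interior (hull T)).indicator (pval (P T)) x := by
        have h3 : ∀ᵐ x ∂(volume.restrict Ω), ∀ T ∈ 𝒯.cells,
            cellPoly Ω l T (R T) x = (interior (hull T)).indicator (pval (R T).1) x :=
          (Finset.eventually_all _).2 fun T _ => MemLp.coeFn_toLp
            (memLp_indicator_pval (volume.restrict Ω) Measure.restrict_le_self T (R T).1)
        refine (Lp.coeFn_finsetSum _ _).trans ?_
        filter_upwards [h3] with x hx
        simp only [Finset.sum_apply]
        exact Finset.sum_congr rfl fun T hT => by rw [hx T hT, hR T hT]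
      refine EventuallyEq.trans ?_ e1.symm
      have key : ∀ᵐ x ∂(volume.restrict (⋃ T ∈ 𝒯.cells, interior (hull T))),
          q x = ∑ T ∈ 𝒯.cells, (interior (hull T)).indicator (pval (P T)) x := by
        refine (ae_restrict_biUnion_finset_iff _ 𝒯.cells _).2 fun T hT => ?_
        have h4 := (hP T hT).2
        rw [restrict_hull] at h4
        filter_upwards [h4, ae_restrict_mem isOpen_interior.measurableSet] with x hx hxT
        rw [hx, Finset.sum_eq_single_of_mem T hT, Set.indicator_of_mem hxT]
        intro S hS hne
        exact Set.indicator_of_notMem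
          (fun h => (Set.disjoint_left.1 (disjoint_interior_hull 𝒯 hS hT hne)) h hxT) _
      rwa [← restrict_patch, restrict_patch_cells 𝒯] at key
    rw [hq']
    refine Submodule.sum_mem _ fun T hT => ?_
    have : LinearMap.range (cellPoly Ω l T) ≤ W :=
      Finset.le_sup (f := fun T => LinearMap.range (cellPoly Ω l T)) hT
    exact this ⟨_, rfl⟩
  exact Submodule.finiteDimensional_of_le hQ

end Triangles

/-! ### Polynomials and localized polynomials -/

section Polynomials

theorem totalDegree_pderiv_le (j : Fin 2) (P : Poly2) :
    (MvPolynomial.pderiv j P).totalDegree ≤ P.totalDegree := by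
  conv_lhs => rw [P.as_sum, map_sum]
  refine MvPolynomial.totalDegree_finsetSum_le fun s hs => ?_
  rw [MvPolynomial.pderiv_monomial]
  refine (MvPolynomial.totalDegree_monomial_le _ _).trans ?_
  refine le_trans ?_ (MvPolynomial.le_totalDegree hs)
  rw [Finsupp.sum_fintype _ _ (by simp), Finsupp.sum_fintype _ _ (by simp)]
  exact Finset.sum_le_sum fun i _ => by simp

theorem totalDegree_polyLaplacian_le (P : Poly2) :
    (polyLaplacian P).totalDegree ≤ P.totalDegree :=
  MvPolynomial.totalDegree_finsetSum_le fun j _ =>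
    (totalDegree_pderiv_le j _).trans (totalDegree_pderiv_le j P)

/-- Substituting polynomials of degree at most one does not raise the degree. -/
theorem totalDegree_bind₁_le {g : Fin 2 → Poly2} (hg : ∀ i, (g i).totalDegree ≤ 1) (P : Poly2) :
    (MvPolynomial.bind₁ g P).totalDegree ≤ P.totalDegree := by
  conv_lhs => rw [P.as_sum, map_sum]
  refine MvPolynomial.totalDegree_finsetSum_le fun s hs => ?_
  rw [MvPolynomial.bind₁_monomial]
  refine (MvPolynomial.totalDegree_mul _ _).trans ?_
  rw [MvPolynomial.totalDegree_C, zero_add]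
  refine (MvPolynomial.totalDegree_finsetProd _ _).trans
    (le_trans ?_ (MvPolynomial.le_totalDegree hs))
  refine Finset.sum_le_sum fun i _ => (MvPolynomial.totalDegree_pow _ _).trans ?_
  simpa using Nat.mul_le_mul_left (s i) (hg i)

theorem pval_bind₁ {g : Fin 2 → Poly2} (P : Poly2) {x y : Plane} (h : ∀ j, pval (g j) x = y j) :
    pval (MvPolynomial.bind₁ g P) x = pval P y := by
  have : (fun j => y j) = fun j => MvPolynomial.eval (fun i => x i) (g j) :=
    funext fun j => (h j).symm
  simp only [pval, this]
  exact MvPolynomial.eval₂Hom_bind₁ _ _ _ _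

theorem pval_add (P R : Poly2) (x : Plane) : pval (P + R) x = pval P x + pval R x := by
  simp [pval]

theorem pval_smul (a : ℝ) (P : Poly2) (x : Plane) : pval (a • P) x = a * pval P x := by
  simp [pval, MvPolynomial.smul_eval]

theorem pval_sum {ι : Type*} (s : Finset ι) (P : ι → Poly2) (x : Plane) :
    pval (∑ i ∈ s, P i) x = ∑ i ∈ s, pval (P i) x := by
  simp [pval]

theorem differentiable_pval (P : Poly2) : Differentiable ℝ (pval P) :=
  (contDiff_pval P).differentiable (by simp)

theorem partialDeriv_add {φ ψ : Plane → ℝ} (hφ : Differentiable ℝ φ) (hψ : Differentiable ℝ ψ)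
    (j : Fin 2) (x : Plane) :
    partialDeriv j (fun y => φ y + ψ y) x = partialDeriv j φ x + partialDeriv j ψ x := by
  unfold partialDeriv
  rw [fderiv_fun_add hφ.differentiableAt hψ.differentiableAt]
  rfl

theorem partialDeriv_mul {φ ψ : Plane → ℝ} (hφ : Differentiable ℝ φ) (hψ : Differentiable ℝ ψ)
    (j : Fin 2) (x : Plane) : partialDeriv j (fun y => φ y * ψ y) x
      = partialDeriv j φ x * ψ x + φ x * partialDeriv j ψ x := by
  unfold partialDeriv
  rw [fderiv_fun_mul hφ.differentiableAt hψ.differentiableAt]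
  simp only [add_apply, smul_apply, smul_eq_mul]
  ring

theorem partialDeriv_pval (j : Fin 2) (P : Poly2) :
    partialDeriv j (pval P) = pval (MvPolynomial.pderiv j P) := by
  funext x
  induction P using MvPolynomial.induction_on with
  | C a =>
    have : pval (MvPolynomial.C a) = fun _ => a := by funext y; simp [pval]
    rw [this]
    simp [partialDeriv, pval]
  | add p q hp hq =>
    have : pval (p + q) = fun y => pval p y + pval q y := funext fun y => pval_add p q y
    rw [this, partialDeriv_add (differentiable_pval p) (differentiable_pval q), hp, hq, map_add,
      pval_add]
  | mul_X p i hp =>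
    have : pval (p * MvPolynomial.X i) = fun y => pval p y * y i := by
      funext y; simp [pval]
    have hi : Differentiable ℝ fun y : Plane => y i :=
      (EuclideanSpace.proj (𝕜 := ℝ) i : Plane →L[ℝ] ℝ).differentiable
    have hd : partialDeriv j (fun y : Plane => y i) x = if i = j then 1 else 0 := by
      unfold partialDeriv
      have : fderiv ℝ (fun y : Plane => y i) x = (EuclideanSpace.proj (𝕜 := ℝ) i : Plane →L[ℝ] ℝ) :=
        (EuclideanSpace.proj (𝕜 := ℝ) i : Plane →L[ℝ] ℝ).fderiv
      rw [this]
      simp [eq_comm]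
    rw [this, partialDeriv_mul (differentiable_pval p) hi, hp, hd, Derivation.leibniz,
      MvPolynomial.pderiv_X]
    rcases eq_or_ne i j with rfl | hij
    · simp [pval]; ring
    · have : (Pi.single j 1 : Fin 2 → Poly2) i = 0 := Pi.single_eq_of_ne hij 1
      simp [pval, hij]; ring

theorem norm_toLp_sq {μ : Measure Plane} {g : Plane → ℝ} (hg : MemLp g 2 μ) :
    ‖hg.toLp g‖ ^ 2 = ∫ x, g x ^ 2 ∂μ := by
  rw [← real_inner_self_eq_norm_sq, L2.inner_def]
  refine integral_congr_ae ?_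
  filter_upwards [hg.coeFn_toLp] with x hx
  simp [hx, sq]

theorem eq_zero_of_pval_eq_zero_on_ball {P : Poly2} {ρ : ℝ} (hρ : 0 < ρ)
    (h : ∀ x ∈ Metric.ball (0 : Plane) ρ, pval P x = 0) : P = 0 := by
  refine MvPolynomial.funext_set (fun _ => Set.Ioo (0 : ℝ) (ρ / 2))
    (fun _ => Set.Ioo_infinite (by linarith)) fun y hy => ?_
  have := h (WithLp.toLp 2 y) (by
    rw [mem_ball_zero_iff, EuclideanSpace.norm_eq, Fin.sum_univ_two]
    have h0 := hy 0 (Set.mem_univ _)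
    have h1 := hy 1 (Set.mem_univ _)
    rw [Real.sqrt_lt' hρ]
    simp only [Real.norm_eq_abs, sq_abs]
    nlinarith [h0.1, h0.2, h1.1, h1.2])
  simpa [pval] using this

/-- On polynomials of bounded degree the `L²` norm over a fixed disc dominates every other
(semi)norm of `L²` type, by finite-dimensionality. -/
theorem exists_poly_bound (N : ℕ) (μ : Measure Plane) (B : Poly2 →ₗ[ℝ] (Plane → ℝ))
    (hB : ∀ P, MemLp (B P) 2 μ) :
    ∃ C : ℝ, 0 ≤ C ∧ ∀ P : Poly2, P.totalDegree ≤ N →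
      ∫ x, B P x ^ 2 ∂μ ≤ C * ∫ x in Metric.ball 0 (1 / 4), pval P x ^ 2 := by
  let V := MvPolynomial.restrictTotalDegree (Fin 2) ℝ N
  let ν := volume.restrict (Metric.ball (0 : Plane) (1 / 4))
  have hA : ∀ P : Poly2, MemLp (pval P) 2 ν := fun P =>
    (memLp_of_continuous (continuous_pval P) (isCompact_closedBall 0 (1 / 4))).mono_measure
      (Measure.restrict_mono Metric.ball_subset_closedBall le_rfl)
  let A : V →ₗ[ℝ] Lp ℝ 2 ν :=
    { toFun := fun P => (hA P.1).toLp _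
      map_add' := fun P R => by
        rw [← MemLp.toLp_add, MemLp.toLp_eq_toLp_iff]
        exact Eventually.of_forall fun x => pval_add _ _ x
      map_smul' := fun c P => by
        rw [RingHom.id_apply, ← MemLp.toLp_const_smul, MemLp.toLp_eq_toLp_iff]
        exact Eventually.of_forall fun x => pval_smul _ _ x }
  let B' : V →ₗ[ℝ] Lp ℝ 2 μ :=
    { toFun := fun P => (hB P.1).toLp _
      map_add' := fun P R => by
        rw [← MemLp.toLp_add, MemLp.toLp_eq_toLp_iff]
        exact Eventually.of_forall fun x => by simp
      map_smul' := fun c P => by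
        rw [RingHom.id_apply, ← MemLp.toLp_const_smul, MemLp.toLp_eq_toLp_iff]
        exact Eventually.of_forall fun x => by simp }
  have hinj : Function.Injective A := by
    rw [← LinearMap.ker_eq_bot, LinearMap.ker_eq_bot']
    intro P hP
    have h1 : pval P.1 =ᵐ[ν] 0 := by
      have h2 : A P =ᵐ[ν] pval P.1 := (hA P.1).coeFn_toLp
      rw [hP] at h2
      exact h2.symm.trans (Lp.coeFn_zero _ _ _)
    have h3 := Measure.eqOn_open_of_ae_eq h1 Metric.isOpen_ball
      (continuous_pval P.1).continuousOn continuousOn_const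
    exact Subtype.ext (eq_zero_of_pval_eq_zero_on_ball (by norm_num) h3)
  let e := LinearEquiv.ofInjective A hinj
  have : FiniteDimensional ℝ (LinearMap.range A) := inferInstance
  let D := LinearMap.toContinuousLinearMap (B' ∘ₗ e.symm.toLinearMap)
  refine ⟨‖D‖ ^ 2, by positivity, fun P hP => ?_⟩
  let v : V := ⟨P, (MvPolynomial.mem_restrictTotalDegree _ _ _).2 hP⟩
  have h1 : ‖B' v‖ ≤ ‖D‖ * ‖A v‖ := by
    have := D.le_opNorm (e v)
    have e1 : D (e v) = B' v := by simp [D]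
    have e2 : ‖e v‖ = ‖A v‖ := rfl
    rwa [e1, e2] at this
  have h2 : ‖B' v‖ ^ 2 = ∫ x, B P x ^ 2 ∂μ := norm_toLp_sq (hB P)
  have h3 : ‖A v‖ ^ 2 = ∫ x in Metric.ball 0 (1 / 4), pval P x ^ 2 := norm_toLp_sq (hA P)
  rw [← h2, ← h3, ← mul_pow]
  gcongr

/-- A fixed smooth bump: equal to one on the disc of radius `1/4`, with support in the disc of
radius `1/2`. -/
noncomputable def bump : ContDiffBump (0 : Plane) := ⟨1 / 4, 1 / 2, by norm_num, by norm_num⟩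

/-- The polynomial `P` localized to the disc of centre `c` and radius `r`. -/
noncomputable def bubble (c : Plane) (r : ℝ) (P : Poly2) (x : Plane) : ℝ :=
  bump (r⁻¹ • (x - c)) * pval P x

theorem setIntegral_rescale (F : Plane → ℝ) (c : Plane) {r : ℝ} (hr : 0 < r) {s : Set Plane}
    (hs : MeasurableSet s) :
    ∫ x in {x | r⁻¹ • (x - c) ∈ s}, F (r⁻¹ • (x - c)) = r ^ 2 * ∫ y in s, F y := by
  have hm : MeasurableSet {x : Plane | r⁻¹ • (x - c) ∈ s} :=
    (by fun_prop : Measurable fun x : Plane => r⁻¹ • (x - c)) hs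
  rw [← integral_indicator hm, ← integral_indicator hs]
  have e : ∀ x, Set.indicator {x | r⁻¹ • (x - c) ∈ s} (fun x => F (r⁻¹ • (x - c))) x
      = s.indicator F (r⁻¹ • (x - c)) := fun x => by
    by_cases hx : r⁻¹ • (x - c) ∈ s <;> simp [hx]
  simp only [e]
  rw [integral_sub_right_eq_self (fun x => s.indicator F (r⁻¹ • x)) c,
    Measure.integral_comp_inv_smul_of_nonneg _ _ hr.le]
  simp

theorem rescale_mem_ball {c x : Plane} {r : ℝ} (hr : 0 < r) (ρ : ℝ) :
    r⁻¹ • (x - c) ∈ Metric.ball (0 : Plane) ρ ↔ x ∈ Metric.ball c (ρ * r) := by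
  rw [mem_ball_zero_iff, mem_ball_iff_norm, norm_smul, norm_inv, Real.norm_of_nonneg hr.le,
    inv_mul_lt_iff₀ hr, mul_comm]

theorem rescale_mem_closedBall {c x : Plane} {r : ℝ} (hr : 0 < r) (ρ : ℝ) :
    r⁻¹ • (x - c) ∈ Metric.closedBall (0 : Plane) ρ ↔ x ∈ Metric.closedBall c (ρ * r) := by
  rw [mem_closedBall_zero_iff, mem_closedBall_iff_norm, norm_smul, norm_inv,
    Real.norm_of_nonneg hr.le, inv_mul_le_iff₀ hr, mul_comm]

theorem exists_rescaled_poly (P : Poly2) (c : Plane) {r : ℝ} (hr : 0 < r) :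
    ∃ R : Poly2, R.totalDegree ≤ P.totalDegree ∧ ∀ x, pval P x = pval R (r⁻¹ • (x - c)) := by
  let g : Fin 2 → Poly2 := fun j => MvPolynomial.C (c j) + MvPolynomial.C r * MvPolynomial.X j
  refine ⟨MvPolynomial.bind₁ g P, totalDegree_bind₁_le (fun i => ?_) P, fun x => ?_⟩
  · refine (MvPolynomial.totalDegree_add _ _).trans (max_le (by simp) ?_)
    refine (MvPolynomial.totalDegree_mul _ _).trans ?_
    simp
  · refine (pval_bind₁ P fun j => ?_).symm
    simp [g, pval, hr.ne']

section Bubble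

variable {c : Plane} {r : ℝ} {P : Poly2}

theorem isTest_bubble (hr : 0 < r) : IsTest (Metric.ball c r) (bubble c r P) := by
  have hsub : tsupport (bubble c r P) ⊆ Metric.closedBall c (1 / 2 * r) := by
    refine closure_minimal (fun x hx => ?_) Metric.isClosed_closedBall
    have h1 : bump (r⁻¹ • (x - c)) ≠ 0 := fun h => hx (by simp [bubble, h])
    have h2 : r⁻¹ • (x - c) ∈ Metric.ball (0 : Plane) (1 / 2) := by
      have : r⁻¹ • (x - c) ∈ Function.support bump := h1
      rwa [bump.support_eq] at this
    exact Metric.ball_subset_closedBall ((rescale_mem_ball hr _).1 h2)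
  refine ⟨?_, (isCompact_closedBall c _).of_isClosed_subset (isClosed_tsupport _) hsub,
    hsub.trans (Metric.closedBall_subset_ball (by linarith))⟩
  have h1 : ContDiff ℝ ∞ fun x : Plane => r⁻¹ • (x - c) :=
    (contDiff_id.sub contDiff_const).const_smul _
  exact (bump.contDiff.comp h1).mul (contDiff_pval P)

theorem integral_bubble_sq_le (hr : 0 < r) :
    ∫ x, bubble c r P x ^ 2 ≤ ∫ x in Metric.ball c r, pval P x ^ 2 := by
  have ht : IsTest (Metric.ball c r) (bubble c r P) := isTest_bubble hr
  have : ∫ x, bubble c r P x ^ 2 = ∫ x in Metric.ball c r, bubble c r P x ^ 2 :=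
    (setIntegral_eq_integral_of_forall_compl_eq_zero fun x hx => by
      rw [ht.eq_zero_of_notMem hx]; simp).symm
  rw [this]
  have hP : IntegrableOn (fun x => pval P x ^ 2) (Metric.ball c r) :=
    (((continuous_pval P).pow 2).continuousOn.integrableOn_compact
      (isCompact_closedBall c r)).mono_set Metric.ball_subset_closedBall
  refine setIntegral_mono (ht.memLp _).integrable_sq.integrableOn hP fun x => ?_
  rw [bubble, mul_pow]
  have h0 := bump.nonneg (x := r⁻¹ • (x - c))
  have h1 := bump.le_one (x := r⁻¹ • (x - c))
  exact mul_le_of_le_one_left (sq_nonneg _) (pow_le_one₀ h0 h1)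

theorem integral_sq_le_integral_bubble_mul (hr : 0 < r) :
    ∫ x in Metric.ball c (1 / 4 * r), pval P x ^ 2 ≤ ∫ x, pval P x * bubble c r P x := by
  have ht : IsTest (Metric.ball c r) (bubble c r P) := isTest_bubble hr
  have : ∫ x in Metric.ball c (1 / 4 * r), pval P x ^ 2
      = ∫ x in Metric.ball c (1 / 4 * r), pval P x * bubble c r P x := by
    refine setIntegral_congr_fun measurableSet_ball fun x hx => ?_
    have h1 : bump (r⁻¹ • (x - c)) = 1 := bump.one_of_mem_closedBall
      (Metric.ball_subset_closedBall ((rescale_mem_ball hr _).2 hx))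
    simp only [bubble, h1]
    ring
  rw [this]
  refine setIntegral_le_integral (ht.integrable_mul_continuous (continuous_pval P) _)
    (Eventually.of_forall fun x => ?_)
  have h0 := bump.nonneg (x := r⁻¹ • (x - c))
  have : pval P x * bubble c r P x = bump (r⁻¹ • (x - c)) * pval P x ^ 2 := by
    rw [bubble]; ring
  simp only [Pi.zero_apply, this]
  positivity

/-- Scaled equivalence of norms and inverse estimate for localized polynomials: both follow from
finite-dimensionality on the unit disc, and scaling. -/
theorem exists_bubble_bound (N : ℕ) (κ : ℝ) :
    ∃ C : ℝ, 0 < C ∧ ∀ (P : Poly2), P.totalDegree ≤ N → ∀ (c : Plane) (r : ℝ), 0 < r →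
      (∫ x in Metric.closedBall c (κ * r), pval P x ^ 2
        ≤ C * ∫ x in Metric.ball c (1 / 4 * r), pval P x ^ 2) ∧
      ∀ j, r ^ 2 * ∫ x, partialDeriv j (bubble c r P) x ^ 2
        ≤ C * ∫ x in Metric.ball c (1 / 4 * r), pval P x ^ 2 := by
  let B₀ : Poly2 →ₗ[ℝ] (Plane → ℝ) :=
    { toFun := pval
      map_add' := fun P R => funext fun x => pval_add P R x
      map_smul' := fun a P => funext fun x => pval_smul a P x }
  have hbd : Differentiable ℝ bump := (bump.contDiff (n := 1)).differentiable (by simp)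
  have hprod : ∀ P : Poly2, ContDiff ℝ ∞ fun y => bump y * pval P y := fun P =>
    bump.contDiff.mul (contDiff_pval P)
  let B : Fin 2 → Poly2 →ₗ[ℝ] (Plane → ℝ) := fun j =>
    { toFun := fun P => partialDeriv j fun y => bump y * pval P y
      map_add' := fun P R => funext fun x => by
        have : (fun y => bump y * pval (P + R) y)
            = fun y => bump y * pval P y + bump y * pval R y := by
          funext y; rw [pval_add]; ring
        rw [this]
        exact partialDeriv_add (hbd.mul (differentiable_pval P))
          (hbd.mul (differentiable_pval R)) j x
      map_smul' := fun a P => funext fun x => by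
        have : (fun y => bump y * pval (a • P) y) = fun y => a * (bump y * pval P y) := by
          funext y; rw [pval_smul]; ring
        rw [this]
        unfold partialDeriv
        have hd : DifferentiableAt ℝ (fun y => bump y * pval P y) x :=
          (hbd.mul (differentiable_pval P)).differentiableAt
        rw [fderiv_const_mul hd]
        rfl }
  obtain ⟨C₀, hC₀, h₀⟩ := exists_poly_bound N (volume.restrict (Metric.closedBall 0 κ)) B₀
    fun P => memLp_of_continuous (continuous_pval P) (isCompact_closedBall 0 κ)
  have hB : ∀ j, ∃ C : ℝ, 0 ≤ C ∧ ∀ P : Poly2, P.totalDegree ≤ N →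
      ∫ x, B j P x ^ 2 ≤ C * ∫ x in Metric.ball 0 (1 / 4), pval P x ^ 2 := fun j =>
    exists_poly_bound N volume (B j) fun P => by
      have ht : IsTest Set.univ fun y => bump y * pval P y :=
        ⟨hprod P, bump.hasCompactSupport.mul_right, Set.subset_univ _⟩
      exact ht.memLp_partialDeriv j volume
  choose C₁ hC₁ h₁ using hB
  refine ⟨C₀ + C₁ 0 + C₁ 1 + 1, by linarith [hC₁ 0, hC₁ 1], fun P hP c r hr => ?_⟩
  obtain ⟨R, hR, hPR⟩ := exists_rescaled_poly P c hr
  have e1 : ∫ x in Metric.ball c (1 / 4 * r), pval P x ^ 2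
      = r ^ 2 * ∫ x in Metric.ball 0 (1 / 4), pval R x ^ 2 := by
    rw [← setIntegral_rescale (fun y => pval R y ^ 2) c hr measurableSet_ball]
    simp only [rescale_mem_ball hr, ← hPR]
    rfl
  have e2 : ∫ x in Metric.closedBall c (κ * r), pval P x ^ 2
      = r ^ 2 * ∫ x in Metric.closedBall 0 κ, pval R x ^ 2 := by
    rw [← setIntegral_rescale (fun y => pval R y ^ 2) c hr measurableSet_closedBall]
    simp only [rescale_mem_closedBall hr, ← hPR]
    rfl
  have hpos : 0 ≤ r ^ 2 * ∫ x in Metric.ball 0 (1 / 4), pval R x ^ 2 :=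
    mul_nonneg (sq_nonneg _) (integral_nonneg fun x => sq_nonneg _)
  have e3 : ∀ j, r ^ 2 * ∫ x, partialDeriv j (bubble c r P) x ^ 2 = r ^ 2 * ∫ y, B j R y ^ 2 := by
    intro j
    have e4 : ∀ x, partialDeriv j (bubble c r P) x = r⁻¹ * B j R (r⁻¹ • (x - c)) := by
      intro x
      have e5 : bubble c r P = fun x => (fun y => bump y * pval R y) (r⁻¹ • (x - c)) := by
        funext y; simp only [bubble, hPR]
      have d1 : HasFDerivAt (fun x : Plane => r⁻¹ • (x - c))
          (r⁻¹ • ContinuousLinearMap.id ℝ Plane) x :=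
        ((hasFDerivAt_id x).sub_const c).const_smul r⁻¹
      have d2 := ((hprod R).differentiable (by simp) (r⁻¹ • (x - c))).hasFDerivAt.comp x d1
      rw [e5]
      change fderiv ℝ ((fun y => bump y * pval R y) ∘ fun x => r⁻¹ • (x - c)) x _ = _
      rw [d2.fderiv]
      simp [B, partialDeriv]
    simp only [e4, mul_pow, integral_const_mul]
    have := setIntegral_rescale (fun y => B j R y ^ 2) c hr MeasurableSet.univ
    simp only [Set.mem_univ, Set.ofPred_true, Measure.restrict_univ] at this
    rw [this]
    field_simp
  rw [e1, e2]
  constructor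
  · have := mul_le_mul_of_nonneg_left (h₀ R (hR.trans hP)) (sq_nonneg r)
    refine le_trans this ?_
    rw [mul_left_comm]
    exact mul_le_mul_of_nonneg_right (by linarith [hC₁ 0, hC₁ 1]) hpos
  · intro j
    rw [e3]
    have := mul_le_mul_of_nonneg_left (h₁ j R (hR.trans hP)) (sq_nonneg r)
    refine le_trans this ?_
    rw [mul_left_comm]
    refine mul_le_mul_of_nonneg_right ?_ hpos
    fin_cases j
    · simp only [Fin.zero_eta]; linarith [hC₁ 0, hC₁ 1]
    · simp only [Fin.mk_one]; linarith [hC₁ 0, hC₁ 1]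

end Bubble

end Polynomials

/-! ### The residual of the momentum equation -/

section Residual

variable {Ω : Set Plane}

theorem memH10_zero : MemH10 (0 : H1 Ω) := by
  have h0 : ∀ a : L2 Ω, a = 0 →
      eLpNorm (fun x => a x - (0 : Plane → ℝ) x) 2 (volume.restrict Ω) = 0 := by
    intro a ha
    rw [eLpNorm_congr_ae (g := 0)]
    · simp
    · filter_upwards [Lp.eq_zero_iff_ae_eq_zero.1 ha] with x hx
      simp [hx]
  have hd : ∀ j, partialDeriv j (0 : Plane → ℝ) = 0 := fun j => by
    funext x
    simp [partialDeriv]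
  refine ⟨fun _ => 0, fun _ => ⟨contDiff_const, HasCompactSupport.zero, by simp⟩, ?_, fun j => ?_⟩
  · simp only [h0 (fn (0 : H1 Ω)) rfl]
    exact tendsto_const_nhds
  · simp only [hd, h0 (grad (0 : H1 Ω) j) rfl]
    exact tendsto_const_nhds

/-- The momentum equation tested with `φ e_i`, the gradient of `q ∈ H¹(Ω)` being moved to the
right-hand side. -/
theorem IsStokesSolution.residual {ν : ℝ} {f : L2v Ω} {uD u : H1v Ω} {p : L2 Ω}
    (h : IsStokesSolution ν f uD u p) (q : H1 Ω) {φ : Plane → ℝ} (hφ : IsTest Ω φ) (i : Fin 2) :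
    inner ℝ ((f - grad q) i) hφ.toL2 = ν * ∑ j, inner ℝ (grad (u i) j) (hφ.partialDeriv j).toL2
      - inner ℝ (p - fn q) (hφ.partialDeriv i).toL2 := by
  let v : H1v Ω := Pi.single i hφ.toH1
  have hvi : v i = hφ.toH1 := Pi.single_eq_same i _
  have hvk : ∀ k, k ≠ i → v k = 0 := fun k hk => Pi.single_eq_of_ne hk _
  have hv : MemH10v v := fun k => by
    rcases eq_or_ne k i with rfl | hk
    · rw [hvi]; exact hφ.memH10_toH1
    · rw [hvk k hk]; exact memH10_zero
  have hg0 : ∀ j, grad (0 : H1 Ω) j = 0 := fun j => rfl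
  have hf0 : fn (0 : H1 Ω) = 0 := rfl
  have e1 : ∑ k, vecInner (grad (u k)) (grad (v k))
      = ∑ j, inner ℝ (grad (u i) j) (hφ.partialDeriv j).toL2 := by
    rw [Finset.sum_eq_single_of_mem i (Finset.mem_univ _)]
    · rw [hvi]; rfl
    · intro k _ hk
      simp [hvk k hk, vecInner, hg0]
  have e2 : divergence v = (hφ.partialDeriv i).toL2 := by
    rw [divergence, Finset.sum_eq_single_of_mem i (Finset.mem_univ _)]
    · rw [hvi]; rfl
    · intro k _ hk
      rw [hvk k hk, hg0]
  have e3 : vecInner f (vfn v) = inner ℝ (f i) hφ.toL2 := by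
    rw [vecInner, Finset.sum_eq_single_of_mem i (Finset.mem_univ _)]
    · simp only [vfn]; rw [hvi]; rfl
    · intro k _ hk
      simp [vfn, hvk k hk, hf0]
  have hm := h.momentum v hv
  rw [e1, e2, e3] at hm
  have e4 := inner_fn_partialDeriv q hφ i
  rw [Pi.sub_apply, inner_sub_left, inner_sub_left]
  linarith

/-- On each cell the weak gradient of a piecewise polynomial in `H¹(Ω)` is the classical one. -/
theorem grad_eq_pderiv (𝒯 : Triangulation Ω) {m : ℕ} {P : Finset Plane → Poly2} {w : H1 Ω}
    (hw : IsPiecewise 𝒯 m P (fn w)) {T : Finset Plane} (hT : T ∈ 𝒯.cells) (j : Fin 2) :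
    ∀ᵐ x ∂(volume.restrict (hull T)), grad w j x = pval (MvPolynomial.pderiv j (P T)) x := by
  rw [restrict_hull]
  set U := interior (hull T) with hU
  have hUΩ : U ⊆ Ω := interior_hull_subset 𝒯 hT
  have hle : volume.restrict U ≤ volume.restrict Ω := Measure.restrict_mono hUΩ le_rfl
  have hp : ∀ R : Poly2, MemLp (pval R) 2 (volume.restrict U) := fun R =>
    (memLp_of_continuous (continuous_pval R) (isCompact_hull T)).mono_measure
      (Measure.restrict_mono interior_subset le_rfl)
  have hg : MemLp (grad w j) 2 (volume.restrict U) := (Lp.memLp _).mono_measure hle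
  have key : ∀ φ, IsTest U φ →
      ∫ x in U, (grad w j x - pval (MvPolynomial.pderiv j (P T)) x) * φ x = 0 := by
    intro φ hφ
    have hφΩ := hφ.mono hUΩ
    have h1 : ∫ x in U, grad w j x * φ x = ∫ x in Ω, grad w j x * φ x := by
      rw [hφ.setIntegral_mul_eq, hφΩ.setIntegral_mul_eq]
    have h2 : ∫ x in Ω, fn w x * partialDeriv j φ x = ∫ x in U, fn w x * partialDeriv j φ x := by
      rw [(hφ.partialDeriv j).setIntegral_mul_eq, (hφΩ.partialDeriv j).setIntegral_mul_eq]
    have h3 : ∫ x in U, fn w x * partialDeriv j φ x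
        = ∫ x in U, pval (P T) x * partialDeriv j φ x := by
      have := (hw T hT).2
      rw [restrict_hull] at this
      refine integral_congr_ae ?_
      filter_upwards [this] with x hx
      rw [hx]
    have h4 : ∫ x in U, pval (P T) x * partialDeriv j φ x
        = -∫ x in U, pval (MvPolynomial.pderiv j (P T)) x * φ x := by
      rw [(hφ.partialDeriv j).setIntegral_mul_eq, hφ.setIntegral_mul_eq,
        integral_mul_partialDeriv (contDiff_pval _) hφ.smooth hφ.compact, partialDeriv_pval]
    have h5 : ∫ x in Ω, fn w x * partialDeriv j φ x = -∫ x in Ω, grad w j x * φ x :=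
      w.2 φ hφΩ j
    simp only [sub_mul]
    have i1 : Integrable (fun x => grad w j x * φ x) (volume.restrict U) :=
      hg.integrable_mul (hφ.memLp _)
    have i2 : Integrable (fun x => pval (MvPolynomial.pderiv j (P T)) x * φ x)
        (volume.restrict U) := (hp _).integrable_mul (hφ.memLp _)
    rw [integral_sub i1 i2]
    linarith
  filter_upwards [ae_eq_zero_of_forall_test isOpen_interior
    (g := fun x => grad w j x - pval (MvPolynomial.pderiv j (P T)) x) (hg.sub (hp _)) key]
    with x hx
  exact sub_eq_zero.1 hx

theorem abs_integral_mul_le {μ : Measure Plane} {a b : Plane → ℝ} (ha : MemLp a 2 μ)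
    (hb : MemLp b 2 μ) : |∫ x, a x * b x ∂μ| ≤ √(∫ x, a x ^ 2 ∂μ) * √(∫ x, b x ^ 2 ∂μ) := by
  have e : ∫ x, a x * b x ∂μ = inner ℝ (ha.toLp a) (hb.toLp b) := by
    rw [L2.inner_def]
    refine integral_congr_ae ?_
    filter_upwards [ha.coeFn_toLp, hb.coeFn_toLp] with x h1 h2
    simp [h1, h2, mul_comm]
  rw [e, ← norm_toLp_sq ha, ← norm_toLp_sq hb, Real.sqrt_sq (norm_nonneg _),
    Real.sqrt_sq (norm_nonneg _)]
  exact abs_real_inner_le_norm _ _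

theorem IsTest.setIntegral_mul_eq_of_subset {U S : Set Plane} {φ : Plane → ℝ} (h : IsTest U φ)
    (hS : U ⊆ S) (a : Plane → ℝ) : ∫ x in S, a x * φ x = ∫ x, a x * φ x :=
  setIntegral_eq_integral_of_forall_compl_eq_zero fun x hx => by
    rw [h.eq_zero_of_notMem fun h' => hx (hS h'), mul_zero]

/-- The Cauchy–Schwarz inequality on a set that contains the support of the test function. -/
theorem IsTest.abs_setIntegral_mul_le {U S : Set Plane} {φ a : Plane → ℝ} (h : IsTest U φ)
    (hΩ : U ⊆ Ω) (hS : U ⊆ S) (ha : MemLp a 2 (volume.restrict S)) :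
    |∫ x in Ω, a x * φ x| ≤ √(∫ x in S, a x ^ 2) * √(∫ x, φ x ^ 2) := by
  rw [h.setIntegral_mul_eq_of_subset hΩ, ← h.setIntegral_mul_eq_of_subset hS]
  refine (abs_integral_mul_le ha (h.memLp _)).trans ?_
  refine mul_le_mul_of_nonneg_left (Real.sqrt_le_sqrt ?_) (Real.sqrt_nonneg _)
  exact setIntegral_le_integral (h.memLp _).integrable_sq
    (Eventually.of_forall fun x => sq_nonneg _)

theorem bestApproxErrorSq_nonneg (k : ℕ) (K : Set Plane) (g : L2 Ω) :
    0 ≤ bestApproxErrorSq k K g :=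
  Real.iInf_nonneg fun _ => integral_nonneg fun _ => sq_nonneg _

theorem le_add_mul_bestApproxErrorSq {k : ℕ} {K : Set Plane} {g : L2 Ω} {A a b : ℝ} (hb : 0 ≤ b)
    (h : ∀ P : Poly2, P.totalDegree ≤ k → A ≤ a + b * ∫ x in K, (g x - pval P x) ^ 2) :
    A ≤ a + b * bestApproxErrorSq k K g := by
  have hne : Nonempty {P : Poly2 // P.totalDegree ≤ k} := ⟨⟨0, by simp⟩⟩
  rcases hb.eq_or_lt with rfl | hb
  · simpa using h 0 (by simp)
  · have : (A - a) / b ≤ bestApproxErrorSq k K g := le_ciInf fun P => by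
      rw [div_le_iff₀ hb]
      linarith [h P.1 P.2]
    rw [div_le_iff₀ hb] at this
    linarith

theorem le_mul_sq_of_le_sqrt_mul {C D X : ℝ} (hC : 0 ≤ C) (hD : 0 ≤ D)
    (h : D ≤ √(C * D) * X) : D ≤ C * X ^ 2 := by
  rcases hD.eq_or_lt with rfl | hD
  · positivity
  · have h1 : D ^ 2 ≤ C * D * X ^ 2 := by
      have := pow_le_pow_left₀ hD.le h 2
      rwa [mul_pow, Real.sq_sqrt (by positivity)] at this
    have h2 : D * D ≤ D * (C * X ^ 2) := by nlinarith
    exact le_of_mul_le_mul_left h2 hD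

theorem integral_add_sq_le {μ : Measure Plane} {a b : Plane → ℝ} (ha : MemLp a 2 μ)
    (hb : MemLp b 2 μ) :
    ∫ x, (a x + b x) ^ 2 ∂μ ≤ 2 * ∫ x, a x ^ 2 ∂μ + 2 * ∫ x, b x ^ 2 ∂μ := by
  rw [← integral_const_mul, ← integral_const_mul,
    ← integral_add (ha.integrable_sq.const_mul 2) (hb.integrable_sq.const_mul 2)]
  refine integral_mono (ha.add hb).integrable_sq
    ((ha.integrable_sq.const_mul 2).add (hb.integrable_sq.const_mul 2)) fun x => ?_
  have := sq_nonneg (a x - b x)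
  change (a x + b x) ^ 2 ≤ 2 * a x ^ 2 + 2 * b x ^ 2
  nlinarith

end Residual

/-! ### Efficiency of the volume residual -/

section Volume

variable {Ω : Set Plane}

theorem sqrt_integral_partialDeriv_le {c : Plane} {r : ℝ} (hr : 0 < r) {P : Poly2} {A : ℝ}
    (j : Fin 2) (h : r ^ 2 * ∫ x, partialDeriv j (bubble c r P) x ^ 2 ≤ A) :
    √(∫ x, partialDeriv j (bubble c r P) x ^ 2) ≤ √A / r := by
  rw [le_div_iff₀ hr, mul_comm]
  calc r * √(∫ x, partialDeriv j (bubble c r P) x ^ 2)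
      = √(r ^ 2 * ∫ x, partialDeriv j (bubble c r P) x ^ 2) := by
        rw [Real.sqrt_mul (sq_nonneg r), Real.sqrt_sq hr.le]
    _ ≤ √A := Real.sqrt_le_sqrt h

theorem IsTest.sum_inner_grad_eq (𝒯 : Triangulation Ω) {m : ℕ} {P : Finset Plane → Poly2}
    {w : H1 Ω} (hw : IsPiecewise 𝒯 m P (fn w)) {T : Finset Plane} (hT : T ∈ 𝒯.cells)
    {φ : Plane → ℝ} (h : IsTest (interior (hull T)) φ) :
    ∑ j, ∫ x in Ω, grad w j x * StokesFE.partialDeriv j φ x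
      = -∫ x, pval (polyLaplacian (P T)) x * φ x := by
  have hΩ := h.mono (interior_hull_subset 𝒯 hT)
  have h1 : ∀ j, ∫ x in Ω, grad w j x * StokesFE.partialDeriv j φ x
      = -∫ x, pval (MvPolynomial.pderiv j (MvPolynomial.pderiv j (P T))) x * φ x := by
    intro j
    have e1 : ∫ x in Ω, grad w j x * StokesFE.partialDeriv j φ x
        = ∫ x in hull T, grad w j x * StokesFE.partialDeriv j φ x := by
      rw [(hΩ.partialDeriv j).setIntegral_mul_eq,
        (h.partialDeriv j).setIntegral_mul_eq_of_subset interior_subset]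
    have e2 : ∫ x in hull T, grad w j x * StokesFE.partialDeriv j φ x
        = ∫ x in hull T, pval (MvPolynomial.pderiv j (P T)) x * StokesFE.partialDeriv j φ x := by
      refine integral_congr_ae ?_
      filter_upwards [grad_eq_pderiv 𝒯 hw hT j] with x hx
      rw [hx]
    rw [e1, e2, (h.partialDeriv j).setIntegral_mul_eq_of_subset interior_subset,
      integral_mul_partialDeriv (contDiff_pval _) h.smooth h.compact, partialDeriv_pval]
  simp only [h1, Finset.sum_neg_distrib]
  rw [← integral_finsetSum _ fun j _ => h.integrable_mul_continuous (continuous_pval _) _]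
  congr 1
  refine integral_congr_ae (Eventually.of_forall fun x => ?_)
  simp only [polyLaplacian, pval_sum, Finset.sum_mul]

/-- The arithmetic of the volume bound on a cell of diameter `h`. In the application `E` and `D` are
the squared norms of the polynomial `P + νΔu_h` on the cell and on a small disc, `e`, `W₀`, `W₁`,
`B` are those of the data minus `P`, of the two derivatives of the velocity error and of the pressure
error, `R` is that of the residual, and `hX` is the tested residual identity. -/
theorem sq_mul_le_of_residual_bounds {C κ ν h r e E D W₀ W₁ B R : ℝ} (hC : 0 ≤ C) (hν : 0 ≤ ν)
    (hr : 0 < r) (hh0 : 0 ≤ h) (hdiam : h ≤ κ * r) (he : 0 ≤ e) (hW₀ : 0 ≤ W₀) (hW₁ : 0 ≤ W₁)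
    (hB : 0 ≤ B) (hED : E ≤ C * D)
    (hX : D ≤ C * (√e + (ν * (√W₀ + √W₁) + √B) / r) ^ 2) (hR : R ≤ 2 * e + 2 * E) :
    h ^ 2 * R ≤ (2 + 8 * C ^ 2 * (1 + κ ^ 2)) * (h ^ 2 * e + ν ^ 2 * (W₀ + W₁) + B) := by
  have h1 : 0 ≤ ν * (√W₀ + √W₁) + √B := by positivity
  have hhX : h * (√e + (ν * (√W₀ + √W₁) + √B) / r) ≤ h * √e + κ * (ν * (√W₀ + √W₁) + √B) := by
    have h2 : h / r ≤ κ := (div_le_iff₀ hr).2 hdiam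
    calc h * (√e + (ν * (√W₀ + √W₁) + √B) / r)
        = h * √e + h / r * (ν * (√W₀ + √W₁) + √B) := by ring
      _ ≤ _ := add_le_add_right (mul_le_mul_of_nonneg_right h2 h1) _
  have key : ∀ x y z w : ℝ, (x + (y + z + w)) ^ 2 ≤ 4 * (x ^ 2 + (y ^ 2 + z ^ 2 + w ^ 2)) := by
    intro x y z w
    nlinarith [sq_nonneg (x - y), sq_nonneg (x - z), sq_nonneg (x - w), sq_nonneg (y - z),
      sq_nonneg (y - w), sq_nonneg (z - w)]
  have hhX2 : h ^ 2 * (√e + (ν * (√W₀ + √W₁) + √B) / r) ^ 2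
      ≤ 4 * (h ^ 2 * e + κ ^ 2 * (ν ^ 2 * (W₀ + W₁) + B)) := by
    have h2 := pow_le_pow_left₀ (by positivity) hhX 2
    rw [mul_pow] at h2
    refine h2.trans ?_
    calc (h * √e + κ * (ν * (√W₀ + √W₁) + √B)) ^ 2
        = (h * √e + (κ * (ν * √W₀) + κ * (ν * √W₁) + κ * √B)) ^ 2 := by ring
      _ ≤ _ := key _ _ _ _
      _ = 4 * (h ^ 2 * √e ^ 2 + κ ^ 2 * (ν ^ 2 * (√W₀ ^ 2 + √W₁ ^ 2) + √B ^ 2)) := by ring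
      _ = _ := by rw [Real.sq_sqrt he, Real.sq_sqrt hW₀, Real.sq_sqrt hW₁, Real.sq_sqrt hB]
  have hS : 0 ≤ ν ^ 2 * (W₀ + W₁) + B := by positivity
  have he2 : 0 ≤ h ^ 2 * e := by positivity
  have h3 : R ≤ 2 * e + 2 * (C * (C * (√e + (ν * (√W₀ + √W₁) + √B) / r) ^ 2)) := by
    have := mul_le_mul_of_nonneg_left hX hC
    linarith
  calc h ^ 2 * R
      ≤ h ^ 2 * (2 * e + 2 * (C * (C * (√e + (ν * (√W₀ + √W₁) + √B) / r) ^ 2))) :=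
        mul_le_mul_of_nonneg_left h3 (sq_nonneg h)
    _ = 2 * (h ^ 2 * e)
        + 2 * C ^ 2 * (h ^ 2 * (√e + (ν * (√W₀ + √W₁) + √B) / r) ^ 2) := by ring
    _ ≤ 2 * (h ^ 2 * e) + 2 * C ^ 2 * (4 * (h ^ 2 * e + κ ^ 2 * (ν ^ 2 * (W₀ + W₁) + B))) := by
        gcongr
    _ ≤ (2 + 8 * C ^ 2 * (1 + κ ^ 2)) * (h ^ 2 * e + (ν ^ 2 * (W₀ + W₁) + B)) := by
        have t1 : 0 ≤ C ^ 2 * (κ ^ 2 * (h ^ 2 * e)) := by positivity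
        have t2 : 0 ≤ C ^ 2 * (ν ^ 2 * (W₀ + W₁) + B) := by positivity
        linarith
    _ = _ := by ring

/-- The local bound: the residual `g + νΔu_h`, with `g` replaced by a polynomial, is tested with
itself times a smooth bump. -/
theorem exists_volume_local (κ : ℝ) (m k : ℕ) :
    ∃ C : ℝ, 0 < C ∧ ∀ (Ω : Set Plane) (𝒯 : Triangulation Ω), ShapeRegular 𝒯 κ →
      ∀ ν : ℝ, 0 < ν → ∀ (f : L2v Ω) (uD u : H1v Ω) (p : L2 Ω), IsStokesSolution ν f uD u p →
      ∀ (uh : H1v Ω) (U : Fin 2 → Finset Plane → Poly2), IsPiecewiseV 𝒯 m U uh →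
      ∀ (q : H1 Ω) (i : Fin 2), ∀ T ∈ 𝒯.cells, ∀ P : Poly2, P.totalDegree ≤ k →
        Metric.diam (hull T) ^ 2 *
          ∫ x in hull T, ((f - grad q) i x + ν * brokenLaplacian 𝒯 (U i) x) ^ 2 ≤
        C * (Metric.diam (hull T) ^ 2 * (∫ x in hull T, ((f - grad q) i x - pval P x) ^ 2)
          + ν ^ 2 * (∑ j, ∫ x in hull T, grad ((u - uh) i) j x ^ 2)
          + ∫ x in hull T, (p - fn q : L2 Ω) x ^ 2) := by
  obtain ⟨C, hC, hbub⟩ := exists_bubble_bound (max k m) κ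
  refine ⟨2 + 8 * C ^ 2 * (1 + κ ^ 2), by positivity, ?_⟩
  intro Ω 𝒯 hreg ν hν f uD u p hsol uh U hU q i T hT P hP
  obtain ⟨c, r, hr, hball, hdiam⟩ := hreg T hT
  set L := polyLaplacian (U i T) with hL
  set g : L2 Ω := (f - grad q) i with hg
  set Q : Poly2 := P + ν • L with hQ
  have hQdeg : Q.totalDegree ≤ max k m :=
    (MvPolynomial.totalDegree_add _ _).trans (max_le_max hP
      ((MvPolynomial.totalDegree_smul_le _ _).trans
        ((totalDegree_polyLaplacian_le _).trans (hU i T hT).1)))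
  obtain ⟨hb1, hb2⟩ := hbub Q hQdeg c r hr
  set D := ∫ x in Metric.ball c (1 / 4 * r), pval Q x ^ 2 with hD
  have hD0 : 0 ≤ D := integral_nonneg fun x => sq_nonneg _
  set E := ∫ x in hull T, pval Q x ^ 2 with hE
  set ψ := bubble c r Q with hψ
  have hballint : Metric.ball c r ⊆ interior (hull T) :=
    (Metric.isOpen_ball.subset_interior_iff).2 (Metric.ball_subset_closedBall.trans hball)
  have hψT : IsTest (interior (hull T)) ψ := (isTest_bubble hr).mono hballint
  have hψΩ : IsTest Ω ψ := hψT.mono (interior_hull_subset 𝒯 hT)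
  have hint : ∀ S : Set Plane, IsCompact S → IntegrableOn (fun x => pval Q x ^ 2) S := fun S hS =>
    ((continuous_pval Q).pow 2).continuousOn.integrableOn_compact hS
  have hED : E ≤ C * D := by
    refine le_trans ?_ hb1
    refine setIntegral_mono_set (hint _ (isCompact_closedBall _ _))
      (Eventually.of_forall fun x => sq_nonneg _) (LE.le.eventuallyLE fun x hx => ?_)
    exact (dist_le_diam_hull hx (hball (Metric.mem_closedBall_self hr.le))).trans hdiam
  have hψ2 : ∫ x, ψ x ^ 2 ≤ C * D := by
    refine le_trans ((integral_bubble_sq_le hr).trans ?_) hED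
    exact setIntegral_mono_set (hint _ (isCompact_hull T))
      (Eventually.of_forall fun x => sq_nonneg _)
      (LE.le.eventuallyLE (hballint.trans interior_subset))
  have hle := restrict_hull_le 𝒯 hT
  have hgT : MemLp g 2 (volume.restrict (hull T)) := (Lp.memLp g).mono_measure hle
  have hpT : ∀ R : Poly2, MemLp (pval R) 2 (volume.restrict (hull T)) := fun R =>
    memLp_of_continuous (continuous_pval R) (isCompact_hull T)
  set e := ∫ x in hull T, (g x - pval P x) ^ 2 with he
  set W : Fin 2 → ℝ := fun j => ∫ x in hull T, grad ((u - uh) i) j x ^ 2 with hW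
  set B := ∫ x in hull T, (p - fn q : L2 Ω) x ^ 2 with hB
  have he0 : 0 ≤ e := integral_nonneg fun x => sq_nonneg _
  have hW0 : ∀ j, 0 ≤ W j := fun j => integral_nonneg fun x => sq_nonneg _
  have hB0 : 0 ≤ B := integral_nonneg fun x => sq_nonneg _
  -- the residual equation for the test function `ψ e_i`
  have hres : (∫ x in hull T, g x * ψ x) + ν * ∫ x, pval L x * ψ x
      = ν * (∑ j, ∫ x in Ω, grad ((u - uh) i) j x * partialDeriv j ψ x)
        - ∫ x in Ω, (p - fn q : L2 Ω) x * partialDeriv i ψ x := by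
    have h1 := hsol.residual q hψΩ i
    have h2 := hψT.sum_inner_grad_eq 𝒯 (hU i) hT
    have h3 : ∀ j, inner ℝ (grad (u i) j) (hψΩ.partialDeriv j).toL2
        = (∫ x in Ω, grad ((u - uh) i) j x * partialDeriv j ψ x)
          + ∫ x in Ω, grad (uh i) j x * partialDeriv j ψ x := by
      intro j
      rw [← IsTest.inner_toL2 (hψΩ.partialDeriv j), ← IsTest.inner_toL2 (hψΩ.partialDeriv j),
        ← inner_add_left]
      congr 1
      change _ = (grad (u i) j - grad (uh i) j) + grad (uh i) j
      rw [sub_add_cancel]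
    simp only [h3, Finset.sum_add_distrib, h2] at h1
    rw [IsTest.inner_toL2, IsTest.inner_toL2, hψΩ.setIntegral_mul_eq,
      ← hψT.setIntegral_mul_eq_of_subset interior_subset] at h1
    linarith
  have hψL : MemLp ψ 2 (volume.restrict (hull T)) := hψT.memLp _
  have hDle : D ≤ √(C * D) * (√e + (ν * ∑ j, √(W j) + √B) / r) := by
    have h1 : D ≤ ∫ x, pval Q x * ψ x := integral_sq_le_integral_bubble_mul hr
    have h2 : ∫ x, pval Q x * ψ x = (∫ x in hull T, (pval P x - g x) * ψ x)
        + ((∫ x in hull T, g x * ψ x) + ν * ∫ x, pval L x * ψ x) := by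
      have i1 : Integrable (fun x => pval P x * ψ x) (volume.restrict (hull T)) :=
        (hpT P).integrable_mul hψL
      have i2 : Integrable (fun x => g x * ψ x) (volume.restrict (hull T)) :=
        hgT.integrable_mul hψL
      have i3 : Integrable (fun x => pval L x * ψ x) (volume.restrict (hull T)) :=
        (hpT L).integrable_mul hψL
      rw [← hψT.setIntegral_mul_eq_of_subset interior_subset (pval Q),
        ← hψT.setIntegral_mul_eq_of_subset interior_subset (pval L)]
      simp only [hQ, pval_add, pval_smul, add_mul, sub_mul, mul_assoc]
      rw [integral_add i1 (i3.const_mul ν), integral_sub i1 i2, integral_const_mul]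
      ring
    have h3 : ∫ x in hull T, (pval P x - g x) * ψ x ≤ √e * √(C * D) := by
      refine (le_abs_self _).trans ((abs_integral_mul_le ((hpT P).sub hgT) hψL).trans ?_)
      refine mul_le_mul (le_of_eq ?_) (Real.sqrt_le_sqrt ?_) (Real.sqrt_nonneg _)
        (Real.sqrt_nonneg _)
      · congr 1
        refine integral_congr_ae (Eventually.of_forall fun x => ?_)
        simp only [Pi.sub_apply]
        ring
      · exact (setIntegral_le_integral (hψT.memLp _).integrable_sq
          (Eventually.of_forall fun x => sq_nonneg _)).trans hψ2
    have h4 : ∀ (a : L2 Ω) (j : Fin 2), |∫ x in Ω, a x * partialDeriv j ψ x|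
        ≤ √(∫ x in hull T, a x ^ 2) * (√(C * D) / r) := fun a j =>
      ((hψT.partialDeriv j).abs_setIntegral_mul_le (interior_hull_subset 𝒯 hT) interior_subset
        ((Lp.memLp a).mono_measure hle)).trans
        (mul_le_mul_of_nonneg_left (sqrt_integral_partialDeriv_le hr j (hb2 j))
          (Real.sqrt_nonneg _))
    have h5 : ν * ∑ j, ∫ x in Ω, grad ((u - uh) i) j x * partialDeriv j ψ x
        ≤ ν * ∑ j, √(W j) * (√(C * D) / r) :=
      mul_le_mul_of_nonneg_left
        (Finset.sum_le_sum fun j _ => (le_abs_self _).trans (h4 _ j)) hν.le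
    have h6 := (neg_le_abs _).trans (h4 (p - fn q) i)
    rw [h2, hres] at h1
    refine h1.trans ((add_le_add h3 (sub_le_sub h5 (neg_le.1 h6))).trans (le_of_eq ?_))
    rw [← Finset.sum_mul]
    ring
  have hX := le_mul_sq_of_le_sqrt_mul hC.le hD0 hDle
  set h := Metric.diam (hull T) with hh
  have hh0 : 0 ≤ h := Metric.diam_nonneg
  -- the residual itself, after replacing the polynomial by `g` again
  have hfin : ∫ x in hull T, (g x + ν * brokenLaplacian 𝒯 (U i) x) ^ 2 ≤ 2 * e + 2 * E := by
    have h1 : ∫ x in hull T, (g x + ν * brokenLaplacian 𝒯 (U i) x) ^ 2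
        = ∫ x in hull T, ((g x - pval P x) + pval Q x) ^ 2 := by
      refine integral_congr_ae ?_
      filter_upwards [ae_brokenLaplacian_eq 𝒯 hT (U i)] with x hx
      rw [hx, hQ, pval_add, pval_smul]
      ring
    rw [h1]
    exact integral_add_sq_le (hgT.sub (hpT P)) (hpT Q)
  rw [Fin.sum_univ_two] at hX ⊢
  exact sq_mul_le_of_residual_bounds hC.le hν.le hr hh0 hdiam he0 (hW0 0) (hW0 1) hB0 hED hX hfin

theorem sum_cells_gradNorm (𝒯 : Triangulation Ω) (w : H1v Ω) :
    ∑ T ∈ 𝒯.cells, ∑ i, ∑ j, ∫ x in hull T, grad (w i) j x ^ 2 = gradNorm w ^ 2 := by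
  rw [gradNorm_sq, Finset.sum_comm]
  refine Finset.sum_congr rfl fun i _ => ?_
  rw [Finset.sum_comm]
  exact Finset.sum_congr rfl fun j _ => sum_cells_integral_sq 𝒯 _

theorem osc_sq (𝒯 : Triangulation Ω) (k : ℕ) (g : L2v Ω) : osc 𝒯 k g ^ 2
    = ∑ T ∈ 𝒯.cells, Metric.diam (hull T) ^ 2 * ∑ i, bestApproxErrorSq k (hull T) (g i) :=
  Real.sq_sqrt (Finset.sum_nonneg fun _ _ => mul_nonneg (sq_nonneg _)
    (Finset.sum_nonneg fun _ _ => bestApproxErrorSq_nonneg _ _ _))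

theorem osc_nonneg (𝒯 : Triangulation Ω) (k : ℕ) (g : L2v Ω) : 0 ≤ osc 𝒯 k g := Real.sqrt_nonneg _

theorem etaVol_sq (𝒯 : Triangulation Ω) (ν : ℝ) (g : L2v Ω) (U : Fin 2 → Finset Plane → Poly2) :
    etaVol 𝒯 ν g U ^ 2 = ∑ T ∈ 𝒯.cells, Metric.diam (hull T) ^ 2 *
      ∑ i, ∫ x in hull T, (g i x + ν * brokenLaplacian 𝒯 (U i) x) ^ 2 :=
  Real.sq_sqrt (Finset.sum_nonneg fun _ _ => mul_nonneg (sq_nonneg _)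
    (Finset.sum_nonneg fun _ _ => integral_nonneg fun _ => sq_nonneg _))

/-- Efficiency of the volume contribution of the estimator. -/
theorem exists_volume_bound (κ : ℝ) (m k : ℕ) :
    ∃ C : ℝ, 0 < C ∧ ∀ (Ω : Set Plane) (𝒯 : Triangulation Ω), ShapeRegular 𝒯 κ →
      ∀ ν : ℝ, 0 < ν → ∀ (f : L2v Ω) (uD u : H1v Ω) (p : L2 Ω), IsStokesSolution ν f uD u p →
      ∀ (uh : H1v Ω) (U : Fin 2 → Finset Plane → Poly2), IsPiecewiseV 𝒯 m U uh → ∀ q : H1 Ω,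
        etaVol 𝒯 ν (f - grad q) U
          ≤ C * (ν * gradNorm (u - uh) + (‖p - fn q‖ + osc 𝒯 k (f - grad q))) := by
  obtain ⟨C, hC, hloc⟩ := exists_volume_local κ m k
  refine ⟨√(2 * C), by positivity, ?_⟩
  intro Ω 𝒯 hreg ν hν f uD u p hsol uh U hU q
  have h1 : etaVol 𝒯 ν (f - grad q) U ^ 2
      ≤ C * (osc 𝒯 k (f - grad q) ^ 2 + ν ^ 2 * gradNorm (u - uh) ^ 2 + 2 * ‖p - fn q‖ ^ 2) := by
    rw [etaVol_sq, osc_sq, ← sum_cells_gradNorm 𝒯, ← sum_cells_integral_sq 𝒯 (p - fn q),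
      Finset.mul_sum, Finset.mul_sum, ← Finset.sum_add_distrib, ← Finset.sum_add_distrib,
      Finset.mul_sum]
    refine Finset.sum_le_sum fun T hT => ?_
    have h2 : ∀ i, Metric.diam (hull T) ^ 2 *
        ∫ x in hull T, ((f - grad q) i x + ν * brokenLaplacian 𝒯 (U i) x) ^ 2
        ≤ C * (ν ^ 2 * (∑ j, ∫ x in hull T, grad ((u - uh) i) j x ^ 2)
          + ∫ x in hull T, (p - fn q : L2 Ω) x ^ 2)
          + (C * Metric.diam (hull T) ^ 2) * bestApproxErrorSq k (hull T) ((f - grad q) i) :=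
      fun i => le_add_mul_bestApproxErrorSq (by positivity) fun P hP => by
        have := hloc Ω 𝒯 hreg ν hν f uD u p hsol uh U hU q i T hT P hP
        linarith
    rw [Finset.mul_sum]
    refine (Finset.sum_le_sum fun i _ => h2 i).trans (le_of_eq ?_)
    simp only [Fin.sum_univ_two]
    ring
  have hg := gradNorm_nonneg (u - uh)
  have ho := osc_nonneg 𝒯 k (f - grad q)
  have hp := norm_nonneg (p - fn q)
  refine (sq_le_sq₀ (Real.sqrt_nonneg _) (by positivity)).1 (h1.trans ?_)
  rw [mul_pow, Real.sq_sqrt (by positivity)]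
  have hνg : 0 ≤ ν * gradNorm (u - uh) := by positivity
  have key : ∀ a b d : ℝ, 0 ≤ a → 0 ≤ b → 0 ≤ d →
      b ^ 2 + a ^ 2 + 2 * d ^ 2 ≤ 2 * (a + (d + b)) ^ 2 := by
    intro a b d ha hb hd
    nlinarith [mul_nonneg ha hb, mul_nonneg ha hd, mul_nonneg hb hd, sq_nonneg a, sq_nonneg b]
  have := mul_le_mul_of_nonneg_left (key _ _ _ hνg ho hp) hC.le
  rw [mul_pow] at this
  linarith

end Volume

/-! ### Coordinates adapted to an edge, and Green's formula on a half-plane -/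

section Frame

/-- `τ` and `n` form an orthonormal basis of the plane. -/
structure IsFrame (τ n : Plane) : Prop where
  norm_tangent : ‖τ‖ = 1
  norm_normal : ‖n‖ = 1
  inner_eq_zero : inner ℝ τ n = 0

variable {τ n : Plane} (h : IsFrame τ n) (z : Plane)

include h

theorem IsFrame.orthonormal : Orthonormal ℝ ![τ, n] := by
  refine ⟨fun i => ?_, fun i j hij => ?_⟩
  · fin_cases i
    · exact h.norm_tangent
    · exact h.norm_normal
  · fin_cases i <;> fin_cases j
    · exact absurd rfl hij
    · exact h.inner_eq_zero
    · change inner ℝ n τ = 0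
      rw [real_inner_comm]; exact h.inner_eq_zero
    · exact absurd rfl hij

theorem IsFrame.neg : IsFrame τ (-n) :=
  ⟨h.norm_tangent, by rw [norm_neg]; exact h.norm_normal, by rw [inner_neg_right, h.inner_eq_zero,
    neg_zero]⟩

/-- The orthonormal basis formed by a frame. -/
noncomputable def IsFrame.basis : OrthonormalBasis (Fin 2) ℝ Plane :=
  OrthonormalBasis.mk h.orthonormal
    (h.orthonormal.linearIndependent.span_eq_top_of_card_eq_finrank (by simp)).ge

theorem IsFrame.basis_zero : h.basis 0 = τ := by simp [IsFrame.basis]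

theorem IsFrame.basis_one : h.basis 1 = n := by simp [IsFrame.basis]

theorem IsFrame.decompose (v : Plane) : v = inner ℝ τ v • τ + inner ℝ n v • n := by
  have := h.basis.sum_repr' v
  rw [Fin.sum_univ_two, h.basis_zero, h.basis_one] at this
  exact this.symm

/-- The coordinates `(s, t) ↦ z + sτ + tn` of the plane, as a measurable equivalence. -/
noncomputable def IsFrame.coords : ℝ × ℝ ≃ᵐ Plane :=
  (MeasurableEquiv.finTwoArrow (α := ℝ)).symm.trans
    ((MeasurableEquiv.toLp 2 (Fin 2 → ℝ)).trans
      (h.basis.measurableEquiv.symm.trans (MeasurableEquiv.addLeft z)))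

theorem IsFrame.coords_apply (q : ℝ × ℝ) : h.coords z q = z + q.1 • τ + q.2 • n := by
  have : h.coords z q = z + h.basis.repr.symm (WithLp.toLp 2 ![q.1, q.2]) := rfl
  rw [this, ← h.basis.sum_repr (h.basis.repr.symm _), LinearIsometryEquiv.apply_symm_apply,
    Fin.sum_univ_two, h.basis_zero, h.basis_one, add_assoc]
  simp

theorem IsFrame.measurePreserving_coords : MeasurePreserving (h.coords z) volume volume :=
  ((measurePreserving_add_left volume z).comp h.basis.measurePreserving_repr_symm).comp
    (((EuclideanSpace.volume_preserving_symm_measurableEquiv_toLp (Fin 2)).symm).comp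
      ((volume_preserving_finTwoArrow ℝ).symm))

theorem IsFrame.inner_tangent (q : ℝ × ℝ) : inner ℝ τ (h.coords z q - z) = q.1 := by
  rw [h.coords_apply, add_assoc, add_sub_cancel_left, inner_add_right, inner_smul_right,
    inner_smul_right, h.inner_eq_zero, real_inner_self_eq_norm_sq, h.norm_tangent]
  ring

theorem IsFrame.inner_normal (q : ℝ × ℝ) : inner ℝ n (h.coords z q - z) = q.2 := by
  rw [h.coords_apply, add_assoc, add_sub_cancel_left, inner_add_right, inner_smul_right,
    inner_smul_right, real_inner_comm, h.inner_eq_zero, real_inner_self_eq_norm_sq, h.norm_normal]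
  ring

theorem IsFrame.setIntegral_coords (F : Plane → ℝ) (S T : Set ℝ) :
    ∫ x in {x | inner ℝ τ (x - z) ∈ S ∧ inner ℝ n (x - z) ∈ T}, F x
      = ∫ q in S ×ˢ T, F (h.coords z q) := by
  rw [← (h.measurePreserving_coords z).setIntegral_preimage_emb (h.coords z).measurableEmbedding]
  congr 2
  ext q
  simp only [Set.mem_preimage, Set.mem_ofPred_eq, h.inner_tangent, h.inner_normal, Set.mem_prod]

omit h in
theorem isometry_line {d : Plane} (hd : ‖d‖ = 1) (p : Plane) : Isometry fun s : ℝ => p + s • d :=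
  Isometry.of_dist_eq fun s t => by
    rw [dist_add_left, dist_eq_norm, ← sub_smul, norm_smul, hd, mul_one, dist_eq_norm]

omit h in
theorem contDiff_line (d p : Plane) : ContDiff ℝ ∞ fun s : ℝ => p + s • d :=
  contDiff_const.add (contDiff_id.smul contDiff_const)

omit h in
theorem hasCompactSupport_comp_line {w : Plane → ℝ} (hw : HasCompactSupport w) {d : Plane}
    (hd : ‖d‖ = 1) (p : Plane) : HasCompactSupport fun s : ℝ => w (p + s • d) :=
  hw.comp_isClosedEmbedding (isometry_line hd p).isClosedEmbedding

omit h in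
theorem deriv_comp_line {w : Plane → ℝ} (hw : ContDiff ℝ ∞ w) (d p : Plane) :
    deriv (fun s : ℝ => w (p + s • d)) = fun s => fderiv ℝ w (p + s • d) d := by
  funext s
  have h1 : HasDerivAt (fun s : ℝ => p + s • d) d s := by
    simpa using ((hasDerivAt_id s).smul_const d).const_add p
  exact ((hw.differentiable (by simp) _).hasFDerivAt.comp_hasDerivAt s h1).deriv

omit h in
/-- The integral of a derivative along a whole line vanishes. -/
theorem integral_fderiv_line {w : Plane → ℝ} (hw : ContDiff ℝ ∞ w) (hc : HasCompactSupport w)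
    {d : Plane} (hd : ‖d‖ = 1) (p : Plane) : ∫ s : ℝ, fderiv ℝ w (p + s • d) d = 0 := by
  have hg : ContDiff ℝ ∞ fun s : ℝ => w (p + s • d) := hw.comp (contDiff_line d p)
  have hgc := hasCompactSupport_comp_line hc hd p
  rw [← deriv_comp_line hw]
  exact integral_eq_zero_of_hasDerivAt_of_integrable
    (fun s => (hg.differentiable (by simp) s).hasDerivAt)
    ((hg.continuous_deriv (by simp)).integrable_of_hasCompactSupport hgc.deriv)
    (hg.continuous.integrable_of_hasCompactSupport hgc)

omit h in
/-- The integral of a derivative along a half-line. -/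
theorem integral_fderiv_halfLine {w : Plane → ℝ} (hw : ContDiff ℝ ∞ w) (hc : HasCompactSupport w)
    {d : Plane} (hd : ‖d‖ = 1) (p : Plane) :
    ∫ s in Set.Ici (0 : ℝ), fderiv ℝ w (p + s • d) d = -w p := by
  have hg : ContDiff ℝ ∞ fun s : ℝ => w (p + s • d) := hw.comp (contDiff_line d p)
  rw [integral_Ici_eq_integral_Ioi, ← deriv_comp_line hw,
    (hasCompactSupport_comp_line hc hd p).integral_Ioi_deriv_eq (hg.of_le (by simp))]
  simp

/-- Green's formula on a half-plane. -/
theorem IsFrame.integral_halfPlane {w : Plane → ℝ} (hw : ContDiff ℝ ∞ w)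
    (hc : HasCompactSupport w) (v : Plane) :
    ∫ x in {x | 0 ≤ inner ℝ n (x - z)}, fderiv ℝ w x v
      = -(inner ℝ n v * ∫ s : ℝ, w (z + s • τ)) := by
  have hset : {x : Plane | 0 ≤ inner ℝ n (x - z)}
      = {x | inner ℝ τ (x - z) ∈ Set.univ ∧ inner ℝ n (x - z) ∈ Set.Ici (0 : ℝ)} := by
    ext x; simp
  have hint : ∀ d : Plane, Integrable (fun x => fderiv ℝ w x d) := fun d =>
    ((hw.continuous_fderiv (by simp)).clm_apply continuous_const).integrable_of_hasCompactSupport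
      (hc.fderiv_apply (𝕜 := ℝ) d)
  have hintq : ∀ d : Plane, Integrable (fun q : ℝ × ℝ => fderiv ℝ w (h.coords z q) d)
      ((volume.restrict Set.univ).prod (volume.restrict (Set.Ici (0 : ℝ)))) := fun d => by
    rw [Measure.prod_restrict]
    exact (((h.measurePreserving_coords z).integrable_comp_emb
      (h.coords z).measurableEmbedding).2 (hint d)).integrableOn
  have hτ : ∫ x in {x | 0 ≤ inner ℝ n (x - z)}, fderiv ℝ w x τ = 0 := by
    rw [hset, h.setIntegral_coords, Measure.volume_eq_prod, ← Measure.prod_restrict,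
      integral_prod_symm _ (hintq τ), Measure.restrict_univ]
    have : ∀ t : ℝ, ∫ s : ℝ, fderiv ℝ w (h.coords z (s, t)) τ = 0 := fun t => by
      rw [← integral_fderiv_line hw hc h.norm_tangent (z + t • n)]
      congr 1; funext s
      rw [h.coords_apply, add_right_comm]
    simp [this]
  have hn : ∫ x in {x | 0 ≤ inner ℝ n (x - z)}, fderiv ℝ w x n = -∫ s : ℝ, w (z + s • τ) := by
    rw [hset, h.setIntegral_coords, Measure.volume_eq_prod, ← Measure.prod_restrict,
      integral_prod _ (hintq n), Measure.restrict_univ, ← integral_neg]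
    congr 1; funext s
    rw [← integral_fderiv_halfLine hw hc h.norm_normal (z + s • τ)]
    simp only [h.coords_apply]
  have hv : ∀ x, fderiv ℝ w x v
      = inner ℝ τ v * fderiv ℝ w x τ + inner ℝ n v * fderiv ℝ w x n := fun x => by
    conv_lhs => rw [h.decompose v]
    rw [map_add, map_smul, map_smul, smul_eq_mul, smul_eq_mul]
  simp only [hv]
  rw [integral_add ((hint τ).integrableOn.const_mul _) ((hint n).integrableOn.const_mul _),
    integral_const_mul, integral_const_mul, hτ, hn]
  ring

theorem IsFrame.sq_norm (v : Plane) : ‖v‖ ^ 2 = inner ℝ τ v ^ 2 + inner ℝ n v ^ 2 := by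
  have := h.basis.sum_sq_norm_inner_right v
  rw [Fin.sum_univ_two, h.basis_zero, h.basis_one] at this
  simpa using this.symm

/-- The integral over a square of a function that is constant in the normal direction. -/
theorem IsFrame.integral_square {F : Plane → ℝ} (hF : Continuous F)
    (hconst : ∀ s t : ℝ, F (z + s • τ + t • n) = F (z + s • τ)) {a : ℝ} (ha : 0 ≤ a) :
    ∫ x in {x | inner ℝ τ (x - z) ∈ Set.Icc (-a) a ∧ inner ℝ n (x - z) ∈ Set.Icc (-a) a}, F x
      = 2 * a * ∫ s in Set.Icc (-a) a, F (z + s • τ) := by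
  rw [h.setIntegral_coords]
  simp only [h.coords_apply, hconst]
  have hcont : Continuous fun q : ℝ × ℝ => F (z + q.1 • τ) := by fun_prop
  rw [Measure.volume_eq_prod, setIntegral_prod _
    (hcont.continuousOn.integrableOn_compact (isCompact_Icc.prod isCompact_Icc))]
  simp only [setIntegral_const, smul_eq_mul]
  rw [integral_const_mul]
  simp only [Measure.real, Real.volume_Icc]
  rw [ENNReal.toReal_ofReal (by linarith)]
  ring

theorem IsFrame.integral_ball_le {F : Plane → ℝ} (hF : Continuous F) (h0 : ∀ x, 0 ≤ F x)
    (hconst : ∀ s t : ℝ, F (z + s • τ + t • n) = F (z + s • τ)) {a : ℝ} (ha : 0 ≤ a) :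
    ∫ x in Metric.ball z a, F x ≤ 2 * a * ∫ s in Set.Icc (-a) a, F (z + s • τ) := by
  rw [← h.integral_square z hF hconst ha]
  refine setIntegral_mono_set ?_ (Eventually.of_forall h0) (LE.le.eventuallyLE fun x hx => ?_)
  · refine (hF.continuousOn.integrableOn_compact (isCompact_closedBall z (2 * a))).mono_set ?_
    rintro x ⟨h1, h2⟩
    rw [mem_closedBall_iff_norm]
    refine le_of_sq_le_sq (α := ℝ) ?_ (by linarith)
    rw [h.sq_norm]
    nlinarith [h1.1, h1.2, h2.1, h2.2]
  · have h3 : ‖x - z‖ < a := mem_ball_iff_norm.1 hx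
    have h4 := h.sq_norm (x - z)
    refine ⟨abs_le.1 (abs_le_of_sq_le_sq ?_ ha), abs_le.1 (abs_le_of_sq_le_sq ?_ ha)⟩ <;>
    nlinarith [sq_nonneg (inner ℝ τ (x - z)), sq_nonneg (inner ℝ n (x - z)), norm_nonneg (x - z)]

theorem IsFrame.le_integral_closedBall {F : Plane → ℝ} (hF : Continuous F) (h0 : ∀ x, 0 ≤ F x)
    (hconst : ∀ s t : ℝ, F (z + s • τ + t • n) = F (z + s • τ)) {a : ℝ} (ha : 0 ≤ a) :
    2 * a * ∫ s in Set.Icc (-a) a, F (z + s • τ) ≤ ∫ x in Metric.closedBall z (2 * a), F x := by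
  rw [← h.integral_square z hF hconst ha]
  refine setIntegral_mono_set
    (hF.continuousOn.integrableOn_compact (isCompact_closedBall z (2 * a)))
    (Eventually.of_forall h0) (LE.le.eventuallyLE ?_)
  rintro x ⟨h1, h2⟩
  rw [mem_closedBall_iff_norm]
  refine le_of_sq_le_sq (α := ℝ) ?_ (by linarith)
  rw [h.sq_norm]
  nlinarith [h1.1, h1.2, h2.1, h2.2]

omit h in
/-- Integrals along an edge with respect to arc length, in terms of a unit-speed parametrization. -/
theorem integral_image_line {d : Plane} (hd : ‖d‖ = 1) (p : Plane) {F : Plane → ℝ}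
    (hF : Continuous F) {S : Set ℝ} (hS : IsCompact S) :
    ∫ x in (fun s : ℝ => p + s • d) '' S, F x ∂(Measure.hausdorffMeasure 1)
      = ∫ s in S, F (p + s • d) := by
  have hi := isometry_line hd p
  have hm : MeasurableSet ((fun s : ℝ => p + s • d) '' S) :=
    (hS.image hi.continuous).isClosed.measurableSet
  have h1 : (Measure.hausdorffMeasure 1 : Measure Plane).restrict ((fun s : ℝ => p + s • d) '' S)
      = (Measure.map (fun s : ℝ => p + s • d) volume).restrict
        ((fun s : ℝ => p + s • d) '' S) := by
    rw [← hausdorffMeasure_real, hi.map_hausdorffMeasure (Or.inl zero_le_one),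
      Measure.restrict_restrict hm, Set.inter_eq_left.2 (Set.image_subset_range _ _)]
  rw [h1, setIntegral_map hm hF.aestronglyMeasurable hi.continuous.aemeasurable,
    hi.injective.preimage_image]

end Frame

/-! ### The two cells at an inner edge -/

section EdgeGeometry

variable {Ω : Set Plane} (𝒯 : Triangulation Ω)

/-- Near the midpoint of an edge, within the radius of a disc contained in the cell, the cell is a
half-disc, because the barycentric coordinates vary slowly at that scale. -/
theorem exists_side {T : Finset Plane} (hT : T ∈ 𝒯.cells) {a b : Plane} (hab : a ≠ b)
    (ha : a ∈ T) (hb : b ∈ T) {c : Plane} {r : ℝ} (hr : 0 < r)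
    (hball : Metric.closedBall c r ⊆ hull T) {n : Plane} (hn : ‖n‖ = 1)
    (hperp : inner ℝ n (a - b) = 0) :
    ∃ σ : ℝ, (σ = 1 ∨ σ = -1) ∧
      (∀ x ∈ hull T, 0 ≤ inner ℝ (σ • n) (x - midpoint ℝ a b)) ∧
      ∀ x ∈ Metric.ball (midpoint ℝ a b) r,
        0 ≤ inner ℝ (σ • n) (x - midpoint ℝ a b) → x ∈ hull T := by
  classical
  obtain ⟨l, hl1, hl0, hsum, hcomb, hhull⟩ :=
    exists_barycentric (𝒯.card_eq T hT) (𝒯.nondegenerate T hT)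
  obtain ⟨d, hd, hdab⟩ : ∃ d ∈ T, d ∉ ({a, b} : Finset Plane) :=
    Finset.exists_mem_notMem_of_card_lt_card (by rw [𝒯.card_eq T hT, Finset.card_pair hab]; simp)
  simp only [Finset.mem_insert, Finset.mem_singleton, not_or] at hdab
  have hTeq : T = {a, b, d} := by
    symm
    refine Finset.eq_of_subset_of_card_le ?_ ?_
    · intro x hx
      simp only [Finset.mem_insert, Finset.mem_singleton] at hx
      rcases hx with rfl | rfl | rfl <;> assumption
    · rw [𝒯.card_eq T hT, Finset.card_eq_three.2
        ⟨a, b, d, hab, fun h => hdab.1 h.symm, fun h => hdab.2 h.symm, rfl⟩]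
  have hnotin : a ∉ ({b, d} : Finset Plane) := by
    simp only [Finset.mem_insert, Finset.mem_singleton, not_or]
    exact ⟨hab, fun h => hdab.1 h.symm⟩
  have hnotin' : b ∉ ({d} : Finset Plane) := by
    simpa using fun h : b = d => hdab.2 h.symm
  have hsum3 : ∀ x, l a x + (l b x + l d x) = 1 := fun x => by
    have := hsum x
    rwa [hTeq, Finset.sum_insert hnotin, Finset.sum_insert hnotin', Finset.sum_singleton] at this
  have hcomb3 : ∀ x, l a x • a + (l b x • b + l d x • d) = x := fun x => by
    have := hcomb x
    rwa [hTeq, Finset.sum_insert hnotin, Finset.sum_insert hnotin', Finset.sum_singleton] at this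
  have hmem : ∀ x, x ∈ hull T ↔ 0 ≤ l a x ∧ 0 ≤ l b x ∧ 0 ≤ l d x := fun x => by
    rw [hhull, hTeq]
    simp
  have hIcc : ∀ y, y = a ∨ y = b → ∀ x ∈ Metric.closedBall c r, l y x ∈ Set.Icc (0 : ℝ) 1 := by
    intro y hy x hx
    obtain ⟨h1, h2, h3⟩ := (hmem x).1 (hball hx)
    have h4 := hsum3 x
    rcases hy with rfl | rfl
    · exact ⟨h1, by linarith⟩
    · exact ⟨h2, by linarith⟩
  have hlip : ∀ y, y = a ∨ y = b → ∀ x x', 2 * r * |l y x - l y x'| ≤ dist x x' :=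
    fun y hy => affine_lipschitz hr (hIcc y hy)
  set z := midpoint ℝ a b with hz
  have hza : l a z = 1 / 2 := by
    rw [hz, AffineMap.map_midpoint, hl1 a ha, hl0 a ha b hb hab, midpoint_eq_smul_add]
    norm_num
  have hzb : l b z = 1 / 2 := by
    rw [hz, AffineMap.map_midpoint, hl1 b hb, hl0 b hb a ha hab.symm, midpoint_eq_smul_add]
    norm_num
  set μ := inner ℝ n (d - z) with hμ
  have hz2 : z = (1 / 2 : ℝ) • (a + b) := by
    rw [hz, midpoint_eq_smul_add]; norm_num
  have haz : inner ℝ n (a - z) = 0 := by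
    have : a - z = (1 / 2 : ℝ) • (a - b) := by rw [hz2]; module
    rw [this, inner_smul_right, hperp, mul_zero]
  have hbz : inner ℝ n (b - z) = 0 := by
    have : b - z = (-1 / 2 : ℝ) • (a - b) := by rw [hz2]; module
    rw [this, inner_smul_right, hperp, mul_zero]
  -- the third barycentric coordinate is the signed distance to the edge, suitably normalized
  have hcoord : ∀ x, inner ℝ n (x - z) = l d x * μ := by
    intro x
    have h1 : x - z = l a x • (a - z) + (l b x • (b - z) + l d x • (d - z)) := by
      have e1 : l a x • (a - z) + (l b x • (b - z) + l d x • (d - z))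
          = (l a x • a + (l b x • b + l d x • d)) - (l a x + (l b x + l d x)) • z := by module
      rw [e1, hcomb3, hsum3, one_smul]
    rw [h1, inner_add_right, inner_add_right, inner_smul_right, inner_smul_right, inner_smul_right,
      haz, hbz]
    ring
  have hμ0 : μ ≠ 0 := by
    intro h0
    have := hcoord (z + n)
    rw [add_sub_cancel_left, real_inner_self_eq_norm_sq, hn, h0] at this
    norm_num at this
  obtain ⟨σ, hσ, hσμ⟩ : ∃ σ : ℝ, (σ = 1 ∨ σ = -1) ∧ 0 < σ * μ := by
    rcases lt_or_gt_of_ne hμ0 with h0 | h0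
    · exact ⟨-1, Or.inr rfl, by linarith⟩
    · exact ⟨1, Or.inl rfl, by linarith⟩
  have hinner : ∀ x, inner ℝ (σ • n) (x - z) = l d x * (σ * μ) := fun x => by
    rw [real_inner_smul_left, hcoord]; ring
  refine ⟨σ, hσ, fun x hx => ?_, fun x hx hx0 => ?_⟩
  · rw [hinner]
    exact mul_nonneg ((hmem x).1 hx).2.2 hσμ.le
  · rw [hinner] at hx0
    have hd0 : 0 ≤ l d x := nonneg_of_mul_nonneg_left hx0 hσμ
    have hx' : dist x z < r := hx
    have hpos : ∀ y, y = a ∨ y = b → l y z = 1 / 2 → 0 ≤ l y x := by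
      intro y hy hyz
      have h1 := (hlip y hy x z).trans_lt hx'
      rw [hyz] at h1
      have h2 : |l y x - 1 / 2| < 1 / 2 := by
        by_contra hc
        have := mul_le_mul_of_nonneg_left (not_lt.1 hc) (by linarith : 0 ≤ 2 * r)
        linarith
      linarith [(abs_lt.1 h2).1]
    exact (hmem x).2 ⟨hpos a (Or.inl rfl) hza, hpos b (Or.inr rfl) hzb, hd0⟩

/-- The two cells at an inner edge lie on different sides of it: near the midpoint they are
complementary half-discs. -/
theorem exists_sides {T₁ T₂ : Finset Plane} (hT₁ : T₁ ∈ 𝒯.cells) (hT₂ : T₂ ∈ 𝒯.cells)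
    (hne : T₁ ≠ T₂) {a b : Plane} (hab : a ≠ b) (ha₁ : a ∈ T₁) (hb₁ : b ∈ T₁) (ha₂ : a ∈ T₂)
    (hb₂ : b ∈ T₂) {ρ : ℝ} (hρ : 0 < ρ)
    (h₁ : ∃ c r, ρ ≤ r ∧ Metric.closedBall c r ⊆ hull T₁)
    (h₂ : ∃ c r, ρ ≤ r ∧ Metric.closedBall c r ⊆ hull T₂) {n : Plane} (hn : ‖n‖ = 1)
    (hperp : inner ℝ n (a - b) = 0) :
    ∃ σ : ℝ, (σ = 1 ∨ σ = -1) ∧ ∀ x ∈ Metric.ball (midpoint ℝ a b) ρ,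
      (x ∈ hull T₁ ↔ 0 ≤ inner ℝ (σ • n) (x - midpoint ℝ a b)) ∧
      (x ∈ hull T₂ ↔ 0 ≤ inner ℝ (-(σ • n)) (x - midpoint ℝ a b)) := by
  obtain ⟨c₁, r₁, hr₁, hball₁⟩ := h₁
  obtain ⟨c₂, r₂, hr₂, hball₂⟩ := h₂
  obtain ⟨σ, hσ, hs1, hs2⟩ := exists_side 𝒯 hT₁ hab ha₁ hb₁ (hρ.trans_le hr₁) hball₁ hn hperp
  obtain ⟨σ', hσ', hs1', hs2'⟩ :=
    exists_side 𝒯 hT₂ hab ha₂ hb₂ (hρ.trans_le hr₂) hball₂ hn hperp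
  set z := midpoint ℝ a b
  have hopp : σ' ≠ σ := by
    rintro rfl
    -- otherwise the two cells would share an open half-disc
    have hsub : Metric.ball z ρ ∩ {x | 0 < inner ℝ (σ' • n) (x - z)} ⊆ hull T₁ ∩ hull T₂ := by
      rintro x ⟨hx, hx0⟩
      exact ⟨hs2 x (Metric.ball_subset_ball hr₁ hx) (le_of_lt hx0),
        hs2' x (Metric.ball_subset_ball hr₂ hx) (le_of_lt hx0)⟩
    have hopen : IsOpen (Metric.ball z ρ ∩ {x | 0 < inner ℝ (σ' • n) (x - z)}) :=
      Metric.isOpen_ball.inter (isOpen_lt continuous_const (by fun_prop))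
    have hσn : ‖σ' • n‖ = 1 := by
      rw [norm_smul, hn, mul_one]
      rcases hσ with rfl | rfl <;> simp
    have hnonempty : (Metric.ball z ρ ∩ {x | 0 < inner ℝ (σ' • n) (x - z)}).Nonempty := by
      refine ⟨z + (ρ / 2) • (σ' • n), ?_, ?_⟩
      · rw [mem_ball_iff_norm, add_sub_cancel_left, norm_smul, hσn, mul_one,
          Real.norm_of_nonneg (by linarith)]
        linarith
      · change 0 < inner ℝ (σ' • n) (z + (ρ / 2) • (σ' • n) - z)
        rw [add_sub_cancel_left, inner_smul_right, real_inner_self_eq_norm_sq, hσn]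
        linarith
    exact (hopen.measure_pos volume hnonempty).ne'
      (measure_mono_null hsub (volume_hull_inter 𝒯 hT₁ hT₂ hne))
  have hneg : σ' • n = -(σ • n) := by
    rcases hσ with rfl | rfl <;> rcases hσ' with rfl | rfl
    · exact absurd rfl hopp
    · simp
    · simp
    · exact absurd rfl hopp
  refine ⟨σ, hσ, fun x hx => ⟨⟨hs1 x, hs2 x (Metric.ball_subset_ball hr₁ hx)⟩, ?_⟩⟩
  rw [← hneg]
  exact ⟨hs1' x, hs2' x (Metric.ball_subset_ball hr₂ hx)⟩

theorem setIntegral_eq_of_inter_eq {F : Plane → ℝ} {B S S' : Set Plane} (hS : MeasurableSet S)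
    (hS' : MeasurableSet S') (h0 : ∀ x ∉ B, F x = 0) (h : ∀ x ∈ B, x ∈ S ↔ x ∈ S') :
    ∫ x in S, F x = ∫ x in S', F x := by
  rw [← integral_indicator hS, ← integral_indicator hS']
  congr 1
  funext x
  by_cases hx : x ∈ B
  · by_cases hxS : x ∈ S
    · rw [Set.indicator_of_mem hxS, Set.indicator_of_mem ((h x hx).1 hxS)]
    · rw [Set.indicator_of_notMem hxS, Set.indicator_of_notMem fun h' => hxS ((h x hx).2 h')]
  · rw [Set.indicator_apply_eq_zero.2 fun _ => h0 x hx,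
      Set.indicator_apply_eq_zero.2 fun _ => h0 x hx]

variable {𝒯}

/-- Green's formula on a cell that is a half-disc on the support of the test function. -/
theorem IsFrame.green_cell {τ n z : Plane} (h : IsFrame τ n) {ρ : ℝ} {m : ℕ}
    {P : Finset Plane → Poly2} {w : H1 Ω} (hw : IsPiecewise 𝒯 m P (fn w)) {T : Finset Plane}
    (hT : T ∈ 𝒯.cells)
    (hside : ∀ x ∈ Metric.ball z ρ, x ∈ hull T ↔ 0 ≤ inner ℝ n (x - z))
    {ψ : Plane → ℝ} (hψ : IsTest (Metric.ball z ρ) ψ) :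
    ∫ x in hull T, (∑ j, grad w j x * partialDeriv j ψ x + brokenLaplacian 𝒯 P x * ψ x)
      = -∑ j, n j * ∫ s : ℝ, pval (MvPolynomial.pderiv j (P T)) (z + s • τ) * ψ (z + s • τ) := by
  have hsm : ∀ j, ContDiff ℝ ∞ fun x => pval (MvPolynomial.pderiv j (P T)) x * ψ x := fun j =>
    (contDiff_pval _).mul hψ.smooth
  have hcs : ∀ j, HasCompactSupport fun x => pval (MvPolynomial.pderiv j (P T)) x * ψ x := fun j =>
    hψ.compact.mul_left
  have hae : ∀ᵐ x ∂(volume.restrict (hull T)), ∀ j,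
      grad w j x = pval (MvPolynomial.pderiv j (P T)) x :=
    ae_all_iff.2 fun j => grad_eq_pderiv 𝒯 hw hT j
  have e1 : ∫ x in hull T, (∑ j, grad w j x * partialDeriv j ψ x + brokenLaplacian 𝒯 P x * ψ x)
      = ∫ x in hull T, ∑ j, partialDeriv j
          (fun y => pval (MvPolynomial.pderiv j (P T)) y * ψ y) x := by
    refine integral_congr_ae ?_
    filter_upwards [hae, ae_brokenLaplacian_eq 𝒯 hT P] with x hx hL
    rw [hL]
    simp only [hx, partialDeriv_mul (differentiable_pval _) (hψ.smooth.differentiable (by simp)),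
      partialDeriv_pval, polyLaplacian, pval_sum, Finset.sum_mul, Finset.sum_add_distrib]
    ring
  have hint : ∀ j, Integrable (partialDeriv j
      fun y => pval (MvPolynomial.pderiv j (P T)) y * ψ y) := fun j =>
    (contDiff_partialDeriv (hsm j) j).continuous.integrable_of_hasCompactSupport
      (hasCompactSupport_partialDeriv (hcs j) j)
  rw [e1, integral_finsetSum _ fun j _ => (hint j).integrableOn, ← Finset.sum_neg_distrib]
  refine Finset.sum_congr rfl fun j _ => ?_
  have hS' : MeasurableSet {x : Plane | 0 ≤ inner ℝ n (x - z)} :=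
    (isClosed_le continuous_const (by fun_prop)).measurableSet
  rw [setIntegral_eq_of_inter_eq (B := Metric.ball z ρ) (measurableSet_hull T) hS' ?_ hside]
  · have := h.integral_halfPlane z (hsm j) (hcs j) (EuclideanSpace.single j 1)
    rw [EuclideanSpace.inner_single_right] at this
    simpa [partialDeriv] using this
  · intro x hx
    refine partialDeriv_eq_zero_of_notMem_tsupport j fun h' => hx (hψ.supp ?_)
    exact closure_mono (Function.support_mul_subset_right _ _) h'

/-- Elementwise integration by parts at an inner edge produces the jump of the normal derivative. -/
theorem IsFrame.green_edge {τ n z : Plane} (h : IsFrame τ n) {ρ : ℝ} {m : ℕ}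
    {P : Finset Plane → Poly2} {w : H1 Ω} (hw : IsPiecewise 𝒯 m P (fn w)) {T₁ T₂ : Finset Plane}
    (hT₁ : T₁ ∈ 𝒯.cells) (hT₂ : T₂ ∈ 𝒯.cells) (hne : T₁ ≠ T₂)
    (hside₁ : ∀ x ∈ Metric.ball z ρ, x ∈ hull T₁ ↔ 0 ≤ inner ℝ n (x - z))
    (hside₂ : ∀ x ∈ Metric.ball z ρ, x ∈ hull T₂ ↔ 0 ≤ inner ℝ (-n) (x - z))
    {ψ : Plane → ℝ} (hψ : IsTest (Metric.ball z ρ) ψ) :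
    (∑ j, ∫ x in Ω, grad w j x * partialDeriv j ψ x) + ∫ x in Ω, brokenLaplacian 𝒯 P x * ψ x
      = -∫ s : ℝ, (∑ j, (pval (MvPolynomial.pderiv j (P T₁)) (z + s • τ)
          - pval (MvPolynomial.pderiv j (P T₂)) (z + s • τ)) * n j) * ψ (z + s • τ) := by
  classical
  have hK : ({T₁, T₂} : Finset (Finset Plane)) ⊆ 𝒯.cells := by
    intro T hT
    simp only [Finset.mem_insert, Finset.mem_singleton] at hT
    rcases hT with rfl | rfl <;> assumption
  have hballK : Metric.ball z ρ ⊆ patch {T₁, T₂} := by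
    intro x hx
    simp only [patch, Finset.mem_insert, Finset.mem_singleton, Set.mem_iUnion, exists_prop,
      exists_eq_or_imp, exists_eq_left]
    rcases le_total 0 (inner ℝ n (x - z)) with h0 | h0
    · exact Or.inl ((hside₁ x hx).2 h0)
    · exact Or.inr ((hside₂ x hx).2 (by rw [inner_neg_left]; linarith))
  have hballΩ : Metric.ball z ρ ⊆ Ω :=
    (Metric.isOpen_ball.subset_interior_iff.2 hballK).trans (interior_patch_subset 𝒯 hK)
  have i1 : ∀ j, Integrable (fun x => grad w j x * partialDeriv j ψ x) (volume.restrict Ω) :=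
    fun j => (Lp.memLp _).integrable_mul (hψ.memLp_partialDeriv j _)
  have i2 : Integrable (fun x => brokenLaplacian 𝒯 P x * ψ x) (volume.restrict Ω) :=
    (memLp_brokenLaplacian 𝒯 P).integrable_mul (hψ.memLp _)
  have i3 : Integrable (fun x => ∑ j, grad w j x * partialDeriv j ψ x) (volume.restrict Ω) :=
    integrable_finsetSum _ fun j _ => i1 j
  have i4 : Integrable (fun x => ∑ j, grad w j x * partialDeriv j ψ x
      + brokenLaplacian 𝒯 P x * ψ x) (volume.restrict Ω) := i3.add i2
  rw [← integral_finsetSum _ fun j _ => i1 j, ← integral_add i3 i2]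
  rw [setIntegral_eq_of_inter_eq (B := Metric.ball z ρ) (isOpen_of_triangulation 𝒯).measurableSet
    (measurableSet_patch {T₁, T₂}) ?_ (fun x hx => iff_of_true (hballΩ hx) (hballK hx)),
    setIntegral_patch 𝒯 hK i4, Finset.sum_pair hne]
  · have g1 := h.green_cell hw hT₁ hside₁ hψ
    have g2 := h.neg.green_cell hw hT₂ hside₂ hψ
    rw [g1, g2]
    have hline : ∀ R : Poly2, Integrable fun s : ℝ => pval R (z + s • τ) * ψ (z + s • τ) := by
      intro R
      refine Continuous.integrable_of_hasCompactSupport ?_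
        (hasCompactSupport_comp_line hψ.compact h.norm_tangent z).mul_left
      have c1 := continuous_pval R
      have c2 := hψ.smooth.continuous
      fun_prop
    have e1 : ∀ s : ℝ, (∑ j, (pval (MvPolynomial.pderiv j (P T₁)) (z + s • τ)
          - pval (MvPolynomial.pderiv j (P T₂)) (z + s • τ)) * n j) * ψ (z + s • τ)
        = ∑ j, (n j * (pval (MvPolynomial.pderiv j (P T₁)) (z + s • τ) * ψ (z + s • τ))
          - n j * (pval (MvPolynomial.pderiv j (P T₂)) (z + s • τ) * ψ (z + s • τ))) := fun s => by
      rw [Finset.sum_mul]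
      exact Finset.sum_congr rfl fun j _ => by ring
    have i5 : ∀ j, Integrable fun s : ℝ =>
        n j * (pval (MvPolynomial.pderiv j (P T₁)) (z + s • τ) * ψ (z + s • τ))
          - n j * (pval (MvPolynomial.pderiv j (P T₂)) (z + s • τ) * ψ (z + s • τ)) := fun j =>
      ((hline _).const_mul _).sub ((hline _).const_mul _)
    simp only [e1]
    rw [integral_finsetSum _ fun j _ => i5 j,
      ← Finset.sum_neg_distrib, ← Finset.sum_neg_distrib, ← Finset.sum_neg_distrib,
      ← Finset.sum_add_distrib]
    refine Finset.sum_congr rfl fun j _ => ?_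
    rw [integral_sub ((hline _).const_mul _) ((hline _).const_mul _), integral_const_mul,
      integral_const_mul]
    simp only [PiLp.neg_apply]
    ring
  · intro x hx
    have h1 : ∀ j, partialDeriv j ψ x = 0 := fun j => (hψ.partialDeriv j).eq_zero_of_notMem hx
    simp [h1, hψ.eq_zero_of_notMem hx]

end EdgeGeometry

/-! ### Efficiency of the jump terms -/

section Jump

variable {Ω : Set Plane}

/-- A polynomial, restricted to the line `z + ℝτ` and extended constantly in the direction `n`. -/
theorem IsFrame.exists_const_normal {τ n : Plane} (h : IsFrame τ n) (z : Plane) (J : Poly2) :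
    ∃ R : Poly2, R.totalDegree ≤ J.totalDegree ∧
      ∀ s t : ℝ, pval R (z + s • τ + t • n) = pval J (z + s • τ) := by
  let ℓ : Poly2 := ∑ k, MvPolynomial.C (τ k) * (MvPolynomial.X k - MvPolynomial.C (z k))
  let g : Fin 2 → Poly2 := fun j => MvPolynomial.C (z j) + MvPolynomial.C (τ j) * ℓ
  have hℓ : ℓ.totalDegree ≤ 1 := MvPolynomial.totalDegree_finsetSum_le fun k _ => by
    refine (MvPolynomial.totalDegree_mul _ _).trans ?_
    rw [MvPolynomial.totalDegree_C, zero_add]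
    refine (MvPolynomial.totalDegree_sub _ _).trans ?_
    simp
  refine ⟨MvPolynomial.bind₁ g J, totalDegree_bind₁_le (fun i => ?_) J, fun s t => ?_⟩
  · refine (MvPolynomial.totalDegree_add _ _).trans (max_le (by simp) ?_)
    refine (MvPolynomial.totalDegree_mul _ _).trans ?_
    rw [MvPolynomial.totalDegree_C, zero_add]
    exact hℓ
  · refine pval_bind₁ J fun j => ?_
    have h1 := h.inner_tangent z (s, t)
    rw [h.coords_apply, PiLp.inner_apply] at h1
    simp only at h1
    have h2 : pval ℓ (z + s • τ + t • n) = s := by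
      refine Eq.trans ?_ h1
      simp only [ℓ, pval_sum]
      refine Finset.sum_congr rfl fun k _ => ?_
      simp [pval]
      ring
    have h3 : ∀ x, pval (g j) x = z j + τ j * pval ℓ x := fun x => by simp [g, pval]
    rw [h3, h2]
    simp [mul_comm]

/-- The polynomial `[∇u_h n]_i`, for two polynomials `P`, `R` in place of `u_h` on the two sides. -/
noncomputable def jumpPoly (n : Plane) (P R : Poly2) : Poly2 :=
  ∑ j, MvPolynomial.C (n j) * (MvPolynomial.pderiv j P - MvPolynomial.pderiv j R)

theorem pval_jumpPoly (n : Plane) (P R : Poly2) (x : Plane) :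
    pval (jumpPoly n P R) x
      = ∑ j, (pval (MvPolynomial.pderiv j P) x - pval (MvPolynomial.pderiv j R) x) * n j := by
  rw [jumpPoly, pval_sum]
  refine Finset.sum_congr rfl fun j _ => ?_
  simp [pval, mul_comm]

theorem totalDegree_jumpPoly_le {n : Plane} {P R : Poly2} {m : ℕ} (hP : P.totalDegree ≤ m)
    (hR : R.totalDegree ≤ m) : (jumpPoly n P R).totalDegree ≤ m :=
  MvPolynomial.totalDegree_finsetSum_le fun j _ => by
    refine (MvPolynomial.totalDegree_mul _ _).trans ?_
    rw [MvPolynomial.totalDegree_C, zero_add]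
    exact (MvPolynomial.totalDegree_sub _ _).trans (max_le ((totalDegree_pderiv_le j P).trans hP)
      ((totalDegree_pderiv_le j R).trans hR))

theorem hull_pair_eq_image {a b : Plane} (hab : a ≠ b) :
    (convexHull ℝ {a, b} : Set Plane)
      = (fun s : ℝ => midpoint ℝ a b + s • ((dist a b)⁻¹ • (b - a))) ''
        Set.Icc (-(dist a b / 2)) (dist a b / 2) := by
  have hd : 0 < dist a b := dist_pos.2 hab
  rw [convexHull_pair, segment_eq_image', midpoint_eq_smul_add]
  ext x
  constructor
  · rintro ⟨θ, ⟨h0, h1⟩, rfl⟩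
    refine ⟨(θ - 1 / 2) * dist a b, ⟨by nlinarith, by nlinarith⟩, ?_⟩
    simp only [smul_smul]
    rw [mul_assoc, mul_inv_cancel₀ hd.ne', mul_one, invOf_eq_inv]
    module
  · rintro ⟨s, ⟨h0, h1⟩, rfl⟩
    refine ⟨s * (dist a b)⁻¹ + 1 / 2, ⟨?_, ?_⟩, ?_⟩
    · have : -(1 / 2) ≤ s * (dist a b)⁻¹ := by
        rw [← div_eq_mul_inv, le_div_iff₀ hd]; linarith
      linarith
    · have : s * (dist a b)⁻¹ ≤ 1 / 2 := by
        rw [← div_eq_mul_inv, div_le_iff₀ hd]; linarith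
      linarith
    · simp only [smul_smul, invOf_eq_inv]
      module

/-- The arithmetic of the jump bound. In the application `A` and `S` are the squared norms of the
jump on a middle part of the edge and on the whole edge, `D` is that of its extension on a small
disc, `G`, `W₀`, `W₁` are those of the residual and of the two derivatives of the velocity error, and
`hres` is the tested residual identity. -/
theorem mul_le_of_jump_bounds {C ν h ρ S A D G W₀ W₁ : ℝ} (hC : 0 ≤ C) (hν : 0 < ν) (hρ : 0 < ρ)
    (hρh : ρ ≤ h) (hA : 0 ≤ A) (hG : 0 ≤ G) (hW₀ : 0 ≤ W₀) (hW₁ : 0 ≤ W₁)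
    (hS : h * S ≤ C * D) (hD : D ≤ ρ / 2 * A)
    (hres : ν * A ≤ √(C * D) * (√G + ν * (√W₀ + √W₁) / ρ)) :
    h * (ν ^ 2 * S) ≤ C ^ 2 * (h ^ 2 * G + ν ^ 2 * (W₀ + W₁)) := by
  set Y := √G + ν * (√W₀ + √W₁) / ρ with hY
  have hY0 : 0 ≤ Y := by positivity
  have h1 : A ≤ √(C * ρ / 2 * A) * (Y / ν) := by
    have h2 : √(C * D) ≤ √(C * ρ / 2 * A) :=
      Real.sqrt_le_sqrt (by nlinarith [mul_le_mul_of_nonneg_left hD hC])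
    have h3 := hres.trans (mul_le_mul_of_nonneg_right h2 hY0)
    rw [← mul_div_assoc, le_div_iff₀ hν]
    linarith
  have h4 := le_mul_sq_of_le_sqrt_mul (by positivity) hA h1
  have h5 : ν ^ 2 * A ≤ C * ρ / 2 * Y ^ 2 := by
    rw [div_pow, ← mul_div_assoc, le_div_iff₀ (by positivity)] at h4
    linarith
  have h6 : h * S ≤ C * ρ / 2 * A := by nlinarith [mul_le_mul_of_nonneg_left hD hC]
  have h7 : ρ * Y = ρ * √G + ν * √W₀ + ν * √W₁ := by
    rw [hY]; field_simp; ring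
  have h8 : (ρ * Y) ^ 2 ≤ 3 * (ρ ^ 2 * G + ν ^ 2 * (W₀ + W₁)) := by
    have key : ∀ x y w : ℝ, (x + y + w) ^ 2 ≤ 3 * (x ^ 2 + y ^ 2 + w ^ 2) := by
      intro x y w
      nlinarith [sq_nonneg (x - y), sq_nonneg (x - w), sq_nonneg (y - w)]
    rw [h7]
    refine (key _ _ _).trans (le_of_eq ?_)
    rw [mul_pow, mul_pow, mul_pow, Real.sq_sqrt hG, Real.sq_sqrt hW₀, Real.sq_sqrt hW₁]
    ring
  have h9 : ρ ^ 2 * G ≤ h ^ 2 * G :=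
    mul_le_mul_of_nonneg_right (pow_le_pow_left₀ hρ.le hρh 2) hG
  have hN : 0 ≤ h ^ 2 * G + ν ^ 2 * (W₀ + W₁) := by positivity
  calc h * (ν ^ 2 * S) = ν ^ 2 * (h * S) := by ring
    _ ≤ ν ^ 2 * (C * ρ / 2 * A) := mul_le_mul_of_nonneg_left h6 (sq_nonneg _)
    _ = C * ρ / 2 * (ν ^ 2 * A) := by ring
    _ ≤ C * ρ / 2 * (C * ρ / 2 * Y ^ 2) := mul_le_mul_of_nonneg_left h5 (by positivity)
    _ = C ^ 2 / 4 * (ρ * Y) ^ 2 := by ring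
    _ ≤ C ^ 2 / 4 * (3 * (h ^ 2 * G + ν ^ 2 * (W₀ + W₁))) := by
        refine mul_le_mul_of_nonneg_left (h8.trans ?_) (by positivity)
        linarith
    _ ≤ C ^ 2 * (h ^ 2 * G + ν ^ 2 * (W₀ + W₁)) := by
        have : 0 ≤ C ^ 2 * (h ^ 2 * G + ν ^ 2 * (W₀ + W₁)) := by positivity
        linarith

/-- The local quantity on a cell that bounds the jumps across its edges: the scaled residual of the
`i`-th momentum equation and the velocity error. -/
noncomputable def cellBound (𝒯 : Triangulation Ω) (ν : ℝ) (g : L2 Ω) (P : Finset Plane → Poly2)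
    (w : H1 Ω) (T : Finset Plane) : ℝ :=
  Metric.diam (hull T) ^ 2 * (∫ x in hull T, (g x + ν * brokenLaplacian 𝒯 P x) ^ 2)
    + ν ^ 2 * ∑ j, ∫ x in hull T, grad w j x ^ 2

theorem cellBound_nonneg (𝒯 : Triangulation Ω) (ν : ℝ) (g : L2 Ω) (P : Finset Plane → Poly2)
    (w : H1 Ω) (T : Finset Plane) : 0 ≤ cellBound 𝒯 ν g P w T :=
  add_nonneg (mul_nonneg (sq_nonneg _) (integral_nonneg fun _ => sq_nonneg _))
    (mul_nonneg (sq_nonneg _) (Finset.sum_nonneg fun _ _ => integral_nonneg fun _ => sq_nonneg _))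

/-- The jump bound on one edge, in geometric terms: `z` and `K ρ` are the midpoint and the length of
the edge, `ρ` is the radius of a disc in which the two cells are half-discs. The test function is
the jump, extended constantly in the normal direction and localized to that disc. -/
theorem exists_jump_halfDiscs (K : ℝ) (hK : 1 ≤ K) (m : ℕ) :
    ∃ C : ℝ, 0 < C ∧ ∀ (Ω : Set Plane) (𝒯 : Triangulation Ω) (ν : ℝ), 0 < ν →
      ∀ (f : L2v Ω) (uD u : H1v Ω) (q : H1 Ω), IsStokesSolution ν f uD u (fn q) →
      ∀ (uh : H1v Ω) (U : Fin 2 → Finset Plane → Poly2), IsPiecewiseV 𝒯 m U uh →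
      ∀ (i : Fin 2), ∀ T₁ ∈ 𝒯.cells, ∀ T₂ ∈ 𝒯.cells, T₁ ≠ T₂ →
      ∀ (τ n z : Plane) (ρ : ℝ), IsFrame τ n → 0 < ρ →
        (∀ x ∈ Metric.ball z ρ, x ∈ hull T₁ ↔ 0 ≤ inner ℝ n (x - z)) →
        (∀ x ∈ Metric.ball z ρ, x ∈ hull T₂ ↔ 0 ≤ inner ℝ (-n) (x - z)) →
        K * ρ ≤ Metric.diam (hull T₁) → K * ρ ≤ Metric.diam (hull T₂) →
        K * ρ * (ν ^ 2 * ∫ s in Set.Icc (-(K * ρ / 2)) (K * ρ / 2),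
            pval (jumpPoly n (U i T₁) (U i T₂)) (z + s • τ) ^ 2)
          ≤ C * (cellBound 𝒯 ν ((f - grad q) i) (U i) ((u - uh) i) T₁
            + cellBound 𝒯 ν ((f - grad q) i) (U i) ((u - uh) i) T₂) := by
  classical
  obtain ⟨C, hC, hbub⟩ := exists_bubble_bound m K
  refine ⟨C ^ 2, by positivity, ?_⟩
  intro Ω 𝒯 ν hν f uD u q hsol uh U hU i T₁ hT₁ T₂ hT₂ hne τ n z ρ hfr hρ hs₁ hs₂ hd₁ hd₂
  set J := jumpPoly n (U i T₁) (U i T₂) with hJ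
  have hJdeg : J.totalDegree ≤ m := totalDegree_jumpPoly_le (hU i T₁ hT₁).1 (hU i T₂ hT₂).1
  obtain ⟨R, hRdeg, hR⟩ := hfr.exists_const_normal z J
  have hR0 : ∀ s : ℝ, pval R (z + s • τ) = pval J (z + s • τ) := fun s => by
    simpa using hR s 0
  have hconst : ∀ s t : ℝ, pval R (z + s • τ + t • n) ^ 2 = pval R (z + s • τ) ^ 2 := fun s t => by
    rw [hR, hR0]
  have hRc : Continuous fun x => pval R x ^ 2 := (continuous_pval R).pow 2
  obtain ⟨hb1, hb2⟩ := hbub R (hRdeg.trans hJdeg) z ρ hρ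
  set D := ∫ x in Metric.ball z (1 / 4 * ρ), pval R x ^ 2 with hD
  set A := ∫ s in Set.Icc (-(1 / 4 * ρ)) (1 / 4 * ρ), pval R (z + s • τ) ^ 2 with hA
  set S := ∫ s in Set.Icc (-(K * ρ / 2)) (K * ρ / 2), pval J (z + s • τ) ^ 2 with hS
  set ψ := bubble z ρ R with hψdef
  have hψ : IsTest (Metric.ball z ρ) ψ := isTest_bubble hρ
  have hA0 : 0 ≤ A := integral_nonneg fun s => sq_nonneg _
  have hDA : D ≤ ρ / 2 * A := by
    have := hfr.integral_ball_le z hRc (fun x => sq_nonneg _) hconst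
      (a := 1 / 4 * ρ) (by positivity)
    linarith
  have hSD : K * ρ * S ≤ C * D := by
    refine le_trans ?_ hb1
    have := hfr.le_integral_closedBall z hRc (fun x => sq_nonneg _) hconst
      (a := K * ρ / 2) (by positivity)
    simp only [hR0] at this
    rwa [mul_div_cancel₀ _ (two_ne_zero' ℝ)] at this
  -- the patch of the two cells
  set pr : Finset (Finset Plane) := {T₁, T₂} with hpair
  have hpairT : pr ⊆ 𝒯.cells := by
    intro T hT
    simp only [hpair, Finset.mem_insert, Finset.mem_singleton] at hT
    rcases hT with rfl | rfl <;> assumption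
  have hballPair : Metric.ball z ρ ⊆ patch pr := by
    intro x hx
    simp only [patch, hpair, Finset.mem_insert, Finset.mem_singleton, Set.mem_iUnion, exists_prop,
      exists_eq_or_imp, exists_eq_left]
    rcases le_total 0 (inner ℝ n (x - z)) with h0 | h0
    · exact Or.inl ((hs₁ x hx).2 h0)
    · exact Or.inr ((hs₂ x hx).2 (by rw [inner_neg_left]; linarith))
  have hballΩ : Metric.ball z ρ ⊆ Ω :=
    (Metric.isOpen_ball.subset_interior_iff.2 hballPair).trans (interior_patch_subset 𝒯 hpairT)
  have hψΩ : IsTest Ω ψ := hψ.mono hballΩ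
  have hle := restrict_patch_le 𝒯 hpairT
  set g : L2 Ω := (f - grad q) i with hg
  have hres : MemLp (fun x => g x + ν * brokenLaplacian 𝒯 (U i) x) 2 (volume.restrict Ω) :=
    (Lp.memLp g).add ((memLp_brokenLaplacian 𝒯 (U i)).const_mul ν)
  set G := ∫ x in patch pr, (g x + ν * brokenLaplacian 𝒯 (U i) x) ^ 2 with hG
  set W : Fin 2 → ℝ := fun j => ∫ x in patch pr, grad ((u - uh) i) j x ^ 2 with hW
  have hG0 : 0 ≤ G := integral_nonneg fun x => sq_nonneg _
  have hW0 : ∀ j, 0 ≤ W j := fun j => integral_nonneg fun x => sq_nonneg _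
  -- the residual equation, the jump entering by elementwise integration by parts
  have hid : ν * ∫ s : ℝ, pval J (z + s • τ) * ψ (z + s • τ)
      = ν * (∑ j, ∫ x in Ω, grad ((u - uh) i) j x * partialDeriv j ψ x)
        - ∫ x in Ω, (g x + ν * brokenLaplacian 𝒯 (U i) x) * ψ x := by
    have h1 := hsol.residual q hψΩ i
    have h2 := hfr.green_edge (hU i) hT₁ hT₂ hne hs₁ hs₂ hψ
    simp only [← pval_jumpPoly, ← hJ] at h2
    have h3 : ∀ j, inner ℝ (grad (u i) j) (hψΩ.partialDeriv j).toL2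
        = (∫ x in Ω, grad ((u - uh) i) j x * partialDeriv j ψ x)
          + ∫ x in Ω, grad (uh i) j x * partialDeriv j ψ x := by
      intro j
      rw [← IsTest.inner_toL2 (hψΩ.partialDeriv j), ← IsTest.inner_toL2 (hψΩ.partialDeriv j),
        ← inner_add_left]
      congr 1
      change _ = (grad (u i) j - grad (uh i) j) + grad (uh i) j
      rw [sub_add_cancel]
    simp only [h3, Finset.sum_add_distrib, sub_self, inner_zero_left, sub_zero] at h1
    rw [IsTest.inner_toL2] at h1
    have i1 : Integrable (fun x => g x * ψ x) (volume.restrict Ω) :=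
      (Lp.memLp g).integrable_mul (hψ.memLp _)
    have i2 : Integrable (fun x => brokenLaplacian 𝒯 (U i) x * ψ x) (volume.restrict Ω) :=
      (memLp_brokenLaplacian 𝒯 (U i)).integrable_mul (hψ.memLp _)
    simp only [add_mul, mul_assoc]
    rw [integral_add i1 (i2.const_mul ν), integral_const_mul, h1]
    linear_combination ν * h2
  have hψ2 : ∫ x, ψ x ^ 2 ≤ C * D := by
    refine (integral_bubble_sq_le hρ).trans (le_trans ?_ hb1)
    refine setIntegral_mono_set (hRc.continuousOn.integrableOn_compact (isCompact_closedBall _ _))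
      (Eventually.of_forall fun x => sq_nonneg _) (LE.le.eventuallyLE ?_)
    refine Metric.ball_subset_closedBall.trans (Metric.closedBall_subset_closedBall ?_)
    nlinarith
  have hAψ : A ≤ ∫ s : ℝ, pval J (z + s • τ) * ψ (z + s • τ) := by
    have hc : Continuous fun s : ℝ => pval J (z + s • τ) * ψ (z + s • τ) := by
      have c1 := continuous_pval J
      have c2 := hψ.smooth.continuous
      fun_prop
    have hnn : ∀ s : ℝ, 0 ≤ pval J (z + s • τ) * ψ (z + s • τ) := fun s => by
      have h0 := bump.nonneg (x := ρ⁻¹ • (z + s • τ - z))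
      have : pval J (z + s • τ) * ψ (z + s • τ)
          = bump (ρ⁻¹ • (z + s • τ - z)) * pval J (z + s • τ) ^ 2 := by
        rw [hψdef, bubble, hR0]; ring
      rw [this]
      positivity
    have h1 : A = ∫ s in Set.Icc (-(1 / 4 * ρ)) (1 / 4 * ρ),
        pval J (z + s • τ) * ψ (z + s • τ) := by
      refine setIntegral_congr_fun measurableSet_Icc fun s hs => ?_
      have h2 : bump (ρ⁻¹ • (z + s • τ - z)) = 1 := bump.one_of_mem_closedBall
        ((rescale_mem_closedBall hρ _).2 (by
          rw [mem_closedBall_iff_norm, add_sub_cancel_left, norm_smul, hfr.norm_tangent, mul_one]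
          exact abs_le.2 hs))
      simp only [hψdef, bubble, h2, hR0]
      ring
    rw [h1]
    exact setIntegral_le_integral (hc.integrable_of_hasCompactSupport
      (hasCompactSupport_comp_line hψ.compact hfr.norm_tangent z).mul_left)
      (Eventually.of_forall hnn)
  have hbound : ν * A ≤ √(C * D) * (√G + ν * (√(W 0) + √(W 1)) / ρ) := by
    have h1 : ∀ j, ∫ x in Ω, grad ((u - uh) i) j x * partialDeriv j ψ x
        ≤ √(W j) * (√(C * D) / ρ) := fun j =>
      (le_abs_self _).trans (((hψ.partialDeriv j).abs_setIntegral_mul_le hballΩ hballPair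
        ((Lp.memLp _).mono_measure hle)).trans
        (mul_le_mul_of_nonneg_left (sqrt_integral_partialDeriv_le hρ j (hb2 j))
          (Real.sqrt_nonneg _)))
    have h2 : -∫ x in Ω, (g x + ν * brokenLaplacian 𝒯 (U i) x) * ψ x ≤ √G * √(C * D) :=
      (neg_le_abs _).trans ((hψ.abs_setIntegral_mul_le hballΩ hballPair
        (hres.mono_measure hle)).trans
        (mul_le_mul_of_nonneg_left (Real.sqrt_le_sqrt hψ2) (Real.sqrt_nonneg _)))
    have h3 : ν * (∑ j, ∫ x in Ω, grad ((u - uh) i) j x * partialDeriv j ψ x)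
        ≤ ν * ∑ j, √(W j) * (√(C * D) / ρ) :=
      mul_le_mul_of_nonneg_left (Finset.sum_le_sum fun j _ => h1 j) hν.le
    have h4 := mul_le_mul_of_nonneg_left hAψ hν.le
    rw [hid] at h4
    rw [Fin.sum_univ_two (fun j => √(W j) * (√(C * D) / ρ))] at h3
    calc ν * A ≤ ν * (√(W 0) * (√(C * D) / ρ) + √(W 1) * (√(C * D) / ρ)) + √G * √(C * D) := by
          linarith
      _ = _ := by ring
  have hKρ : ρ ≤ K * ρ := by nlinarith
  refine (mul_le_of_jump_bounds hC.le hν hρ hKρ hA0 hG0 (hW0 0) (hW0 1) hSD hDA hbound).trans ?_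
  refine mul_le_mul_of_nonneg_left ?_ (by positivity)
  have hGsum : G = (∫ x in hull T₁, (g x + ν * brokenLaplacian 𝒯 (U i) x) ^ 2)
      + ∫ x in hull T₂, (g x + ν * brokenLaplacian 𝒯 (U i) x) ^ 2 := by
    rw [hG, setIntegral_patch 𝒯 hpairT hres.integrable_sq, hpair, Finset.sum_pair hne]
  have hWsum : ∀ j, W j = (∫ x in hull T₁, grad ((u - uh) i) j x ^ 2)
      + ∫ x in hull T₂, grad ((u - uh) i) j x ^ 2 := fun j => by
    simp only [hW]
    rw [setIntegral_patch 𝒯 hpairT (integrable_sq _), hpair, Finset.sum_pair hne]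
  have hKρ0 : 0 ≤ K * ρ := hρ.le.trans hKρ
  rw [hGsum, hWsum, hWsum, cellBound, cellBound, Fin.sum_univ_two, Fin.sum_univ_two]
  have k1 := mul_le_mul_of_nonneg_right (pow_le_pow_left₀ hKρ0 hd₁ 2)
    (integral_nonneg (μ := volume.restrict (hull T₁))
      (f := fun x => (g x + ν * brokenLaplacian 𝒯 (U i) x) ^ 2) fun x => sq_nonneg _)
  have k2 := mul_le_mul_of_nonneg_right (pow_le_pow_left₀ hKρ0 hd₂ 2)
    (integral_nonneg (μ := volume.restrict (hull T₂))
      (f := fun x => (g x + ν * brokenLaplacian 𝒯 (U i) x) ^ 2) fun x => sq_nonneg _)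
  linarith

theorem exists_pair_of_mem_innerEdges {𝒯 : Triangulation Ω} {e : Finset Plane}
    (he : e ∈ innerEdges 𝒯) : ∃ a b, a ≠ b ∧ e = {a, b} := by
  classical
  simp only [innerEdges, Finset.mem_filter, Finset.mem_biUnion, Finset.mem_powersetCard] at he
  obtain ⟨⟨T, -, -, hcard⟩, -⟩ := he
  obtain ⟨a, b, hab, h⟩ := Finset.card_eq_two.1 hcard
  exact ⟨a, b, hab, by convert h⟩

/-- Efficiency of the jump across a single edge. -/
theorem exists_jump_local (κ : ℝ) (m : ℕ) :
    ∃ C : ℝ, 0 < C ∧ ∀ (Ω : Set Plane) (𝒯 : Triangulation Ω), ShapeRegular 𝒯 κ →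
      ∀ (ν : ℝ), 0 < ν →
      ∀ (f : L2v Ω) (uD u : H1v Ω) (q : H1 Ω), IsStokesSolution ν f uD u (fn q) →
      ∀ (uh : H1v Ω) (U : Fin 2 → Finset Plane → Poly2), IsPiecewiseV 𝒯 m U uh →
      ∀ (o : EdgeOrientation 𝒯) (i : Fin 2), ∀ e ∈ innerEdges 𝒯,
        Metric.diam (hull e) *
            (∫ x in hull e, (ν * normalJump o U e i x) ^ 2 ∂(Measure.hausdorffMeasure 1))
          ≤ C * (cellBound 𝒯 ν ((f - grad q) i) (U i) ((u - uh) i) (o.plus e)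
            + cellBound 𝒯 ν ((f - grad q) i) (U i) ((u - uh) i) (o.minus e)) := by
  classical
  -- with `ρ = h_e / K`, the inscribed discs of the two cells have radius at least `ρ`
  set K := max κ 1 with hK
  have hK1 : 1 ≤ K := le_max_right _ _
  have hK0 : 0 < K := zero_lt_one.trans_le hK1
  obtain ⟨C, hC, hmain⟩ := exists_jump_halfDiscs K hK1 m
  refine ⟨C, hC, ?_⟩
  intro Ω 𝒯 hreg ν hν f uD u q hsol uh U hU o i e he
  obtain ⟨a, b, hab, rfl⟩ := exists_pair_of_mem_innerEdges he
  set e : Finset Plane := {a, b} with hedef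
  have hae : a ∈ e := by simp [hedef]
  have hbe : b ∈ e := by simp [hedef]
  obtain ⟨hp, hep⟩ := o.plus_mem e he
  obtain ⟨hm, hem⟩ := o.minus_mem e he
  have hd : 0 < dist a b := dist_pos.2 hab
  set ρ := dist a b / K with hρdef
  have hρ : 0 < ρ := div_pos hd hK0
  have hKρ : K * ρ = dist a b := mul_div_cancel₀ _ hK0.ne'
  have hdiam : ∀ T, e ⊆ T → dist a b ≤ Metric.diam (hull T) := fun T hT =>
    dist_le_diam_hull (subset_hull (hT hae)) (subset_hull (hT hbe))
  have hdisc : ∀ T ∈ 𝒯.cells, e ⊆ T → ∃ c r, ρ ≤ r ∧ Metric.closedBall c r ⊆ hull T := by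
    intro T hT heT
    obtain ⟨c, r, hr, hball, hdi⟩ := hreg T hT
    refine ⟨c, r, ?_, hball⟩
    rw [hρdef, div_le_iff₀ hK0, mul_comm]
    exact (hdiam T heT).trans (hdi.trans (mul_le_mul_of_nonneg_right (le_max_left _ _) hr.le))
  set τ := (dist a b)⁻¹ • (b - a) with hτ
  have hperp := o.normal_perp e he a hae b hbe
  have hfr : IsFrame τ (o.normal e) := by
    refine ⟨?_, o.norm_normal e he, ?_⟩
    · rw [hτ, norm_smul, norm_inv, Real.norm_of_nonneg hd.le, dist_comm, dist_eq_norm,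
        inv_mul_cancel₀]
      exact norm_ne_zero_iff.2 (sub_ne_zero.2 hab.symm)
    · rw [hτ, real_inner_smul_left, real_inner_comm, ← neg_sub, inner_neg_right, hperp]
      simp
  obtain ⟨σ, hσ, hsides⟩ := exists_sides 𝒯 hp hm (o.plus_ne_minus e he) hab (hep hae) (hep hbe)
    (hem hae) (hem hbe) hρ (hdisc _ hp hep) (hdisc _ hm hem) (o.norm_normal e he) hperp
  have hfrσ : IsFrame τ (σ • o.normal e) := by
    rcases hσ with rfl | rfl
    · rwa [one_smul]
    · rw [neg_one_smul]; exact hfr.neg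
  have hfin := hmain Ω 𝒯 ν hν f uD u q hsol uh U hU i _ hp _ hm (o.plus_ne_minus e he) τ _
    (midpoint ℝ a b) ρ hfrσ hρ (fun x hx => (hsides x hx).1) (fun x hx => (hsides x hx).2)
    (hKρ.le.trans (hdiam _ hep)) (hKρ.le.trans (hdiam _ hem))
  refine le_of_eq_of_le ?_ hfin
  have hcoe : hull e = convexHull ℝ {a, b} := by simp [hull, hedef]
  have hdi : Metric.diam (hull e) = dist a b := by
    rw [hcoe, convexHull_diam, Metric.diam_pair]
  have hjump : ∀ x, normalJump o U e i x
      = pval (jumpPoly (o.normal e) (U i (o.plus e)) (U i (o.minus e))) x := fun x =>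
    (pval_jumpPoly _ _ _ x).symm
  have hjσ : ∀ x, pval (jumpPoly (σ • o.normal e) (U i (o.plus e)) (U i (o.minus e))) x ^ 2
      = pval (jumpPoly (o.normal e) (U i (o.plus e)) (U i (o.minus e))) x ^ 2 := fun x => by
    have : pval (jumpPoly (σ • o.normal e) (U i (o.plus e)) (U i (o.minus e))) x
        = σ * pval (jumpPoly (o.normal e) (U i (o.plus e)) (U i (o.minus e))) x := by
      rw [pval_jumpPoly, pval_jumpPoly, Finset.mul_sum]
      refine Finset.sum_congr rfl fun j _ => ?_
      simp only [PiLp.smul_apply, smul_eq_mul]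
      ring
    rw [this, mul_pow]
    rcases hσ with rfl | rfl <;> simp
  rw [hdi, hKρ, hcoe, hull_pair_eq_image hab]
  simp only [hjump, hjσ, mul_pow]
  have hF : Continuous fun x =>
      pval (jumpPoly (o.normal e) (U i (o.plus e)) (U i (o.minus e))) x ^ 2 :=
    (continuous_pval _).pow 2
  rw [integral_const_mul, integral_image_line hfr.norm_tangent _ hF isCompact_Icc]

end Jump

section JumpSum

variable {Ω : Set Plane}

/-- Each cell has three edges, so it is the `plus` or `minus` cell of at most three inner edges. -/
theorem EdgeOrientation.sum_innerEdges_le {𝒯 : Triangulation Ω} (o : EdgeOrientation 𝒯)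
    {G : Finset Plane → ℝ} (hG : ∀ T, 0 ≤ G T) :
    ∑ e ∈ innerEdges 𝒯, (G (o.plus e) + G (o.minus e)) ≤ 3 * ∑ T ∈ 𝒯.cells, G T := by
  classical
  calc ∑ e ∈ innerEdges 𝒯, (G (o.plus e) + G (o.minus e))
      ≤ ∑ e ∈ innerEdges 𝒯, ∑ T ∈ 𝒯.cells, if e ⊆ T then G T else 0 := by
        refine Finset.sum_le_sum fun e he => ?_
        rw [← Finset.sum_pair (o.plus_ne_minus e he), ← Finset.sum_filter]
        refine Finset.sum_le_sum_of_subset_of_nonneg ?_ fun T _ _ => hG T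
        intro T hT
        rw [Finset.mem_filter]
        rcases Finset.mem_insert.1 hT with rfl | hT
        · exact o.plus_mem e he
        · rw [Finset.mem_singleton.1 hT]
          exact o.minus_mem e he
    _ = ∑ T ∈ 𝒯.cells, ((innerEdges 𝒯).filter (· ⊆ T)).card * G T := by
        rw [Finset.sum_comm]
        refine Finset.sum_congr rfl fun T _ => ?_
        rw [← Finset.sum_filter, Finset.sum_const, nsmul_eq_mul]
    _ ≤ ∑ T ∈ 𝒯.cells, 3 * G T := by
        refine Finset.sum_le_sum fun T hT => mul_le_mul_of_nonneg_right ?_ (hG T)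
        have hsub : (innerEdges 𝒯).filter (· ⊆ T) ⊆ T.powersetCard 2 := by
          intro e he
          obtain ⟨he, heT⟩ := Finset.mem_filter.1 he
          obtain ⟨a, b, hab, rfl⟩ := exists_pair_of_mem_innerEdges he
          exact Finset.mem_powersetCard.2 ⟨heT, Finset.card_pair hab⟩
        have := Finset.card_le_card hsub
        rw [Finset.card_powersetCard, 𝒯.card_eq T hT] at this
        exact_mod_cast this
    _ = _ := by rw [Finset.mul_sum]

theorem etaJump_sq {𝒯 : Triangulation Ω} (o : EdgeOrientation 𝒯) (ν : ℝ)
    (U : Fin 2 → Finset Plane → Poly2) : etaJump o ν U ^ 2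
      = ∑ e ∈ innerEdges 𝒯, Metric.diam (hull e) *
        ∑ i, ∫ x in hull e, (ν * normalJump o U e i x) ^ 2 ∂(Measure.hausdorffMeasure 1) :=
  Real.sq_sqrt (Finset.sum_nonneg fun _ _ => mul_nonneg Metric.diam_nonneg
    (Finset.sum_nonneg fun _ _ => integral_nonneg fun _ => sq_nonneg _))

theorem sum_cellBound (𝒯 : Triangulation Ω) (ν : ℝ) (g : L2v Ω)
    (U : Fin 2 → Finset Plane → Poly2) (w : H1v Ω) :
    ∑ T ∈ 𝒯.cells, ∑ i, cellBound 𝒯 ν (g i) (U i) (w i) T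
      = etaVol 𝒯 ν g U ^ 2 + ν ^ 2 * gradNorm w ^ 2 := by
  rw [etaVol_sq, ← sum_cells_gradNorm 𝒯, Finset.mul_sum, ← Finset.sum_add_distrib]
  refine Finset.sum_congr rfl fun T _ => ?_
  simp only [cellBound, Finset.sum_add_distrib, Finset.mul_sum]

/-- Efficiency of the jump contribution of the estimator. -/
theorem exists_jump_bound (κ : ℝ) (m k : ℕ) :
    ∃ C : ℝ, 0 < C ∧ ∀ (Ω : Set Plane) (𝒯 : Triangulation Ω), ShapeRegular 𝒯 κ →
      ∀ ν : ℝ, 0 < ν → ∀ (f : L2v Ω) (uD u : H1v Ω) (q : H1 Ω),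
        IsStokesSolution ν f uD u (fn q) →
      ∀ (uh : H1v Ω) (U : Fin 2 → Finset Plane → Poly2), IsPiecewiseV 𝒯 m U uh →
      ∀ o : EdgeOrientation 𝒯,
        etaJump o ν U ≤ C * (ν * gradNorm (u - uh) + osc 𝒯 k (f - grad q)) := by
  obtain ⟨C, hC, hvol⟩ := exists_volume_bound κ m k
  obtain ⟨D, hD, hloc⟩ := exists_jump_local κ m
  refine ⟨√(3 * D) * (C + 1), by positivity, ?_⟩
  intro Ω 𝒯 hreg ν hν f uD u q hsol uh U hU o
  have hv := hvol Ω 𝒯 hreg ν hν f uD u (fn q) hsol uh U hU q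
  rw [sub_self, norm_zero, zero_add] at hv
  have hg := gradNorm_nonneg (u - uh)
  have ho := osc_nonneg 𝒯 k (f - grad q)
  have he : 0 ≤ etaVol 𝒯 ν (f - grad q) U := Real.sqrt_nonneg _
  have h1 : etaJump o ν U ^ 2
      ≤ 3 * D * (etaVol 𝒯 ν (f - grad q) U ^ 2 + ν ^ 2 * gradNorm (u - uh) ^ 2) := by
    set G : Finset Plane → ℝ :=
      fun T => ∑ i, cellBound 𝒯 ν ((f - grad q) i) (U i) ((u - uh) i) T with hG
    have hG0 : ∀ T, 0 ≤ G T := fun T => Finset.sum_nonneg fun i _ => cellBound_nonneg _ _ _ _ _ _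
    rw [← sum_cellBound 𝒯, etaJump_sq]
    calc _ ≤ ∑ e ∈ innerEdges 𝒯, D * (G (o.plus e) + G (o.minus e)) := by
          refine Finset.sum_le_sum fun e he => ?_
          rw [Finset.mul_sum, hG, ← Finset.sum_add_distrib, Finset.mul_sum]
          exact Finset.sum_le_sum fun i _ => hloc Ω 𝒯 hreg ν hν f uD u q hsol uh U hU o i e he
      _ ≤ D * (3 * ∑ T ∈ 𝒯.cells, G T) := by
          rw [← Finset.mul_sum]
          exact mul_le_mul_of_nonneg_left (o.sum_innerEdges_le hG0) hD.le
      _ = _ := by ring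
  have hνg : 0 ≤ ν * gradNorm (u - uh) := by positivity
  refine (sq_le_sq₀ (Real.sqrt_nonneg _) (by positivity)).1 (h1.trans ?_)
  rw [mul_assoc √(3 * D), mul_pow, Real.sq_sqrt (by positivity)]
  refine mul_le_mul_of_nonneg_left ?_ (by positivity)
  have h2 : etaVol 𝒯 ν (f - grad q) U + ν * gradNorm (u - uh)
      ≤ (C + 1) * (ν * gradNorm (u - uh) + osc 𝒯 k (f - grad q)) := by linarith
  have h3 := pow_le_pow_left₀ (by positivity) h2 2
  nlinarith [mul_nonneg he hνg]

end JumpSum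

/-! ### Consistency terms -/

section Consistency

variable {Ω : Set Plane} {𝒯 : Triangulation Ω} {m : ℕ}

theorem FEPair.dualNorm_le {X : FEPair 𝒯 m} {ℓ : X.V → ℝ} {B : ℝ} (hB : 0 ≤ B)
    (h : ∀ v ∈ X.V0, ℓ v ≤ B * gradNorm v.1) : X.dualNorm ℓ ≤ ENNReal.ofReal B :=
  iSup₂_le fun v hv => ENNReal.ofReal_le_ofReal
    (div_le_of_le_mul₀ (gradNorm_nonneg _) hB (h v hv.1))

theorem FEPair.dualNorm_eq_zero {X : FEPair 𝒯 m} {ℓ : X.V → ℝ} (h : ∀ v ∈ X.V0, ℓ v = 0) :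
    X.dualNorm ℓ = 0 := by
  have := X.dualNorm_le (ℓ := ℓ) le_rfl fun v hv => by rw [h v hv, zero_mul]
  simpa using this

theorem IsPatchFamily.sum_sum_le {M : ℕ} {𝒦 : Finset (Finset (Finset Plane))}
    (h : IsPatchFamily 𝒯 M 𝒦) {F : Finset Plane → ℝ} (hF : ∀ T, 0 ≤ F T) :
    ∑ K ∈ 𝒦, ∑ T ∈ K, F T ≤ M * ∑ T ∈ 𝒯.cells, F T := by
  classical
  have h1 : ∑ K ∈ 𝒦, ∑ T ∈ K, F T = ∑ T ∈ 𝒯.cells, ∑ K ∈ 𝒦.filter (T ∈ ·), F T := by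
    refine Finset.sum_comm' fun K T => ?_
    simp only [Finset.mem_filter]
    exact ⟨fun ⟨hK, hT⟩ => ⟨⟨hK, hT⟩, h.subset K hK hT⟩, fun ⟨hK, _⟩ => hK⟩
  rw [h1, Finset.mul_sum]
  refine Finset.sum_le_sum fun T hT => ?_
  rw [Finset.sum_const, nsmul_eq_mul]
  refine mul_le_mul_of_nonneg_right ?_ (hF T)
  have := h.overlap T hT
  rw [← Finset.coe_filter, Set.ncard_coe_finset] at this
  exact_mod_cast this

theorem inner_eq_setIntegral_patch {K : Finset (Finset Plane)} (hK : K ⊆ 𝒯.cells) (a : L2 Ω)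
    {s : L2 Ω} (hs : ∀ᵐ x ∂(volume.restrict Ω), x ∉ patch K → s x = 0) :
    inner ℝ a s = ∫ x in patch K, a x * s x := by
  rw [inner_eq_integral, restrict_patch]
  have hΩ := (isOpen_of_triangulation 𝒯).measurableSet
  refine setIntegral_eq_of_subset_of_ae_sdiff_eq_zero hΩ.nullMeasurableSet
    (Set.iUnion₂_subset fun T hT => interior_hull_subset 𝒯 (hK hT)) ?_
  rw [ae_restrict_iff' hΩ] at hs
  filter_upwards [hs, (patch_ae_eq K).mem_iff] with x h1 h2 h3
  rw [h1 h3.1 fun h => h3.2 (h2.2 h), mul_zero]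

theorem setIntegral_patch_sq_le {K : Finset (Finset Plane)} (hK : K ⊆ 𝒯.cells) (s : L2 Ω) :
    ∫ x in patch K, s x ^ 2 ≤ ‖s‖ ^ 2 := by
  rw [norm_sq_eq_integral]
  exact integral_mono_measure (restrict_patch_le 𝒯 hK) (Eventually.of_forall fun x => sq_nonneg _)
    (integrable_sq s)

theorem abs_setIntegral_patch_mul_le {K : Finset (Finset Plane)} (hK : K ⊆ 𝒯.cells)
    {a : Plane → ℝ} (ha : MemLp a 2 (volume.restrict (patch K))) (s : L2 Ω) :
    |∫ x in patch K, a x * s x| ≤ √(∫ x in patch K, a x ^ 2) * ‖s‖ := by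
  refine (abs_integral_mul_le ha ((Lp.memLp s).mono_measure (restrict_patch_le 𝒯 hK))).trans ?_
  refine mul_le_mul_of_nonneg_left ?_ (Real.sqrt_nonneg _)
  rw [← Real.sqrt_sq (norm_nonneg s)]
  exact Real.sqrt_le_sqrt (setIntegral_patch_sq_le hK s)

/-- A function orthogonal to polynomials sees another one only up to its best approximation
error. -/
theorem abs_setIntegral_patch_mul_le_bestApprox {K : Finset (Finset Plane)} (hK : K ⊆ 𝒯.cells)
    {k : ℕ} (g s : L2 Ω)
    (hs : ∀ P : Poly2, P.totalDegree ≤ k → ∫ x in patch K, s x * pval P x = 0) :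
    |∫ x in patch K, g x * s x| ≤ √(bestApproxErrorSq k (patch K) g) * ‖s‖ := by
  have hle := restrict_patch_le 𝒯 hK
  have hsq : (∫ x in patch K, g x * s x) ^ 2 ≤ 0 + ‖s‖ ^ 2 * bestApproxErrorSq k (patch K) g := by
    refine le_add_mul_bestApproxErrorSq (sq_nonneg _) fun P hP => ?_
    have hPm : MemLp (pval P) 2 (volume.restrict (patch K)) :=
      memLp_of_continuous (continuous_pval P) (isCompact_patch K)
    have hg := (Lp.memLp g).mono_measure hle
    have hsm := (Lp.memLp s).mono_measure hle
    have i1 : Integrable (fun x => g x * s x) (volume.restrict (patch K)) := hg.integrable_mul hsm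
    have i2 : Integrable (fun x => s x * pval P x) (volume.restrict (patch K)) :=
      hsm.integrable_mul hPm
    have e : ∫ x in patch K, g x * s x = ∫ x in patch K, (g x - pval P x) * s x := by
      rw [← sub_zero (∫ x in patch K, g x * s x), ← hs P hP, ← integral_sub i1 i2]
      exact integral_congr_ae (Eventually.of_forall fun x => by simp only; ring)
    have h1 := pow_le_pow_left₀ (abs_nonneg _)
      (abs_setIntegral_patch_mul_le hK (a := fun x => g x - pval P x) (hg.sub hPm) s) 2
    rw [sq_abs, mul_pow, Real.sq_sqrt (integral_nonneg fun x => sq_nonneg _)] at h1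
    rw [e]
    linarith
  rw [zero_add] at hsq
  have := Real.sqrt_le_sqrt hsq
  rwa [Real.sqrt_sq_eq_abs, Real.sqrt_mul (sq_nonneg _), Real.sqrt_sq (norm_nonneg _),
    mul_comm] at this

theorem gradNormOn_sq (K : Set Plane) (w : H1v Ω) :
    gradNormOn K w ^ 2 = ∑ i, ∑ j, ∫ x in K, grad (w i) j x ^ 2 :=
  Real.sq_sqrt (Finset.sum_nonneg fun _ _ => Finset.sum_nonneg fun _ _ =>
    integral_nonneg fun _ => sq_nonneg _)

theorem IsPatchFamily.sum_gradNormOn_sq_le {M : ℕ} {𝒦 : Finset (Finset (Finset Plane))}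
    (h : IsPatchFamily 𝒯 M 𝒦) (w : H1v Ω) :
    ∑ K ∈ 𝒦, gradNormOn (patch K) w ^ 2 ≤ M * gradNorm w ^ 2 := by
  rw [← sum_cells_gradNorm 𝒯]
  refine le_of_eq_of_le (Finset.sum_congr rfl fun K hK => ?_) (h.sum_sum_le fun T =>
    Finset.sum_nonneg fun _ _ => Finset.sum_nonneg fun _ _ => integral_nonneg fun _ => sq_nonneg _)
  rw [gradNormOn_sq]
  refine (Finset.sum_comm.trans (Finset.sum_congr rfl fun i _ => ?_)).symm
  refine Finset.sum_comm.trans (Finset.sum_congr rfl fun j _ => ?_)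
  exact (setIntegral_patch 𝒯 (h.subset K hK) (integrable_sq _)).symm

theorem memLp_residual (𝒯 : Triangulation Ω) (ν : ℝ) (g : L2 Ω) (P : Finset Plane → Poly2) :
    MemLp (fun x => g x + ν * brokenLaplacian 𝒯 P x) 2 (volume.restrict Ω) :=
  (Lp.memLp g).add ((memLp_brokenLaplacian 𝒯 P).const_mul ν)

theorem IsPatchFamily.sum_residual_sq_le {M : ℕ} {𝒦 : Finset (Finset (Finset Plane))}
    (h : IsPatchFamily 𝒯 M 𝒦) (ν : ℝ) (g : L2v Ω) (U : Fin 2 → Finset Plane → Poly2) :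
    ∑ K ∈ 𝒦, Metric.diam (patch K) ^ 2 *
        ∑ i, ∫ x in patch K, (g i x + ν * brokenLaplacian 𝒯 (U i) x) ^ 2
      ≤ (M : ℝ) ^ 3 * etaVol 𝒯 ν g U ^ 2 := by
  set F : Finset Plane → ℝ :=
    fun T => ∑ i, ∫ x in hull T, (g i x + ν * brokenLaplacian 𝒯 (U i) x) ^ 2 with hF
  have hF0 : ∀ T, 0 ≤ F T := fun T =>
    Finset.sum_nonneg fun _ _ => integral_nonneg fun _ => sq_nonneg _
  rw [etaVol_sq]
  calc _ = ∑ K ∈ 𝒦, ∑ T ∈ K, Metric.diam (patch K) ^ 2 * F T := by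
        refine Finset.sum_congr rfl fun K hK => ?_
        rw [← Finset.mul_sum, hF, Finset.sum_comm]
        congr 1
        exact Finset.sum_congr rfl fun i _ =>
          setIntegral_patch 𝒯 (h.subset K hK) (memLp_residual 𝒯 ν (g i) (U i)).integrable_sq
    _ ≤ ∑ K ∈ 𝒦, ∑ T ∈ K, (M : ℝ) ^ 2 * (Metric.diam (hull T) ^ 2 * F T) := by
        refine Finset.sum_le_sum fun K hK => Finset.sum_le_sum fun T hT => ?_
        rw [← mul_assoc, ← mul_pow]
        exact mul_le_mul_of_nonneg_right
          (pow_le_pow_left₀ Metric.diam_nonneg (h.size K hK T hT) 2) (hF0 T)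
    _ ≤ M * ∑ T ∈ 𝒯.cells, (M : ℝ) ^ 2 * (Metric.diam (hull T) ^ 2 * F T) :=
        h.sum_sum_le fun T => mul_nonneg (sq_nonneg _) (mul_nonneg (sq_nonneg _) (hF0 T))
    _ = _ := by rw [← Finset.mul_sum]; ring

/-- On a patch, the residual `g + ν Δ_𝒯 u_h` and the oscillation of `g` bound the action of
`ν Δ_𝒯 u_h` on a field that is orthogonal to polynomials. -/
theorem patch_laplacian_le {K : Finset (Finset Plane)} (hK : K ⊆ 𝒯.cells) (k : ℕ) (ν : ℝ)
    (g s L : L2v Ω) (hs : ∀ i, ∀ᵐ x ∂(volume.restrict Ω), x ∉ patch K → s i x = 0)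
    (horth : ∀ P : Fin 2 → Poly2, (∀ i, (P i).totalDegree ≤ k) →
      ∑ i, ∫ x in patch K, s i x * pval (P i) x = 0) :
    ν * ∑ i, inner ℝ (L i) (s i)
      ≤ (√(∑ i, ∫ x in patch K, (g i + ν • L i : L2 Ω) x ^ 2)
        + √(∑ i, bestApproxErrorSq k (patch K) (g i))) * vecNorm s := by
  classical
  have horth' : ∀ i, ∀ P : Poly2, P.totalDegree ≤ k → ∫ x in patch K, s i x * pval P x = 0 := by
    intro i P hP
    have := horth (Pi.single i P) fun j => by
      rcases eq_or_ne j i with rfl | hj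
      · simpa using hP
      · simp [hj]
    rwa [Finset.sum_eq_single_of_mem i (Finset.mem_univ i), Pi.single_eq_same] at this
    intro j _ hj
    simp [hj, pval]
  have h1 : ∀ i, ν * inner ℝ (L i) (s i)
      ≤ √(∫ x in patch K, (g i + ν • L i : L2 Ω) x ^ 2) * √(‖s i‖ ^ 2)
        + √(bestApproxErrorSq k (patch K) (g i)) * √(‖s i‖ ^ 2) := by
    intro i
    have e : ν * inner ℝ (L i) (s i) = inner ℝ (g i + ν • L i) (s i) - inner ℝ (g i) (s i) := by
      rw [inner_add_left, real_inner_smul_left]; ring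
    rw [e, inner_eq_setIntegral_patch hK _ (hs i), inner_eq_setIntegral_patch hK _ (hs i),
      Real.sqrt_sq (norm_nonneg _)]
    have h2 := (le_abs_self _).trans (abs_setIntegral_patch_mul_le hK
      ((Lp.memLp (g i + ν • L i)).mono_measure (restrict_patch_le 𝒯 hK)) (s i))
    have h3 := (neg_le_abs _).trans
      (abs_setIntegral_patch_mul_le_bestApprox hK (g i) (s i) (horth' i))
    linarith
  rw [Finset.mul_sum, add_mul, vecNorm]
  refine (Finset.sum_le_sum fun i _ => h1 i).trans ?_
  rw [Finset.sum_add_distrib]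
  exact add_le_add
    (Real.sum_sqrt_mul_sqrt_le _ (fun i => integral_nonneg fun _ => sq_nonneg _)
      fun i => sq_nonneg _)
    (Real.sum_sqrt_mul_sqrt_le _ (fun i => bestApproxErrorSq_nonneg _ _ _) fun i => sq_nonneg _)

set_option maxHeartbeats 600000 in
/-- The first consistency functional is bounded by the volume residual and the oscillation on the
patches. -/
theorem LocallyOrthogonal.laplacian_le {X : FEPair 𝒯 m} {R : X.V →ₗ[ℝ] Hdiv Ω}
    {𝒦 : Finset (Finset (Finset Plane))} {r M : ℕ} {c : ℝ} (h : LocallyOrthogonal X R 𝒦 r c)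
    (h𝒦 : IsPatchFamily 𝒯 M 𝒦) (ν : ℝ) (g : L2v Ω) (U : Fin 2 → Finset Plane → Poly2)
    {v : X.V} (hv : v ∈ X.V0) :
    ν * ∑ i, ∫ x in Ω, brokenLaplacian 𝒯 (U i) x * (vfn v.1 i x - hfn (R v) i x)
      ≤ |c| * √M * (√((M : ℝ) ^ 3) * etaVol 𝒯 ν g U + oscPatch 𝒦 (r - 1) g) * gradNorm v.1 := by
  obtain ⟨σ, hsum, hσ⟩ := h v hv
  set L : L2v Ω := fun i => (memLp_brokenLaplacian 𝒯 (U i)).toLp _ with hL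
  have hLae : ∀ i, L i =ᵐ[volume.restrict Ω] brokenLaplacian 𝒯 (U i) := fun i => MemLp.coeFn_toLp _
  have e1 : ∀ i, ∫ x in Ω, brokenLaplacian 𝒯 (U i) x * (vfn v.1 i x - hfn (R v) i x)
      = ∑ K ∈ 𝒦, inner ℝ (L i) (σ K i) := by
    intro i
    have h1 : vfn v.1 i - hfn (R v) i = ∑ K ∈ 𝒦, σ K i := by
      rw [← Pi.sub_apply, hsum, Finset.sum_apply]
    rw [← inner_sum, ← h1, inner_eq_integral]
    refine integral_congr_ae ?_
    filter_upwards [hLae i, Lp.coeFn_sub (vfn v.1 i) (hfn (R v) i)] with x h2 h3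
    rw [h2, h3, Pi.sub_apply]
  have e2 : ∀ K ∈ 𝒦, ∀ i, ∫ x in patch K, (g i + ν • L i : L2 Ω) x ^ 2
      = ∫ x in patch K, (g i x + ν * brokenLaplacian 𝒯 (U i) x) ^ 2 := by
    intro K hK i
    refine integral_congr_ae (ae_mono (restrict_patch_le 𝒯 (h𝒦.subset K hK)) ?_)
    filter_upwards [hLae i, Lp.coeFn_add (g i) (ν • L i), Lp.coeFn_smul ν (L i)] with x h2 h3 h4
    rw [h3, Pi.add_apply, h4, Pi.smul_apply, h2, smul_eq_mul]
  set a : Finset (Finset Plane) → ℝ := fun K => Metric.diam (patch K) ^ 2 *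
    ∑ i, ∫ x in patch K, (g i x + ν * brokenLaplacian 𝒯 (U i) x) ^ 2 with ha
  set b : Finset (Finset Plane) → ℝ := fun K => Metric.diam (patch K) ^ 2 *
    ∑ i, bestApproxErrorSq (r - 1) (patch K) (g i) with hb
  set d : Finset (Finset Plane) → ℝ := fun K => gradNormOn (patch K) v.1 ^ 2 with hd
  have ha0 : ∀ K, 0 ≤ a K := fun K => mul_nonneg (sq_nonneg _)
    (Finset.sum_nonneg fun _ _ => integral_nonneg fun _ => sq_nonneg _)
  have hb0 : ∀ K, 0 ≤ b K := fun K => mul_nonneg (sq_nonneg _)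
    (Finset.sum_nonneg fun _ _ => bestApproxErrorSq_nonneg _ _ _)
  have hd0 : ∀ K, 0 ≤ d K := fun K => sq_nonneg _
  have h1 : ∀ K ∈ 𝒦, ν * ∑ i, inner ℝ (L i) (σ K i)
      ≤ |c| * (√(a K) * √(d K) + √(b K) * √(d K)) := by
    intro K hK
    obtain ⟨hvan, hnorm, horth⟩ := hσ K hK
    refine (patch_laplacian_le (h𝒦.subset K hK) (r - 1) ν g (σ K) L hvan horth).trans ?_
    simp only [e2 K hK]
    have hn0 : 0 ≤ gradNormOn (patch K) v.1 := Real.sqrt_nonneg _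
    have hnorm' : vecNorm (σ K) ≤ |c| * Metric.diam (patch K) * gradNormOn (patch K) v.1 :=
      hnorm.trans (by gcongr; exact le_abs_self c)
    refine (mul_le_mul_of_nonneg_left hnorm' (by positivity)).trans (le_of_eq ?_)
    simp only [ha, hb, hd]
    rw [Real.sqrt_mul (sq_nonneg _), Real.sqrt_mul (sq_nonneg _), Real.sqrt_sq Metric.diam_nonneg,
      Real.sqrt_sq hn0]
    ring
  have hA : √(∑ K ∈ 𝒦, a K) ≤ √((M : ℝ) ^ 3) * etaVol 𝒯 ν g U := by
    have he : 0 ≤ etaVol 𝒯 ν g U := Real.sqrt_nonneg _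
    rw [← Real.sqrt_sq he, ← Real.sqrt_mul (by positivity)]
    exact Real.sqrt_le_sqrt (h𝒦.sum_residual_sq_le ν g U)
  have hD : √(∑ K ∈ 𝒦, d K) ≤ √M * gradNorm v.1 := by
    rw [← Real.sqrt_sq (gradNorm_nonneg v.1), ← Real.sqrt_mul (by positivity)]
    exact Real.sqrt_le_sqrt (h𝒦.sum_gradNormOn_sq_le v.1)
  have hosc : oscPatch 𝒦 (r - 1) g = √(∑ K ∈ 𝒦, b K) := rfl
  calc ν * ∑ i, ∫ x in Ω, brokenLaplacian 𝒯 (U i) x * (vfn v.1 i x - hfn (R v) i x)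
      = ∑ K ∈ 𝒦, ν * ∑ i, inner ℝ (L i) (σ K i) := by
        simp only [e1]
        rw [Finset.sum_comm, Finset.mul_sum]
    _ ≤ ∑ K ∈ 𝒦, |c| * (√(a K) * √(d K) + √(b K) * √(d K)) := Finset.sum_le_sum h1
    _ = |c| * ((∑ K ∈ 𝒦, √(a K) * √(d K)) + ∑ K ∈ 𝒦, √(b K) * √(d K)) := by
        rw [← Finset.mul_sum, Finset.sum_add_distrib]
    _ ≤ |c| * (√(∑ K ∈ 𝒦, a K) * √(∑ K ∈ 𝒦, d K) + √(∑ K ∈ 𝒦, b K) * √(∑ K ∈ 𝒦, d K)) := by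
        gcongr
        · exact Real.sum_sqrt_mul_sqrt_le _ ha0 hd0
        · exact Real.sum_sqrt_mul_sqrt_le _ hb0 hd0
    _ = |c| * ((√(∑ K ∈ 𝒦, a K) + oscPatch 𝒦 (r - 1) g) * √(∑ K ∈ 𝒦, d K)) := by
        rw [hosc]; ring
    _ ≤ |c| * ((√((M : ℝ) ^ 3) * etaVol 𝒯 ν g U + oscPatch 𝒦 (r - 1) g)
          * (√M * gradNorm v.1)) := by
        have : 0 ≤ oscPatch 𝒦 (r - 1) g := Real.sqrt_nonneg _
        have : 0 ≤ etaVol 𝒯 ν g U := Real.sqrt_nonneg _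
        gcongr
    _ = _ := by ring

/-- A best approximation in a space of piecewise polynomials of bounded degree exists, since the
space is finite dimensional. -/
theorem FEPair.exists_best_approx (X : FEPair 𝒯 m) (q : L2 Ω) :
    ∃ qh ∈ X.Q, ∀ qh' ∈ X.Q, ‖q - qh‖ ≤ ‖q - qh'‖ := by
  have : FiniteDimensional ℝ X.Q := finiteDimensional_of_memPoly 𝒯 X.Q X.Q_poly
  refine ⟨X.Q.starProjection q, Submodule.starProjection_apply_mem _ _, fun w hw => ?_⟩
  rw [Submodule.starProjection_minimal]
  exact ciInf_le ⟨0, by rintro _ ⟨x, rfl⟩; exact norm_nonneg _⟩ (⟨w, hw⟩ : X.Q)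

theorem FEPair.abs_inner_divergence_le (X : FEPair 𝒯 m) (q : L2 Ω) {qh : L2 Ω} (hq : qh ∈ X.Q)
    {v : X.V} (hv : v ∈ X.V0) :
    |inner ℝ q (divergence v.1)| ≤ ‖q - qh‖ * gradNorm v.1 := by
  have : inner ℝ q (divergence v.1) = inner ℝ (q - qh) (divergence v.1) := by
    rw [inner_sub_left, hv qh hq, sub_zero]
  rw [this]
  exact (abs_real_inner_le_norm _ _).trans (mul_le_mul_of_nonneg_left
    (norm_divergence_le (X.V_boundary v.1 v.2)) (norm_nonneg _))

end Consistency

/-! ### Divergence of the discrete velocity -/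

theorem IsStokesSolution.norm_divergence_le {Ω : Set Plane} {𝒯 : Triangulation Ω} {m : ℕ} {ν : ℝ}
    {f : L2v Ω} {uD u : H1v Ω} {p : L2 Ω} (hsol : IsStokesSolution ν f uD u p) (X : FEPair 𝒯 m)
    {uDh uh : H1v Ω} (h : uh - uDh ∈ X.V) (hD : MemH10v (uD - uDh)) :
    ‖divergence uh‖ ≤ gradNorm (u - uh) := by
  have hmem : MemH10v (u - uh) := fun i => by
    have h3 := X.V_boundary _ (X.V.neg_mem h) i
    have := ((hsol.boundary i).add (hD i)).add h3
    convert this using 1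
    simp only [Pi.sub_apply, Pi.neg_apply]
    abel
  have hdiv : divergence (u - uh) = -divergence uh := by
    have : divergence (u - uh) = divergence u - divergence uh := by
      simp only [divergence, ← Finset.sum_sub_distrib]
      rfl
    rw [this, hsol.div_free, zero_sub]
  rw [← norm_neg, ← hdiv]
  exact StokesFE.norm_divergence_le hmem

end StokesFE

theorem mainTheorem9 (κ : ℝ) (m k : ℕ) :
    ∃ C : ℝ, 0 < C ∧ ∀ (M : ℕ) (c : ℝ), ∃ C' : ℝ, 0 < C' ∧
      ∀ (Ω : Set Plane) (𝒯 : Triangulation Ω), ShapeRegular 𝒯 κ →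
      ∀ ν : ℝ, 0 < ν →
      ∀ (f : L2v Ω) (uD u : H1v Ω) (p : L2 Ω), IsStokesSolution ν f uD u p →
      ∀ (X : FEPair 𝒯 m) (uDh uh : H1v Ω), (∀ i, MemPoly 𝒯 m (fn (uDh i))) → uh - uDh ∈ X.V →
      ∀ U : Fin 2 → Finset Plane → Poly2, IsPiecewiseV 𝒯 m U uh →
      ∀ R : X.V →ₗ[ℝ] Hdiv Ω,
        -- (a) divergence term, for exact boundary data
        (MemH10v (uD - uDh) → ‖divergence uh‖ ≤ gradNorm (u - uh)) ∧
        -- (b) volume term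
        (∀ q : H1 Ω,
          ν⁻¹ * etaVol 𝒯 ν (f - grad q) U ≤
            C * (gradNorm (u - uh) + ν⁻¹ * (‖p - fn q‖ + osc 𝒯 k (f - grad q)))) ∧
        -- (c) jump term, for a pressure in H¹
        (∀ (o : EdgeOrientation 𝒯) (p₁ : H1 Ω), fn p₁ = p →
          ν⁻¹ * etaJump o ν U ≤ C * (gradNorm (u - uh) + ν⁻¹ * osc 𝒯 k (f - grad p₁))) ∧
        -- (d) first consistency term, for a pressure in H¹
        (∀ p₁ : H1 Ω, fn p₁ = p →
          ∀ (𝒦 : Finset (Finset (Finset Plane))) (r : ℕ), 1 ≤ r → IsPatchFamily 𝒯 M 𝒦 →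
            LocallyOrthogonal X R 𝒦 r c →
            consistency1 X R U ≤ ENNReal.ofReal
              (C' * (gradNorm (u - uh) +
                ν⁻¹ * (osc 𝒯 k (f - grad p₁) + oscPatch 𝒦 (r - 1) (f - grad p₁))))) ∧
        -- (e) second consistency term
        ((MapsToDivFree X R →
            (∀ q : L2 Ω, consistency2 X R q = 0) ∧
            ((∀ v ∈ X.V0, ZeroNormalTrace (R v)) → ∀ q : H1 Ω, consistency2Grad X R q = 0)) ∧
         (IsIdentity X R →
            ∀ q : L2 Ω, ∃ qh ∈ X.Q, (∀ qh' ∈ X.Q, ‖q - qh‖ ≤ ‖q - qh'‖) ∧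
              consistency2 X R q ≤ ENNReal.ofReal ‖q - qh‖ ∧
              ∀ q₁ : H1 Ω, fn q₁ = q → consistency2Grad X R q₁ ≤ ENNReal.ofReal ‖q - qh‖)) := by
  obtain ⟨C₁, hC₁, hvol⟩ := exists_volume_bound κ m k
  obtain ⟨C₂, hC₂, hjump⟩ := exists_jump_bound κ m k
  refine ⟨C₁ + C₂, by positivity, fun M c => ?_⟩
  refine ⟨|c| * √M * (√((M : ℝ) ^ 3) * C₁ + 1) + 1, by positivity, ?_⟩
  intro Ω 𝒯 hreg ν hν f uD u p hsol X uDh uh _ huh U hU R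
  have hg := gradNorm_nonneg (u - uh)
  have hν' : 0 ≤ ν⁻¹ := (inv_pos.2 hν).le
  have hosc : ∀ g, 0 ≤ osc 𝒯 k g := osc_nonneg 𝒯 k
  -- the bounds in which `ν` multiplies the velocity error, divided by `ν`
  have hscale : ∀ {A D Y : ℝ}, A ≤ D * (ν * gradNorm (u - uh) + Y) →
      ν⁻¹ * A ≤ D * (gradNorm (u - uh) + ν⁻¹ * Y) := by
    intro A D Y h
    refine (mul_le_mul_of_nonneg_left h hν').trans (le_of_eq ?_)
    field_simp
  refine ⟨fun hD => hsol.norm_divergence_le X huh hD, fun q => ?_, fun o p₁ hp => ?_,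
    fun p₁ hp 𝒦 r _ h𝒦 horth => ?_, fun hR => ⟨fun q => ?_, fun hn q => ?_⟩, fun hR q => ?_⟩
  · refine (hscale (hvol Ω 𝒯 hreg ν hν f uD u p hsol uh U hU q)).trans ?_
    have := hosc (f - grad q)
    exact mul_le_mul_of_nonneg_right (by linarith) (by positivity)
  · subst hp
    refine (hscale (hjump Ω 𝒯 hreg ν hν f uD u p₁ hsol uh U hU o)).trans ?_
    have := hosc (f - grad p₁)
    exact mul_le_mul_of_nonneg_right (by linarith) (by positivity)
  · subst hp
    have hv := hvol Ω 𝒯 hreg ν hν f uD u (fn p₁) hsol uh U hU p₁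
    rw [sub_self, norm_zero, zero_add] at hv
    have h1 := hosc (f - grad p₁)
    have h2 : 0 ≤ oscPatch 𝒦 (r - 1) (f - grad p₁) := Real.sqrt_nonneg _
    refine FEPair.dualNorm_le (by positivity) fun v hv0 => ?_
    have h3 := horth.laplacian_le h𝒦 ν (f - grad p₁) U hv0
    rw [← inv_mul_cancel_left₀ hν.ne' (∑ i, _)]
    refine (mul_le_mul_of_nonneg_left h3 hν').trans ?_
    rw [← mul_assoc]
    refine mul_le_mul_of_nonneg_right (hscale ?_) (gradNorm_nonneg _)
    have h4 : √((M : ℝ) ^ 3) * etaVol 𝒯 ν (f - grad p₁) U + oscPatch 𝒦 (r - 1) (f - grad p₁)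
        ≤ (√((M : ℝ) ^ 3) * C₁ + 1) * (ν * gradNorm (u - uh)
          + (osc 𝒯 k (f - grad p₁) + oscPatch 𝒦 (r - 1) (f - grad p₁))) := by
      have h5 : 0 ≤ √((M : ℝ) ^ 3) * C₁ * oscPatch 𝒦 (r - 1) (f - grad p₁) := by positivity
      have h6 := mul_le_mul_of_nonneg_left hv (Real.sqrt_nonneg ((M : ℝ) ^ 3))
      have h7 : 0 ≤ ν * gradNorm (u - uh) := by positivity
      linarith
    have h8 := mul_le_mul_of_nonneg_left h4 (by positivity : 0 ≤ |c| * √M)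
    have h9 : 0 ≤ ν * gradNorm (u - uh)
        + (osc 𝒯 k (f - grad p₁) + oscPatch 𝒦 (r - 1) (f - grad p₁)) := by positivity
    linarith
  · exact FEPair.dualNorm_eq_zero fun v hv => by rw [hR v hv, inner_zero_right]
  · refine FEPair.dualNorm_eq_zero fun v hv => ?_
    have h1 := hn v hv q
    rw [hR v hv, inner_zero_left, add_zero] at h1
    rw [← h1]
    exact Finset.sum_congr rfl fun i _ => real_inner_comm _ _
  · have hd : ∀ v, hdiv (R v) = divergence v.1 := fun v =>
      hdiv_eq_divergence (isOpen_of_triangulation 𝒯) (hR v)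
    obtain ⟨qh, hqh, hmin⟩ := X.exists_best_approx q
    refine ⟨qh, hqh, hmin, ?_, fun q₁ hq₁ => ?_⟩
    · refine FEPair.dualNorm_le (norm_nonneg _) fun v hv => ?_
      rw [hd]
      exact (le_abs_self _).trans (X.abs_inner_divergence_le q hqh hv)
    · refine FEPair.dualNorm_le (norm_nonneg _) fun v hv => ?_
      rw [hR, vecInner_grad_vfn q₁ (X.V_boundary v.1 v.2), hq₁]
      exact (neg_le_abs _).trans (X.abs_inner_divergence_le q hqh hv)
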